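/- For $n\ge 2$ let $G_n$ be the $2n$-cycle with its $n$ diagonals, i.e. the 3-regular graph with vertex set $\{1,\dots,2n\}$ and edges $\{i,i+1 \bmod 2n\}$ ($1\le i\le 2n$) and $\{i,i+n\}$ ($1\le i\le n$). For a permutation $\sigma$ of $E(G_n)$ let $B(G_n,\sigma)$ be the bipartite graph with sides $V_B=V(G_n)\times\{0,1\}$ and $W_B=E(G_n)$, in which $(v,0)$ is adjacent to $e$ iff $v\in e$, and $(v,1)$ is adjacent to $e$ iff $v\in\sigma(e)$; every vertex of $V_B$ has degree 3. For a bipartite graph $B$ with sides $V,W$ in which every vertex of $V$ has degree 3, the multipede graph $R(B)$ has two vertices $a(w),b(w)$ for every $w\in W$ and four vertices $m_S(v)$ for every $v\in V$, one for each subset $S\subseteq N(v)$ of even size; its edges are the following: for all $v\in V$, $w\in N(v)$ and even $S\subseteq N(v)$, the vertex $m_S(v)$ is adjacent to $b(w)$ if $w\in S$ and to $a(w)$ if $w\notin S$. Such a $B$ is odd if for every nonempty $X\subseteq W$ there is $v\in V$ with $|X\cap N(v)|$ odd. A graph is rigid if its only automorphism is the identity. The second neighborhood of a vertex $x$ is the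 set of all vertices $u\ne x$ that have a common neighbor with $x$. Let $\sigma$ be a uniformly random permutation of $E(G_n)$. Then, as $n\to\infty$, the probability that $R(B(G_n,\sigma))$ is not rigid is $O\!\left(\frac{\log^2 n}{n}\right)$. Moreover, the probability that $B(G_n,\sigma)$ is not odd is $O\!\left(\frac{\log^2 n}{n}\right)$, the probability that $B(G_n,\sigma)$ is not rigid is $O\!\left(\frac1n\right)$, and the probability that there are two distinct vertices of $W_B$ with equal second neighborhoods in $B(G_n,\sigma)$ is $O\!\left(\frac1n\right)$. -/

import Mathlib

open Filter Asymptotics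

/-- A graph is rigid (asymmetric) if its only automorphism is the identity. -/
def IsRigid {V : Type*} (G : SimpleGraph V) : Prop :=
  ∀ φ : G ≃g G, ∀ v, φ v = v

/-- The second neighborhood of `v`: the vertices other than `v` that have a common neighbor
with `v`. -/
def secondNeighborhood {V : Type*} (G : SimpleGraph V) (v : V) : Set V :=
  {u | u ≠ v ∧ ∃ w, G.Adj v w ∧ G.Adj w u}

/-- The bipartite graph with sides `V` and `W` given by an incidence relation `E`. -/
def bipartiteGraph {V W : Type*} (E : V → W → Prop) : SimpleGraph (V ⊕ W) :=
  SimpleGraph.fromRel fun x y => ∃ v w, x = Sum.inl v ∧ y = Sum.inr w ∧ E v w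

/-- A bipartite graph is odd if every nonempty `X ⊆ W` meets the neighborhood of some
`v ∈ V` in an odd number of vertices. -/
def IsOddBipartite {V W : Type*} (E : V → W → Prop) : Prop :=
  ∀ X : Set W, X.Nonempty → ∃ v : V, Odd (X ∩ {w | E v w}).ncard

/-- No two distinct vertices of the side `W` have equal second neighborhoods. -/
def SecondNeighborhoodsDistinct {V W : Type*} (E : V → W → Prop) : Prop :=
  ∀ w₁ w₂ : W, w₁ ≠ w₂ →
    secondNeighborhood (bipartiteGraph E) (Sum.inr w₁) ≠
      secondNeighborhood (bipartiteGraph E) (Sum.inr w₂)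

/-- The inner vertices of the gadget that replaces `v`. If the neighbors of `v` are
`w₁, w₂, w₃`, then the inner vertex `m_i(v)`, where `i ∈ {0,1}³` has an even number of ones,
is indexed by the even subset `{w_j | i_j = 1}` of the neighborhood of `v`; so no order of the
neighbors has to be chosen. -/
def InnerVertex {V W : Type*} (E : V → W → Prop) (v : V) : Type _ :=
  {S : Finset W // (∀ w ∈ S, E v w) ∧ Even S.card}

/-- The multipede graph `R(G)` of a bipartite graph `G` in which every vertex of `V` has
degree 3. The vertex `Sum.inr (w, false)` is `a(w)` and `Sum.inr (w, true)` is `b(w)`.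
For each neighbor `w` of `v`, the inner vertex of `v` with index `S` is joined to `b(w)` if
`w ∈ S`, and to `a(w)` otherwise. -/
def multipede {V W : Type*} (E : V → W → Prop) :
    SimpleGraph ((Σ v : V, InnerVertex E v) ⊕ (W × Bool)) :=
  SimpleGraph.fromRel fun x y => ∃ (v : V) (S : InnerVertex E v) (w : W) (c : Bool),
    x = Sum.inl ⟨v, S⟩ ∧ y = Sum.inr (w, c) ∧ E v w ∧ (c = true ↔ w ∈ S.1)

/-- The bipartite graph `B(G, σ)`: its sides are `V(G) × {0,1}` and `E(G)`, the vertex `(v, 0)`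
is adjacent to `e` if `v ∈ e`, and `(v, 1)` is adjacent to `e` if `v ∈ σ e`. -/
def baseIncidence {V : Type*} (G : SimpleGraph V) (σ : Equiv.Perm G.edgeSet) :
    V × Fin 2 → G.edgeSet → Prop :=
  fun x e => (x.2 = 0 ∧ x.1 ∈ (e : Sym2 V)) ∨ (x.2 = 1 ∧ x.1 ∈ (σ e : Sym2 V))

/-- The graph `G_n`: the cycle on the `2n` vertices `0, …, 2n - 1`, with the `n` diagonals
joining `i` and `i + n` added. -/
def cycleWithDiagonals (n : ℕ) : SimpleGraph (Fin (2 * n)) :=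
  SimpleGraph.cycleGraph (2 * n) ⊔ SimpleGraph.fromRel fun i j => (j : ℕ) = (i : ℕ) + n

/-- The probability that a uniformly random permutation of a finite type satisfies `P`. -/
noncomputable def permProb {α : Type*} (P : Equiv.Perm α → Prop) : ℝ :=
  ({σ | P σ}.ncard : ℝ) / (Nat.card (Equiv.Perm α) : ℝ)

/-! The deterministic core is `isRigid_multipede`. The vertices `a(w)` and `b(w)` have the same
second neighborhood, so distinct second neighborhoods in the base graph force an automorphism of the
multipede to permute the pairs `{a(w), b(w)}`. It then induces an automorphism of the base graph,
which is trivial by rigidity. What remains is a set of flipped pairs that meets every neighborhood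
evenly, and oddness makes it empty. Hence three bad events have to be bounded. All of them turn out
to have probability `O(1/n)`, which is stronger than the bound with the squared logarithm.

The common tool is sparsity (`IsSparse`): with probability `1 - O(1/n)`, no bounded set of `k` edges
can be covered by fewer than `k` balls of bounded radius, counted over both layers. Indeed fewer
than `k` centres give at most `O(n^(k-1))` choices, against a probability of order `n^(-k)`. Equal
second neighborhoods would put six edges into four balls.

For the rigidity of the base graph, an automorphism sends each vertex of a layer to some layer.
Sparsity keeps the squares that meet both target layers far apart (`isMono_add`). Between them the
automorphism is locally a map `x ↦ ± x + b`, since the only 4-cycles of the Möbius ladder are its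
squares. With `t` exceptional squares there are at most about `n^(4t+2)` descriptions of this kind
for the two layers together, while each of them imposes `7t` constraints on `σ` (three if `t = 0`),
each satisfied with probability at most `2/n` given the earlier ones (`permProb_transported_le`).

For oddness, a violating set is an even edge set whose image under `σ` is even as well. A transfer
matrix bounds the number of even sets of size `k < n`; for `k ≥ n` the trivial count `2^(n+1)` is
enough. The square of the count, divided by the number of `k`-sets of edges, sums to `O(1/n)`. -/

section PermProb

/-! ### Union bounds and elementary probabilities for random permutations. -/

variable {α : Type*} [Fintype α]

theorem permProb_eq (P : Equiv.Perm α → Prop) :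
    permProb P = ({σ | P σ}.ncard : ℝ) / ((Fintype.card α).factorial : ℝ) := by
  rw [permProb, Nat.card_perm, Nat.card_eq_fintype_card]

theorem permProb_mono {P Q : Equiv.Perm α → Prop} (h : ∀ σ, P σ → Q σ) :
    permProb P ≤ permProb Q := by
  classical
  rw [permProb_eq, permProb_eq]
  have : {σ | P σ}.ncard ≤ {σ | Q σ}.ncard := Set.ncard_le_ncard (fun σ => h σ) (Set.toFinite _)
  gcongr

theorem permProb_or_le (P Q : Equiv.Perm α → Prop) :
    permProb (fun σ => P σ ∨ Q σ) ≤ permProb P + permProb Q := by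
  classical
  rw [permProb_eq, permProb_eq, permProb_eq, ← add_div]
  have : {σ | P σ ∨ Q σ}.ncard ≤ {σ | P σ}.ncard + {σ | Q σ}.ncard :=
    Set.ncard_union_le {σ | P σ} {σ | Q σ}
  gcongr
  exact_mod_cast this

theorem permProb_false : permProb (fun _ : Equiv.Perm α => False) = 0 := by
  simp [permProb_eq]

theorem permProb_eq_zero {P : Equiv.Perm α → Prop} (h : ∀ σ, ¬ P σ) : permProb P = 0 := by
  have : P = fun _ => False := by ext σ; simp [h σ]
  rw [this, permProb_false]

theorem permProb_exists_le {ι : Type*} (s : Finset ι) (P : ι → Equiv.Perm α → Prop) :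
    permProb (fun σ => ∃ i ∈ s, P i σ) ≤ ∑ i ∈ s, permProb (P i) := by
  classical
  induction s using Finset.induction_on with
  | empty => simp [permProb_false]
  | insert a s ha ih =>
    rw [Finset.sum_insert ha]
    refine le_trans (permProb_mono (Q := fun σ => P a σ ∨ ∃ i ∈ s, P i σ) ?_)
      ((permProb_or_le _ _).trans (by gcongr))
    rintro σ ⟨i, hi, h⟩
    rcases Finset.mem_insert.1 hi with rfl | hi
    · exact Or.inl h
    · exact Or.inr ⟨i, hi, h⟩

theorem permProb_le_card_mul {ι : Type*} (s : Finset ι) (P : ι → Equiv.Perm α → Prop)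
    {c : ℝ} (h : ∀ i ∈ s, permProb (P i) ≤ c) :
    permProb (fun σ => ∃ i ∈ s, P i σ) ≤ s.card * c := by
  refine (permProb_exists_le s P).trans ((Finset.sum_le_card_nsmul s _ c h).trans ?_)
  rw [nsmul_eq_mul]

/-- The permutations in question are none, or a coset of the pointwise stabilizer of `S`, which is
the symmetric group of the complement. -/
theorem permProb_eqOn_le (S : Finset α) (p : α → α) :
    permProb (fun σ : Equiv.Perm α => ∀ e ∈ S, σ e = p e) ≤
      ((Fintype.card α - S.card).factorial : ℝ) / (Fintype.card α).factorial := by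
  classical
  rw [permProb_eq]
  gcongr
  by_cases h : ∃ σ₀ : Equiv.Perm α, ∀ e ∈ S, σ₀ e = p e
  swap
  · have : {σ : Equiv.Perm α | ∀ e ∈ S, σ e = p e} = ∅ := by
      ext σ; simp only [Set.mem_ofPred_eq, Set.mem_empty_iff_false, iff_false]
      exact fun hσ => h ⟨σ, hσ⟩
    rw [this]; simp
  obtain ⟨σ₀, h₀⟩ := h
  have hcard : Nat.card { f : Equiv.Perm α // ∀ a, ¬ a ∉ S → f a = a } =
      (Fintype.card α - S.card).factorial := by
    rw [← Nat.card_congr (Equiv.Perm.subtypeEquivSubtypePerm (fun a => a ∉ S)), Nat.card_perm,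
      Nat.card_eq_fintype_card, Fintype.card_subtype_compl]
    simp
  rw [← hcard, ← Nat.card_coe_set_eq]
  refine Nat.card_le_card_of_injective
    (fun σ => ⟨σ₀⁻¹ * σ.1, fun a ha => ?_⟩) ?_
  · have ha : a ∈ S := by simpa using ha
    have := σ.2 a ha
    simp only [Equiv.Perm.mul_apply, this, ← h₀ a ha]
    exact σ₀.symm_apply_apply a
  · rintro ⟨σ, _⟩ ⟨τ, _⟩ h
    simpa using h

/-- The probability that a uniformly random permutation maps one given `k`-set to another. -/
theorem permProb_image_eq_le [DecidableEq α] (X Y : Finset α) :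
    permProb (fun σ : Equiv.Perm α => X.image σ = Y) ≤
      1 / ((Fintype.card α).choose X.card : ℝ) := by
  by_cases hc : Y.card = X.card
  swap
  · rw [permProb_eq_zero]
    · positivity
    · intro σ h
      exact hc (by rw [← h, Finset.card_image_of_injective _ σ.injective])
  -- By symmetry all targets of the right size are equally likely: compose with a permutation that
  -- carries `Y` to `Y'`.
  have hinv : ∀ Y' ∈ Finset.powersetCard X.card (Finset.univ : Finset α),
      permProb (fun σ : Equiv.Perm α => X.image σ = Y) =
        permProb (fun σ : Equiv.Perm α => X.image σ = Y') := by
    intro Y' hY'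
    have hY' : Y'.card = X.card := (Finset.mem_powersetCard.1 hY').2
    obtain ⟨τ, hτ⟩ : ∃ τ : Equiv.Perm α, Y.image τ = Y' := by
      have e : {x // x ∈ Y} ≃ {x // x ∈ Y'} := Fintype.equivOfCardEq (by simp [hc, hY'])
      refine ⟨e.extendSubtype, ?_⟩
      apply Finset.eq_of_subset_of_card_le
      · intro y hy
        obtain ⟨x, hx, rfl⟩ := Finset.mem_image.1 hy
        rw [Equiv.extendSubtype_apply_of_mem e x hx]
        exact (e ⟨x, hx⟩).2
      · rw [Finset.card_image_of_injective _ (Equiv.injective _)]; omega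
    rw [permProb_eq, permProb_eq]
    congr 2
    refine Set.ncard_congr (fun σ _ => τ * σ) ?_ ?_ ?_
    · intro σ hσ
      simp only [Set.mem_ofPred_eq] at hσ ⊢
      rw [← hτ, ← hσ, Finset.image_image]; rfl
    · intro _ _ _ _ h
      exact mul_left_cancel h
    · intro σ hσ
      refine ⟨τ⁻¹ * σ, ?_, by simp⟩
      simp only [Set.mem_ofPred_eq] at hσ ⊢
      apply Finset.image_injective τ.injective
      rw [hτ, ← hσ, Finset.image_image]
      congr 1
      ext x; simp
  -- The events for different targets are disjoint.
  have htot : ∑ Y' ∈ Finset.powersetCard X.card (Finset.univ : Finset α),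
      permProb (fun σ : Equiv.Perm α => X.image σ = Y') ≤ 1 := by
    simp only [permProb_eq]
    rw [← Finset.sum_div, div_le_one (by positivity), ← Nat.cast_sum, Nat.cast_le,
      ← Fintype.card_perm, ← Nat.card_eq_fintype_card, ← Set.ncard_univ]
    simp only [Set.ncard_eq_toFinset_card']
    rw [← Finset.card_biUnion]
    · apply Finset.card_le_card
      intro σ _
      simp
    · intro A _ B _ hAB
      rw [Function.onFun, Finset.disjoint_left]
      intro σ h1 h2
      simp only [Set.mem_toFinset, Set.mem_ofPred_eq] at h1 h2
      exact hAB (h1 ▸ h2)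
  rw [← Finset.sum_congr rfl hinv, Finset.sum_const, Finset.card_powersetCard, Finset.card_univ,
    nsmul_eq_mul] at htot
  have hpos : (0 : ℝ) < (Fintype.card α).choose X.card := by
    exact_mod_cast Nat.choose_pos (Finset.card_le_univ X)
  rw [le_div_iff₀ hpos, mul_comm]
  exact htot

/-- With `a` values still free, either one more value is forced, or for each of `a` choices a second
one is. Relative to `a!` this is `1/a + 1/(a-1) ≤ 2/D`. -/
theorem descend_factorial_bound {a D : ℕ} (h : D + 1 ≤ a) :
    (((a - 1).factorial : ℝ) + a * ((a - 2).factorial : ℝ)) * D ≤ 2 * a.factorial := by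
  rcases a with _ | _ | a
  · omega
  · have : D = 0 := by omega
    subst this; simp
  · simp only [Nat.add_sub_cancel, Nat.factorial_succ, Nat.reduceSubDiff]
    have : (D : ℝ) ≤ a + 1 := by exact_mod_cast (by omega : D ≤ a + 1)
    push_cast
    have hf : (0 : ℝ) < a.factorial := by positivity
    have h1 : ((a : ℝ) + 1 + (a + 2)) * D ≤ 2 * ((a + 2) * (a + 1)) := by nlinarith
    calc (((a : ℝ) + 1) * a.factorial + (a + 1 + 1) * a.factorial) * D
        = (((a : ℝ) + 1 + (a + 2)) * D) * a.factorial := by ring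
      _ ≤ (2 * ((a + 2) * (a + 1))) * a.factorial := by gcongr
      _ = _ := by ring

end PermProb

/-! ### Permutations that transport a partial structure. -/

section Twisted

variable {α : Type*} [Fintype α]

/-- The permutation `σ` carries the partial structure `Θ` to the partial structure `Γ` at `e`,
where the flag tells whether the structure is preserved or reversed. -/
def IsTransported (Θ Γ : α → Option (Fin 2 × α)) (σ : Equiv.Perm α) (e : α) : Prop :=
  (∃ x, Θ e = some (0, x) ∧ x ≠ e ∧ Γ (σ e) = some (0, σ x)) ∨
    ∃ y, Θ e = some (1, σ y) ∧ Γ (σ e) = some (1, y)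

/-- Reveal `σ` gradually, with `S` the set of points already revealed. Each constraint at a new
point of `M` uses up at most two further points and costs a factor `2/D`, as long as more than `D`
values are free. Hence the budget `2 * k`. -/
theorem permProb_transported_aux [DecidableEq α] (Θ Γ : α → Option (Fin 2 × α))
    (hΓ : ∀ f g, Γ f = Γ g → Γ f ≠ none → f = g) (M : Finset α) (D : ℕ) (k : ℕ) :
    ∀ (S : Finset α) (p : α → α), S.card + 2 * k ≤ M.card →
      S.card + 2 * k + D ≤ Fintype.card α → 0 < D →
      permProb (fun σ : Equiv.Perm α => (∀ e ∈ S, σ e = p e) ∧ ∀ e ∈ M, IsTransported Θ Γ σ e) ≤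
        ((Fintype.card α - S.card).factorial : ℝ) / (Fintype.card α).factorial * (2 / D) ^ k := by
  induction k with
  | zero =>
    intro S p _ _ _
    rw [pow_zero, mul_one]
    exact (permProb_mono fun σ h => h.1).trans (permProb_eqOn_le S p)
  | succ k ih =>
    intro S p hM hN hD
    set N := Fintype.card α with hNdef
    have hD' : (0 : ℝ) < D := by exact_mod_cast hD
    obtain ⟨e, heM, heS⟩ : ∃ e ∈ M, e ∉ S := by
      apply Finset.exists_mem_notMem_of_card_lt_card; omega
    have step1 : ∀ f, permProb (fun σ : Equiv.Perm α =>
        ((∀ e ∈ S, σ e = p e) ∧ ∀ e ∈ M, IsTransported Θ Γ σ e) ∧ σ e = f) ≤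
        ((N - S.card - 1).factorial : ℝ) / N.factorial * (2 / D) ^ k := by
      intro f
      refine (permProb_mono ?_).trans
        ((ih (insert e S) (Function.update p e f) ?_ ?_ hD).trans_eq ?_)
      · rintro σ ⟨⟨h1, h2⟩, h3⟩
        refine ⟨fun x hx => ?_, h2⟩
        rcases Finset.mem_insert.1 hx with rfl | hx
        · simpa using h3
        · rw [Function.update_of_ne (ne_of_mem_of_not_mem hx heS)]; exact h1 x hx
      · rw [Finset.card_insert_of_notMem heS]; omega
      · rw [Finset.card_insert_of_notMem heS]; omega
      · rw [Finset.card_insert_of_notMem heS, Nat.sub_add_eq]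
    have step2 : ∀ x f g, x ∉ S → x ≠ e → permProb (fun σ : Equiv.Perm α =>
        ((∀ e ∈ S, σ e = p e) ∧ ∀ e ∈ M, IsTransported Θ Γ σ e) ∧ σ e = f ∧ σ x = g) ≤
        ((N - S.card - 2).factorial : ℝ) / N.factorial * (2 / D) ^ k := by
      intro x f g hx hxe
      have hcard : (insert x (insert e S)).card = S.card + 2 := by
        rw [Finset.card_insert_of_notMem (by simp [hx, hxe]), Finset.card_insert_of_notMem heS]
      refine (permProb_mono ?_).trans
        ((ih (insert x (insert e S)) (Function.update (Function.update p e f) x g)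
          ?_ ?_ hD).trans_eq ?_)
      · rintro σ ⟨⟨h1, h2⟩, h3, h4⟩
        refine ⟨fun z hz => ?_, h2⟩
        rcases Finset.mem_insert.1 hz with rfl | hz
        · simpa using h4
        · rcases Finset.mem_insert.1 hz with rfl | hz
          · rw [Function.update_of_ne hxe.symm]; simpa using h3
          · rw [Function.update_of_ne (ne_of_mem_of_not_mem hz hx),
              Function.update_of_ne (ne_of_mem_of_not_mem hz heS)]
            exact h1 z hz
      · rw [hcard]; omega
      · rw [hcard]; omega
      · rw [hcard, Nat.sub_add_eq]
    set a := N - S.card with ha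
    set E : Equiv.Perm α → Prop := fun σ => (∀ e ∈ S, σ e = p e) ∧ ∀ e ∈ M, IsTransported Θ Γ σ e
      with hE
    rcases em (∃ σ, E σ) with ⟨σ₀, hσ₀⟩ | hno
    swap
    · rw [permProb_eq_zero fun σ h => hno ⟨σ, h⟩]; positivity
    set T : Finset α := Finset.univ \ S.image p with hT
    have hTcard : T.card = a := by
      rw [hT, Finset.card_sdiff_of_subset (Finset.subset_univ _), Finset.card_univ,
        Finset.card_image_of_injOn]
      intro x hx y hy hxy
      apply σ₀.injective
      rw [hσ₀.1 x hx, hσ₀.1 y hy]; exact hxy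
    -- Either `σ e` is already forced to be `f₀`, or its value forces the value of `σ` at one more
    -- unrevealed point.
    have main : ∃ (f₀ : α) (X G : α → α), ∀ σ, E σ →
        σ e = f₀ ∨ (X (σ e) ∉ S ∧ X (σ e) ≠ e ∧ σ (X (σ e)) = G (σ e)) := by
      rcases hΘ : Θ e with _ | ⟨c, x⟩
      · exfalso
        rcases hσ₀.2 e heM with ⟨x, h, _⟩ | ⟨y, h, _⟩ <;> simp [hΘ] at h
      have uniq : ∀ z : Fin 2 × α, ∃ f₀, ∀ f, Γ f = some z → f = f₀ := by
        intro z
        rcases em (∃ f, Γ f = some z) with ⟨f, hf⟩ | h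
        · exact ⟨f, fun g hg => hΓ g f (hg.trans hf.symm) (by simp [hg])⟩
        · exact ⟨e, fun g hg => (h ⟨g, hg⟩).elim⟩
      have hc : c = 0 ∨ c = 1 := by omega
      rcases hc with rfl | rfl
      · by_cases hx : x ∈ S
        · obtain ⟨f₀, hf₀⟩ := uniq (0, p x)
          refine ⟨f₀, id, id, fun σ hσ => Or.inl (hf₀ _ ?_)⟩
          rcases hσ.2 e heM with ⟨x', h, _, h'⟩ | ⟨y, h, _⟩
          · rw [hΘ] at h
            simp only [Option.some.injEq, Prod.mk.injEq, true_and] at h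
            rw [h', ← h, hσ.1 x hx]
          · simp [hΘ] at h
        -- Here `σ x` is read off from `Γ (σ e)`. The candidate `f₀ = e` and the default `(0, e)`
        -- are dummies.
        · refine ⟨e, fun _ => x, fun f => ((Γ f).getD (0, e)).2, fun σ hσ => Or.inr ?_⟩
          rcases hσ.2 e heM with ⟨x', h, hne, h'⟩ | ⟨y, h, _⟩
          · rw [hΘ] at h
            simp only [Option.some.injEq, Prod.mk.injEq, true_and] at h
            subst h
            exact ⟨hx, hne, by simp [h']⟩
          · simp [hΘ] at h
      · by_cases hx : x ∈ S.image p
        · obtain ⟨s, hs, rfl⟩ := Finset.mem_image.1 hx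
          obtain ⟨f₀, hf₀⟩ := uniq (1, s)
          refine ⟨f₀, id, id, fun σ hσ => Or.inl (hf₀ _ ?_)⟩
          rcases hσ.2 e heM with ⟨x', h, _, h'⟩ | ⟨y, h, h'⟩
          · simp [hΘ] at h
          · rw [hΘ] at h
            simp only [Option.some.injEq, Prod.mk.injEq, true_and] at h
            rw [← hσ.1 s hs] at h
            rw [h', σ.injective h]
        -- Here `Γ (σ e)` names the preimage `y` of `x`. It is unrevealed, because `x` is not a
        -- revealed value; if it is `e` itself, then `σ e = x`.
        · refine ⟨x, fun f => ((Γ f).getD (0, e)).2, fun _ => x, fun σ hσ => ?_⟩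
          rcases hσ.2 e heM with ⟨x', h, _, h'⟩ | ⟨y, h, h'⟩
          · simp [hΘ] at h
          · rw [hΘ] at h
            simp only [Option.some.injEq, Prod.mk.injEq, true_and] at h
            by_cases hye : y = e
            · left; rw [h, hye]
            · right
              simp only [h', Option.getD_some]
              refine ⟨fun hyS => hx ?_, hye, h.symm⟩
              rw [h, hσ.1 y hyS]
              exact Finset.mem_image_of_mem _ hyS
    obtain ⟨f₀, X, G, main⟩ := main
    have hcover : permProb E ≤ permProb (fun σ => E σ ∧ σ e = f₀) +
        permProb (fun σ => ∃ f ∈ T, (X f ∉ S ∧ X f ≠ e) ∧ E σ ∧ σ e = f ∧ σ (X f) = G f) := by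
      refine (permProb_mono ?_).trans (permProb_or_le _ _)
      intro σ hσ
      rcases main σ hσ with h | ⟨h1, h2, h3⟩
      · exact Or.inl ⟨hσ, h⟩
      · refine Or.inr ⟨σ e, ?_, ⟨h1, h2⟩, hσ, rfl, h3⟩
        simp only [hT, Finset.mem_sdiff, Finset.mem_univ, true_and, Finset.mem_image, not_exists,
          not_and]
        intro z hz hze
        rw [← hσ.1 z hz] at hze
        exact heS (σ.injective hze ▸ hz)
    have hsecond := permProb_le_card_mul T
      (fun f σ => (X f ∉ S ∧ X f ≠ e) ∧ E σ ∧ σ e = f ∧ σ (X f) = G f)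
      (c := ((a - 2).factorial : ℝ) / N.factorial * (2 / D) ^ k) (by
        intro f _
        by_cases hX : X f ∉ S ∧ X f ≠ e
        · exact (permProb_mono fun σ h => h.2).trans (step2 (X f) f (G f) hX.1 hX.2)
        · rw [permProb_eq_zero fun σ h => hX h.1]; positivity)
    rw [hTcard] at hsecond
    have hfact := descend_factorial_bound (a := a) (D := D) (by omega)
    calc permProb E ≤ _ := hcover
      _ ≤ ((a - 1).factorial : ℝ) / N.factorial * (2 / D) ^ k +
          a * (((a - 2).factorial : ℝ) / N.factorial * (2 / D) ^ k) :=
        add_le_add (step1 f₀) hsecond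
      _ = ((((a - 1).factorial : ℝ) + a * ((a - 2).factorial : ℝ)) * D) / D / N.factorial *
          (2 / D) ^ k := by
        field_simp
      _ ≤ (2 * a.factorial) / D / N.factorial * (2 / D) ^ k := by gcongr
      _ = (a.factorial : ℝ) / N.factorial * (2 / D) ^ (k + 1) := by
        rw [pow_succ]; field_simp

/-- A permutation that transports a structure with at least `2 * k` moved points is unlikely. -/
theorem permProb_transported_le (Θ Γ : α → Option (Fin 2 × α))
    (hΓ : ∀ f g, Γ f = Γ g → Γ f ≠ none → f = g) (M : Finset α) {D k : ℕ}
    (hM : 2 * k ≤ M.card) (hN : 2 * k + D ≤ Fintype.card α) (hD : 0 < D) :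
    permProb (fun σ : Equiv.Perm α => ∀ e ∈ M, IsTransported Θ Γ σ e) ≤ (2 / D : ℝ) ^ k := by
  classical
  refine (permProb_mono fun σ h => ?_).trans
    ((permProb_transported_aux Θ Γ hΓ M D k ∅ id (by simpa using hM) (by simpa using hN)
      hD).trans_eq ?_)
  · exact ⟨by simp, h⟩
  · rw [Finset.card_empty, Nat.sub_zero, div_self (by positivity), one_mul]

end Twisted

/-! ### The Möbius ladder: edges and short cycles. -/

/-- The Möbius ladder on `ZMod (2 * n)`. -/
def ladder (n : ℕ) : SimpleGraph (ZMod (2 * n)) where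
  Adj u v := u ≠ v ∧ (v = u + 1 ∨ u = v + 1 ∨ v = u + n)
  symm := ⟨by
    rintro u v ⟨h, h' | h' | h'⟩
    · exact ⟨h.symm, Or.inr (Or.inl h')⟩
    · exact ⟨h.symm, Or.inl h'⟩
    · refine ⟨h.symm, Or.inr (Or.inr ?_)⟩
      have : ((2 * n : ℕ) : ZMod (2 * n)) = 0 := ZMod.natCast_self _
      push_cast at this
      rw [h']; linear_combination -this⟩
  loopless := ⟨fun u h => h.1 rfl⟩

section Ladder

variable {n : ℕ}

theorem two_mul_natCast_zmod (n : ℕ) : (2 * n : ZMod (2 * n)) = 0 := by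
  have : ((2 * n : ℕ) : ZMod (2 * n)) = 0 := ZMod.natCast_self _
  exact_mod_cast this

/-- This turns an identity between short displacements (`a` along the rim, `b` across rungs) into
integer arithmetic: a multiple of `n` smaller than `n` vanishes, and then `b * n` is a multiple of
`2 * n`. -/
theorem intCast_add_mul_eq_zero {a b : ℤ} (ha : |a| < n)
    (h : (a + b * n : ZMod (2 * n)) = 0) : a = 0 ∧ Even b := by
  have h1 : ((a + b * n : ℤ) : ZMod (2 * n)) = 0 := by push_cast; exact h
  rw [ZMod.intCast_zmod_eq_zero_iff_dvd] at h1
  push_cast at h1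
  have h2 : (n : ℤ) ∣ a := by
    have : (n : ℤ) ∣ a + b * n := (Dvd.intro_left _ rfl).trans h1
    exact (Int.dvd_add_left (Dvd.intro_left _ rfl)).1 this
  have h3 : a = 0 := Int.eq_zero_of_abs_lt_dvd h2 ha
  refine ⟨h3, ?_⟩
  subst h3
  rw [zero_add] at h1
  have hn : (n : ℤ) ≠ 0 := by
    intro h0; simp [h0] at ha
  exact even_iff_two_dvd.2 (Int.dvd_of_mul_dvd_mul_right hn h1)

variable [hn : Fact (6 ≤ n)]

instance : NeZero n := ⟨by have := hn.out; omega⟩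

theorem zmod_ne {a b : ℤ} (ha : |a| < 6) (h : a ≠ 0 ∨ Odd b) :
    (a + b * n : ZMod (2 * n)) ≠ 0 := by
  intro h0
  have := hn.out
  obtain ⟨h1, h2⟩ := intCast_add_mul_eq_zero (by omega) h0
  rcases h with h | h
  · exact h h1
  · exact (Int.not_even_iff_odd.2 h) h2

theorem zmod_one_ne : (1 : ZMod (2 * n)) ≠ 0 := by
  simpa using zmod_ne (n := n) (a := 1) (b := 0) (by norm_num) (by norm_num)

theorem zmod_two_ne : (2 : ZMod (2 * n)) ≠ 0 := by
  simpa using zmod_ne (n := n) (a := 2) (b := 0) (by norm_num) (by norm_num)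

theorem zmod_half_ne : (n : ZMod (2 * n)) ≠ 0 := by
  simpa using zmod_ne (n := n) (a := 0) (b := 1) (by norm_num) (by norm_num)

theorem zmod_half_add_one_ne : (1 + n : ZMod (2 * n)) ≠ 0 := by
  simpa using zmod_ne (n := n) (a := 1) (b := 1) (by norm_num) (by norm_num)

theorem zmod_half_sub_one_ne : (-1 + n : ZMod (2 * n)) ≠ 0 := by
  simpa using zmod_ne (n := n) (a := -1) (b := 1) (by norm_num) (by norm_num)

theorem ladder_adj {u v : ZMod (2 * n)} :
    (ladder n).Adj u v ↔ v = u + 1 ∨ u = v + 1 ∨ v = u + n := by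
  refine ⟨fun h => h.2, fun h => ⟨?_, h⟩⟩
  rintro rfl
  rcases h with h | h | h
  · exact zmod_one_ne (n := n) (by linear_combination -h)
  · exact zmod_one_ne (n := n) (by linear_combination -h)
  · exact zmod_half_ne (n := n) (by linear_combination -h)

/-- The edge joining `x` and `x + 1`. -/
def rim (x : ZMod (2 * n)) : (ladder n).edgeSet :=
  ⟨s(x, x + 1), by rw [SimpleGraph.mem_edgeSet, ladder_adj]; exact Or.inl rfl⟩

/-- The edge joining `x` and its antipode. -/
def rung (x : ZMod (2 * n)) : (ladder n).edgeSet :=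
  ⟨s(x, x + n), by rw [SimpleGraph.mem_edgeSet, ladder_adj]; exact Or.inr (Or.inr rfl)⟩

theorem mem_rim {x v : ZMod (2 * n)} : v ∈ (rim x : Sym2 (ZMod (2 * n))) ↔ v = x ∨ v = x + 1 := by
  simp [rim]

theorem mem_rung {x v : ZMod (2 * n)} :
    v ∈ (rung x : Sym2 (ZMod (2 * n))) ↔ v = x ∨ v = x + n := by
  simp [rung]

theorem rim_injective : Function.Injective (rim : ZMod (2 * n) → (ladder n).edgeSet) := by
  intro x y h
  have h := congrArg Subtype.val h
  simp only [rim, Sym2.eq_iff] at h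
  rcases h with h | ⟨h1, h2⟩
  · exact h.1
  · exact (zmod_two_ne (n := n) (by linear_combination h2 - h1)).elim

theorem rim_ne_rung (x y : ZMod (2 * n)) : rim x ≠ rung y := by
  intro h
  have h := congrArg Subtype.val h
  simp only [rim, rung, Sym2.eq_iff] at h
  rcases h with ⟨h1, h2⟩ | ⟨h1, h2⟩
  · exact zmod_half_sub_one_ne (n := n) (by linear_combination h1 - h2)
  · exact zmod_half_add_one_ne (n := n) (by linear_combination h2 - h1)

theorem rung_add (x : ZMod (2 * n)) : rung (x + (n : ZMod (2 * n))) = rung x := by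
  apply Subtype.ext
  simp only [rung, Sym2.eq_iff]
  right
  exact ⟨trivial, by linear_combination two_mul_natCast_zmod n⟩

theorem rung_eq_iff {x y : ZMod (2 * n)} : rung x = rung y ↔ x = y ∨ x = y + n := by
  constructor
  · intro h
    have : x ∈ (rung y : Sym2 (ZMod (2 * n))) := by rw [← h, mem_rung]; exact Or.inl rfl
    exact mem_rung.1 this
  · rintro (rfl | rfl)
    · rfl
    · exact rung_add y

theorem edge_cases (e : (ladder n).edgeSet) : (∃ x, e = rim x) ∨ ∃ x, e = rung x := by
  obtain ⟨e, he⟩ := e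
  induction e using Sym2.ind with
  | h u v =>
    have he' := he
    rw [SimpleGraph.mem_edgeSet, ladder_adj] at he'
    rcases he' with rfl | rfl | rfl
    · exact Or.inl ⟨u, rfl⟩
    · exact Or.inl ⟨v, Subtype.ext Sym2.eq_swap⟩
    · exact Or.inr ⟨u, rfl⟩

theorem mem_edge_iff {e : (ladder n).edgeSet} {v : ZMod (2 * n)} :
    v ∈ (e : Sym2 (ZMod (2 * n))) ↔ e = rim v ∨ e = rim (v - 1) ∨ e = rung v := by
  constructor
  · intro h
    rcases edge_cases e with ⟨x, rfl⟩ | ⟨x, rfl⟩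
    · rcases mem_rim.1 h with rfl | rfl
      · exact Or.inl rfl
      · right; left; congr 1; ring
    · rcases mem_rung.1 h with rfl | rfl
      · exact Or.inr (Or.inr rfl)
      · exact Or.inr (Or.inr (rung_add x).symm)
  · rintro (rfl | rfl | rfl)
    · exact mem_rim.2 (Or.inl rfl)
    · exact mem_rim.2 (Or.inr (by ring))
    · exact mem_rung.2 (Or.inl rfl)

theorem rim_ne_rim_sub_one (v : ZMod (2 * n)) : rim v ≠ rim (v - 1) := fun h =>
  zmod_one_ne (n := n) (by linear_combination rim_injective h)

theorem edges_at (v : ZMod (2 * n)) :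
    {e : (ladder n).edgeSet | v ∈ (e : Sym2 (ZMod (2 * n)))} = {rim v, rim (v - 1), rung v} := by
  ext e; exact mem_edge_iff

theorem ncard_edges_at (v : ZMod (2 * n)) :
    {e : (ladder n).edgeSet | v ∈ (e : Sym2 (ZMod (2 * n)))}.ncard = 3 := by
  rw [edges_at, Set.ncard_eq_three]
  exact ⟨_, _, _, rim_ne_rim_sub_one v, rim_ne_rung _ _, rim_ne_rung _ _, rfl⟩

theorem neighborSet_ladder (v : ZMod (2 * n)) :
    (ladder n).neighborSet v = {v + 1, v - 1, v + n} := by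
  ext u
  simp only [SimpleGraph.mem_neighborSet, ladder_adj, Set.mem_insert_iff, Set.mem_singleton_iff]
  rw [eq_sub_iff_add_eq, eq_comm (a := v)]

noncomputable instance fintypeLadderEdgeSet :
    Fintype (ladder n).edgeSet := Fintype.ofFinite _

theorem card_edgeSet_ladder : Fintype.card (ladder n).edgeSet = 3 * n := by
  classical
  have h1 := (ladder n).sum_degrees_eq_twice_card_edges
  have h2 : ∀ v, (ladder n).degree v = 3 := by
    intro v
    rw [← SimpleGraph.card_neighborSet_eq_degree, ← Nat.card_eq_fintype_card,
      Nat.card_coe_set_eq, neighborSet_ladder, Set.ncard_eq_three]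
    refine ⟨_, _, _, ?_, ?_, ?_, rfl⟩
    · intro h; exact zmod_two_ne (n := n) (by linear_combination h)
    · intro h; exact zmod_half_sub_one_ne (n := n) (by linear_combination -h)
    · intro h; exact zmod_half_add_one_ne (n := n) (by linear_combination -h)
  simp only [h2, Finset.sum_const, Finset.card_univ, ZMod.card, smul_eq_mul] at h1
  have h3 : ∀ inst, (@SimpleGraph.edgeFinset _ (ladder n) inst).card =
      Fintype.card (ladder n).edgeSet := by
    intro inst
    rw [← Set.ncard_coe_finset, SimpleGraph.coe_edgeFinset, ← Nat.card_coe_set_eq]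
    exact @Nat.card_eq_fintype_card _ fintypeLadderEdgeSet
  rw [h3] at h1
  omega

theorem ladder_adj_exists_step {u v : ZMod (2 * n)} (h : (ladder n).Adj u v) :
    ∃ a b : ℤ, v = u + a + b * n ∧ ((a = 1 ∧ b = 0) ∨ (a = -1 ∧ b = 0) ∨ (a = 0 ∧ b = 1)) := by
  rcases ladder_adj.1 h with h | h | h
  · exact ⟨1, 0, by rw [h]; push_cast; ring, by simp⟩
  · exact ⟨-1, 0, by rw [h]; push_cast; ring, by simp⟩
  · exact ⟨0, 1, by rw [h]; push_cast; ring, by simp⟩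

/-- In a closed walk the rung steps are even in number and the rim steps sum to zero, so the length
is even. -/
theorem ladder_triangle_free {u v w : ZMod (2 * n)} (h1 : (ladder n).Adj u v)
    (h2 : (ladder n).Adj v w) (h3 : (ladder n).Adj w u) : False := by
  obtain ⟨a1, b1, e1, c1⟩ := ladder_adj_exists_step h1
  obtain ⟨a2, b2, e2, c2⟩ := ladder_adj_exists_step h2
  obtain ⟨a3, b3, e3, c3⟩ := ladder_adj_exists_step h3
  have key : (((a1 + a2 + a3 : ℤ) : ZMod (2 * n)) + ((b1 + b2 + b3 : ℤ)) * n) = 0 := by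
    push_cast; linear_combination -e1 - e2 - e3
  have := hn.out
  obtain ⟨k1, k2⟩ := intCast_add_mul_eq_zero (by rw [abs_lt]; omega) key
  rw [Int.even_iff] at k2
  omega

/-- A closed walk of four steps that does not backtrack alternates rungs with rim steps in opposite
directions. -/
theorem ladder_four_cycle {p q r s : ZMod (2 * n)} (h1 : (ladder n).Adj p q)
    (h2 : (ladder n).Adj q r) (h3 : (ladder n).Adj r s) (h4 : (ladder n).Adj s p)
    (hpr : p ≠ r) (hqs : q ≠ s) :
    (q = p + n ∧ (s = p + 1 ∨ s = p - 1) ∧ r = s + n) ∨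
      (s = p + n ∧ (q = p + 1 ∨ q = p - 1) ∧ r = q + n) := by
  have h2n := two_mul_natCast_zmod n
  obtain ⟨a1, b1, e1, c1⟩ := ladder_adj_exists_step h1
  obtain ⟨a2, b2, e2, c2⟩ := ladder_adj_exists_step h2
  obtain ⟨a3, b3, e3, c3⟩ := ladder_adj_exists_step h3
  obtain ⟨a4, b4, e4, c4⟩ := ladder_adj_exists_step h4
  have key : (((a1 + a2 + a3 + a4 : ℤ) : ZMod (2 * n)) + ((b1 + b2 + b3 + b4 : ℤ)) * n) = 0 := by
    push_cast; linear_combination -e1 - e2 - e3 - e4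
  have := hn.out
  obtain ⟨k1, k2⟩ := intCast_add_mul_eq_zero (by rw [abs_lt]; omega) key
  rw [Int.even_iff] at k2
  -- The hypotheses `p ≠ r` and `q ≠ s` exclude two consecutive steps that cancel, including two
  -- rungs in a row.
  have n1 : ¬ (a1 + a2 = 0 ∧ (b1 + b2 = 0 ∨ b1 + b2 = 2)) := by
    rintro ⟨k, k'⟩
    apply hpr
    have k : (a1 + a2 : ZMod (2 * n)) = 0 := by exact_mod_cast congrArg (Int.cast (R := ZMod (2 * n))) k
    rcases k' with k' | k'
    · have k' : (b1 + b2 : ZMod (2 * n)) = 0 := by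
        exact_mod_cast congrArg (Int.cast (R := ZMod (2 * n))) k'
      linear_combination -e1 - e2 - k - n * k'
    · have k' : (b1 + b2 : ZMod (2 * n)) = 2 := by
        exact_mod_cast congrArg (Int.cast (R := ZMod (2 * n))) k'
      linear_combination -e1 - e2 - k - n * k' - h2n
  have n2 : ¬ (a2 + a3 = 0 ∧ (b2 + b3 = 0 ∨ b2 + b3 = 2)) := by
    rintro ⟨k, k'⟩
    apply hqs
    have k : (a2 + a3 : ZMod (2 * n)) = 0 := by exact_mod_cast congrArg (Int.cast (R := ZMod (2 * n))) k
    rcases k' with k' | k'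
    · have k' : (b2 + b3 : ZMod (2 * n)) = 0 := by
        exact_mod_cast congrArg (Int.cast (R := ZMod (2 * n))) k'
      linear_combination -e2 - e3 - k - n * k'
    · have k' : (b2 + b3 : ZMod (2 * n)) = 2 := by
        exact_mod_cast congrArg (Int.cast (R := ZMod (2 * n))) k'
      linear_combination -e2 - e3 - k - n * k' - h2n
  rcases c1 with ⟨rfl, rfl⟩ | ⟨rfl, rfl⟩ | ⟨rfl, rfl⟩ <;>
  rcases c2 with ⟨rfl, rfl⟩ | ⟨rfl, rfl⟩ | ⟨rfl, rfl⟩ <;>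
  rcases c3 with ⟨rfl, rfl⟩ | ⟨rfl, rfl⟩ | ⟨rfl, rfl⟩ <;>
  first
  | omega
  | (left; push_cast at e1 e2 e3
     exact ⟨by rw [e1]; ring1, Or.inl (by rw [e3, e2, e1]; linear_combination h2n),
       by rw [e3]; linear_combination -h2n⟩)
  | (left; push_cast at e1 e2 e3
     exact ⟨by rw [e1]; ring1, Or.inr (by rw [e3, e2, e1]; linear_combination h2n),
       by rw [e3]; linear_combination -h2n⟩)
  | (right; push_cast at e1 e2 e3
     exact ⟨by rw [e3, e2, e1]; ring1, Or.inl (by rw [e1]; ring1), by rw [e2]; ring1⟩)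
  | (right; push_cast at e1 e2 e3
     exact ⟨by rw [e3, e2, e1]; ring1, Or.inr (by rw [e1]; ring1), by rw [e2]; ring1⟩)

end Ladder

/-! ### Sparsity of the random permutation. -/

section Sparse

variable {n : ℕ}

/-- `v` can be reached from `u` by at most `R` steps in the ladder. -/
def IsNear (R : ℕ) (u v : ZMod (2 * n)) : Prop := ∃ p : (ladder n).Walk u v, p.length ≤ R

theorem IsNear.refl (R : ℕ) (u : ZMod (2 * n)) : IsNear R u u := ⟨.nil, by simp⟩

theorem IsNear.of_adj {R : ℕ} {u v : ZMod (2 * n)} (h : (ladder n).Adj u v) (hR : 1 ≤ R) :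
    IsNear R u v := ⟨.cons h .nil, by simpa using hR⟩

theorem IsNear.trans {R S T : ℕ} {u v w : ZMod (2 * n)} (h : IsNear R u v) (h' : IsNear S v w)
    (hT : R + S ≤ T) : IsNear T u w := by
  obtain ⟨p, hp⟩ := h
  obtain ⟨q, hq⟩ := h'
  exact ⟨p.append q, by rw [SimpleGraph.Walk.length_append]; omega⟩

theorem IsNear.mono {R S : ℕ} {u v : ZMod (2 * n)} (h : IsNear R u v) (hS : R ≤ S) :
    IsNear S u v := h.trans (IsNear.refl 0 v) hS

variable [hn : Fact (6 ≤ n)]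

theorem IsNear.exists_eq_add {R : ℕ} {u v : ZMod (2 * n)} (h : IsNear R u v) :
    ∃ a ∈ Finset.Icc (-R : ℤ) R, ∃ b ∈ ({0, 1} : Finset ℤ), v = u + a + b * n := by
  have h2n := two_mul_natCast_zmod n
  obtain ⟨p, hp⟩ := h
  induction p generalizing R with
  | nil => exact ⟨0, by simp, 0, by simp, by simp⟩
  | @cons u w v hadj p ih =>
    rw [SimpleGraph.Walk.length_cons] at hp
    obtain ⟨a, ha, b, hb, e⟩ := ih (R := R - 1) (by omega)
    rw [Finset.mem_Icc] at ha
    rcases ladder_adj_exists_step hadj with ⟨a', b', e', ⟨rfl, rfl⟩ | ⟨rfl, rfl⟩ | ⟨rfl, rfl⟩⟩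
    · refine ⟨a + 1, by rw [Finset.mem_Icc]; omega, b, hb, ?_⟩
      rw [e, e']; push_cast; ring
    · refine ⟨a - 1, by rw [Finset.mem_Icc]; omega, b, hb, ?_⟩
      rw [e, e']; push_cast; ring
    · refine ⟨a, by rw [Finset.mem_Icc]; omega, 1 - b, ?_, ?_⟩
      · simp only [Finset.mem_insert, Finset.mem_singleton] at hb ⊢; omega
      · simp only [Finset.mem_insert, Finset.mem_singleton] at hb
        rcases hb with rfl | rfl
        · rw [e, e']; push_cast; ring
        · rw [e, e']; push_cast; linear_combination h2n

open Classical in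
/-- The edges with an endpoint near a vertex of `A`. -/
noncomputable def edgeBall (R : ℕ) (A : Finset (ZMod (2 * n))) : Finset (ladder n).edgeSet :=
  Finset.univ.filter fun e => ∃ a ∈ A, ∃ v ∈ (e : Sym2 (ZMod (2 * n))), IsNear R a v

/-- A ball of radius `R` has at most `2 * (2 * R + 1)` vertices, and each has three edges. -/
theorem card_edgeBall_le (R : ℕ) (A : Finset (ZMod (2 * n))) :
    (edgeBall R A).card ≤ A.card * (6 * (2 * R + 1)) := by
  classical
  have hsub : edgeBall R A ⊆ (A ×ˢ (Finset.Icc (-R : ℤ) R ×ˢ (({0, 1} : Finset ℤ) ×ˢ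
      (Finset.univ : Finset (Fin 3))))).image fun q =>
        ![rim (q.1 + q.2.1 + q.2.2.1 * n), rim (q.1 + q.2.1 + q.2.2.1 * n - 1),
          rung (q.1 + q.2.1 + q.2.2.1 * n)] q.2.2.2 := by
    intro e he
    simp only [edgeBall, Finset.mem_filter, Finset.mem_univ, true_and] at he
    obtain ⟨a, ha, v, hv, hav⟩ := he
    obtain ⟨k, hk, b, hb, rfl⟩ := hav.exists_eq_add
    rw [Finset.mem_image]
    rcases mem_edge_iff.1 hv with rfl | rfl | rfl
    · exact ⟨(a, k, b, 0), by simp only [Finset.mem_product]; exact ⟨ha, hk, hb, by simp⟩, rfl⟩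
    · exact ⟨(a, k, b, 1), by simp only [Finset.mem_product]; exact ⟨ha, hk, hb, by simp⟩, rfl⟩
    · exact ⟨(a, k, b, 2), by simp only [Finset.mem_product]; exact ⟨ha, hk, hb, by simp⟩, rfl⟩
  refine (Finset.card_le_card hsub).trans (Finset.card_image_le.trans ?_)
  simp only [Finset.card_product, Int.card_Icc, Finset.card_univ, Fintype.card_fin]
  rw [Finset.card_pair (by norm_num)]
  apply Nat.mul_le_mul_left
  have : ((R : ℤ) + 1 - -R).toNat = 2 * R + 1 := by omega
  rw [this]; omega

/-- Every set of at most `K` edges needs at least as many balls of radius `R` to be covered in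
both layers together as it has elements. -/
def IsSparse (R K : ℕ) (σ : Equiv.Perm (ladder n).edgeSet) : Prop :=
  ∀ (A B : Finset (ZMod (2 * n))) (F : Finset (ladder n).edgeSet), F.card ≤ K →
    (∀ e ∈ F, ∃ a ∈ A, ∃ v ∈ (e : Sym2 (ZMod (2 * n))), IsNear R a v) →
    (∀ e ∈ F, ∃ b ∈ B, ∃ v ∈ (σ e : Sym2 (ZMod (2 * n))), IsNear R b v) →
    F.card ≤ A.card + B.card

/-- Once the centres are fixed, the union bound over source and target sets has a number of terms
bounded independently of `n`. -/
theorem permProb_covered_le (R k : ℕ) (A B : Finset (ZMod (2 * n))) :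
    permProb (fun σ : Equiv.Perm (ladder n).edgeSet =>
      ∃ F ∈ (edgeBall R A).powersetCard k, ∃ F' ∈ (edgeBall R B).powerset,
        (by classical exact F.image σ) = F') ≤
      2 ^ (A.card * (6 * (2 * R + 1))) * (2 ^ (B.card * (6 * (2 * R + 1))) *
        (1 / ((3 * n).choose k : ℝ))) := by
  classical
  refine (permProb_le_card_mul _ _
    (c := 2 ^ (B.card * (6 * (2 * R + 1))) * (1 / ((3 * n).choose k : ℝ))) ?_).trans ?_
  · intro F hF
    refine (permProb_le_card_mul _ _ (c := 1 / ((3 * n).choose k : ℝ)) ?_).trans ?_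
    · intro F' _
      have := permProb_image_eq_le F F'
      rw [card_edgeSet_ladder, (Finset.mem_powersetCard.1 hF).2] at this
      convert this
    · rw [Finset.card_powerset]
      push_cast
      gcongr
      · norm_num
      · exact card_edgeBall_le R B
  · have : ((edgeBall R A).powersetCard k).card ≤ 2 ^ (A.card * (6 * (2 * R + 1))) := by
      refine (Finset.card_le_card (t := (edgeBall R A).powerset) fun F hF =>
        Finset.mem_powerset.2 (Finset.mem_powersetCard.1 hF).1).trans ?_
      rw [Finset.card_powerset]
      exact Nat.pow_le_pow_right (by norm_num) (card_edgeBall_le R A)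
    gcongr
    exact_mod_cast this

theorem one_div_choose_le {n k K : ℕ} (hn : 0 < n) (hk : k ≤ K) (hK : K ≤ n) :
    1 / ((3 * n).choose k : ℝ) ≤ K.factorial / (2 * n : ℝ) ^ k := by
  have h1 : ((3 * n + 1 - k) ^ k : ℕ) ≤ k.factorial * (3 * n).choose k := by
    have := Nat.pow_sub_le_descFactorial (3 * n) k
    rwa [Nat.descFactorial_eq_factorial_mul_choose] at this
  have h2 : (2 * n) ^ k ≤ K.factorial * (3 * n).choose k :=
    (Nat.pow_le_pow_left (by omega) k).trans
      (h1.trans (Nat.mul_le_mul_right _ (Nat.factorial_le hk)))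
  have h3 : (0 : ℝ) < (3 * n).choose k := by exact_mod_cast Nat.choose_pos (by omega)
  have hn' : (0 : ℝ) < n := by exact_mod_cast hn
  rw [div_le_div_iff₀ h3 (by positivity), one_mul]
  exact_mod_cast h2

/-- A violation has `i + j ≤ k - 1` centres for `k` edges: at most `(2 * n) ^ (k - 1)` choices
against a probability of order `n ^ (-k)`. -/
theorem permProb_not_isSparse_le (R K : ℕ) (hK : K ≤ n) :
    permProb (fun σ : Equiv.Perm (ladder n).edgeSet => ¬ IsSparse R K σ) ≤
      (K + 1) ^ 3 * (2 ^ (2 * K * (6 * (2 * R + 1))) * K.factorial) * (1 / n) := by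
  classical
  have hn0 : 0 < n := by have := hn.out; omega
  have hn' : (0 : ℝ) < n := by exact_mod_cast hn0
  -- The triples of sizes of `A`, `B` and `F` in a violation.
  set I : Finset (ℕ × ℕ × ℕ) := (Finset.range (K + 1) ×ˢ (Finset.range (K + 1) ×ˢ
    Finset.range (K + 1))).filter fun q => q.1 + q.2.1 < q.2.2 with hI
  have hIcard : (I.card : ℝ) ≤ (K + 1) ^ 3 := by
    have : I.card ≤ (K + 1) ^ 3 := by
      refine (Finset.card_filter_le _ _).trans ?_
      simp only [Finset.card_product, Finset.card_range]
      apply le_of_eq; ring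
    exact_mod_cast this
  have hcover : ∀ σ : Equiv.Perm (ladder n).edgeSet, ¬ IsSparse R K σ → ∃ q ∈ I,
      ∃ AB ∈ (Finset.univ : Finset (ZMod (2 * n))).powersetCard q.1 ×ˢ
        (Finset.univ : Finset (ZMod (2 * n))).powersetCard q.2.1,
      ∃ F ∈ (edgeBall R AB.1).powersetCard q.2.2, ∃ F' ∈ (edgeBall R AB.2).powerset,
        F.image σ = F' := by
    intro σ h
    unfold IsSparse at h
    push Not at h
    obtain ⟨A, B, F, hFK, hA, hB, hlt⟩ := h
    refine ⟨(A.card, B.card, F.card), ?_, (A, B), ?_, F, ?_, F.image σ, ?_, rfl⟩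
    · simp only [hI, Finset.mem_filter, Finset.mem_product, Finset.mem_range]
      omega
    · simp [Finset.mem_powersetCard]
    · rw [Finset.mem_powersetCard]
      refine ⟨fun e he => ?_, rfl⟩
      simp only [edgeBall, Finset.mem_filter, Finset.mem_univ, true_and]
      exact hA e he
    · rw [Finset.mem_powerset]
      intro f hf
      obtain ⟨e, he, rfl⟩ := Finset.mem_image.1 hf
      simp only [edgeBall, Finset.mem_filter, Finset.mem_univ, true_and]
      exact hB e he
  refine (permProb_mono hcover).trans ((permProb_le_card_mul I _
    (c := 2 ^ (2 * K * (6 * (2 * R + 1))) * K.factorial * (1 / n)) ?_).trans ?_)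
  · rintro ⟨i, j, k⟩ hq
    simp only [hI, Finset.mem_filter, Finset.mem_product, Finset.mem_range] at hq
    refine (permProb_le_card_mul _ _ (c := 2 ^ (i * (6 * (2 * R + 1))) *
      (2 ^ (j * (6 * (2 * R + 1))) * (1 / ((3 * n).choose k : ℝ)))) ?_).trans ?_
    · rintro ⟨A, B⟩ hAB
      simp only [Finset.mem_product, Finset.mem_powersetCard_univ] at hAB
      have := permProb_covered_le R k A B
      rw [hAB.1, hAB.2] at this
      convert this
    · simp only [Finset.card_product, Finset.card_powersetCard, Finset.card_univ, ZMod.card]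
      have e1 : (((2 * n).choose i * (2 * n).choose j : ℕ) : ℝ) ≤ (2 * n : ℝ) ^ (k - 1) := by
        have : (2 * n).choose i * (2 * n).choose j ≤ (2 * n) ^ (k - 1) := by
          refine (Nat.mul_le_mul (Nat.choose_le_pow _ _) (Nat.choose_le_pow _ _)).trans ?_
          rw [← pow_add]
          exact Nat.pow_le_pow_right (by omega) (by omega)
        exact_mod_cast this
      have e2 := one_div_choose_le (k := k) (K := K) hn0 (by omega) hK
      have e3 : (2 : ℝ) ^ (i * (6 * (2 * R + 1))) * 2 ^ (j * (6 * (2 * R + 1))) ≤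
          2 ^ (2 * K * (6 * (2 * R + 1))) := by
        rw [← pow_add, ← add_mul]
        apply pow_le_pow_right₀ (by norm_num)
        apply Nat.mul_le_mul_right
        omega
      calc _ ≤ (2 * n : ℝ) ^ (k - 1) * (2 ^ (i * (6 * (2 * R + 1))) *
            (2 ^ (j * (6 * (2 * R + 1))) * (K.factorial / (2 * n : ℝ) ^ k))) := by gcongr
        _ = (2 ^ (i * (6 * (2 * R + 1))) * 2 ^ (j * (6 * (2 * R + 1)))) * K.factorial *
            ((2 * n : ℝ) ^ (k - 1) / (2 * n : ℝ) ^ k) := by ring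
        _ ≤ 2 ^ (2 * K * (6 * (2 * R + 1))) * K.factorial * (1 / n) := by
          refine mul_le_mul (by gcongr) ?_ (by positivity) (by positivity)
          obtain ⟨k, rfl⟩ : ∃ k', k = k' + 1 := ⟨k - 1, by omega⟩
          rw [Nat.add_sub_cancel, pow_succ, div_mul_eq_div_div, div_self (by positivity)]
          apply one_div_le_one_div_of_le hn'
          linarith
  · rw [← mul_assoc]
    gcongr

end Sparse

/-! ### Adjacency in bipartite graphs. -/

section Bipartite

variable {V W : Type*} {E : V → W → Prop}

theorem bipartiteGraph_adj_inl_inr {v : V} {w : W} :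
    (bipartiteGraph E).Adj (Sum.inl v) (Sum.inr w) ↔ E v w := by
  simp [bipartiteGraph, SimpleGraph.fromRel_adj]

theorem bipartiteGraph_adj_inr_inl {v : V} {w : W} :
    (bipartiteGraph E).Adj (Sum.inr w) (Sum.inl v) ↔ E v w := by
  rw [SimpleGraph.adj_comm, bipartiteGraph_adj_inl_inr]

theorem not_bipartiteGraph_adj_inl_inl {v v' : V} :
    ¬ (bipartiteGraph E).Adj (Sum.inl v) (Sum.inl v') := by
  simp [bipartiteGraph, SimpleGraph.fromRel_adj]

theorem not_bipartiteGraph_adj_inr_inr {w w' : W} :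
    ¬ (bipartiteGraph E).Adj (Sum.inr w) (Sum.inr w') := by
  simp [bipartiteGraph, SimpleGraph.fromRel_adj]

theorem mem_secondNeighborhood_bipartiteGraph {w : W} {z : V ⊕ W} :
    z ∈ secondNeighborhood (bipartiteGraph E) (Sum.inr w) ↔
      ∃ w', z = Sum.inr w' ∧ w' ≠ w ∧ ∃ v, E v w ∧ E v w' := by
  constructor
  · rintro ⟨hne, c, h1, h2⟩
    rcases c with v | c
    · rcases z with z | w'
      · exact (not_bipartiteGraph_adj_inl_inl h2).elim
      · exact ⟨w', rfl, fun h => hne (by rw [h]), v, bipartiteGraph_adj_inr_inl.1 h1,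
          bipartiteGraph_adj_inl_inr.1 h2⟩
    · exact (not_bipartiteGraph_adj_inr_inr h1).elim
  · rintro ⟨w', rfl, hne, v, h1, h2⟩
    exact ⟨fun h => hne (Sum.inr_injective h), Sum.inl v, bipartiteGraph_adj_inr_inl.2 h1,
      bipartiteGraph_adj_inl_inr.2 h2⟩

end Bipartite

/-! ### The two layers of `B(G, σ)`. -/

section Layers

variable {V : Type*} {G : SimpleGraph V}

/-- The permutation by which the edges are attached to the vertices of layer `j`. -/
def layerPerm (σ : Equiv.Perm G.edgeSet) (j : Fin 2) : Equiv.Perm G.edgeSet :=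
  if j = 0 then 1 else σ

@[simp] theorem layerPerm_zero (σ : Equiv.Perm G.edgeSet) : layerPerm σ 0 = 1 := rfl

@[simp] theorem layerPerm_one (σ : Equiv.Perm G.edgeSet) : layerPerm σ 1 = σ := rfl

theorem baseIncidence_iff {σ : Equiv.Perm G.edgeSet} {x : V × Fin 2} {e : G.edgeSet} :
    baseIncidence G σ x e ↔ x.1 ∈ (layerPerm σ x.2 e : Sym2 V) := by
  obtain ⟨v, j⟩ := x
  have hj : j = 0 ∨ j = 1 := by omega
  rcases hj with rfl | rfl <;> simp [baseIncidence]

theorem edge_eq_of_mem {e f : G.edgeSet} {u v : V} (h : u ≠ v) (hu : u ∈ (e : Sym2 V))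
    (hv : v ∈ (e : Sym2 V)) (hu' : u ∈ (f : Sym2 V)) (hv' : v ∈ (f : Sym2 V)) : e = f :=
  Subtype.ext (((Sym2.mem_and_mem_iff h).1 ⟨hu, hv⟩).trans
    ((Sym2.mem_and_mem_iff h).1 ⟨hu', hv'⟩).symm)

theorem exists_edge_eq (e : G.edgeSet) : ∃ u v, u ≠ v ∧ G.Adj u v ∧ (e : Sym2 V) = s(u, v) := by
  obtain ⟨e, he⟩ := e
  induction e using Sym2.ind with
  | h u v => exact ⟨u, v, G.ne_of_adj he, he, rfl⟩

theorem adj_of_mem_edge {e : G.edgeSet} {u v : V} (h : u ≠ v) (hu : u ∈ (e : Sym2 V))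
    (hv : v ∈ (e : Sym2 V)) : G.Adj u v := by
  have h1 := (Sym2.mem_and_mem_iff h).1 ⟨hu, hv⟩
  rw [← SimpleGraph.mem_edgeSet, ← h1]
  exact e.2

end Layers

/-! ### Distinct second neighborhoods. -/

section SecondNeighborhoods

variable {n : ℕ}

theorem isNear_one_of_mem {e : (ladder n).edgeSet} {u v : ZMod (2 * n)}
    (hu : u ∈ (e : Sym2 (ZMod (2 * n)))) (hv : v ∈ (e : Sym2 (ZMod (2 * n)))) : IsNear 1 u v := by
  by_cases h : u = v
  · subst h; exact IsNear.refl _ _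
  · exact IsNear.of_adj (adj_of_mem_edge h hu hv) le_rfl

variable [hn : Fact (6 ≤ n)]

/-- If both other edges at `a` met `f`, they would coincide or close a triangle with `f`. -/
theorem exists_edge_disjoint {e f : (ladder n).edgeSet} {a : ZMod (2 * n)}
    (ha : a ∈ (e : Sym2 (ZMod (2 * n)))) (haf : a ∉ (f : Sym2 (ZMod (2 * n)))) :
    ∃ g : (ladder n).edgeSet, g ≠ e ∧ a ∈ (g : Sym2 (ZMod (2 * n))) ∧
      ∀ v ∈ (g : Sym2 (ZMod (2 * n))), v ∉ (f : Sym2 (ZMod (2 * n))) := by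
  have h2 : ({g : (ladder n).edgeSet | a ∈ (g : Sym2 (ZMod (2 * n)))} \ {e}).ncard = 2 := by
    rw [Set.ncard_sdiff_singleton_of_mem (by exact ha), ncard_edges_at]
  obtain ⟨g, g', hgg, hG⟩ := Set.ncard_eq_two.1 h2
  have hg : g ∈ ({g, g'} : Set _) := by simp
  have hg' : g' ∈ ({g, g'} : Set _) := by simp
  rw [← hG] at hg hg'
  by_contra! hcon
  obtain ⟨c, hc, hcf⟩ := hcon g hg.2 hg.1
  obtain ⟨c', hc', hcf'⟩ := hcon g' hg'.2 hg'.1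
  have hac : a ≠ c := fun h => haf (h ▸ hcf)
  have hac' : a ≠ c' := fun h => haf (h ▸ hcf')
  by_cases hcc : c = c'
  · subst hcc
    exact hgg (edge_eq_of_mem hac hg.1 hc hg'.1 hc')
  · exact ladder_triangle_free (adj_of_mem_edge hac hg.1 hc) (adj_of_mem_edge hcc hcf hcf')
      (adj_of_mem_edge hac' hg'.1 hc').symm

/-- Suppose `e` and `f` have the same second neighborhood. In layer 0 each of them has two further
neighbors that avoid the other one, so these must be adjacent to the other one in layer 1. Together
with `e` and `f` they are six edges, covered by two balls in each layer. -/
theorem secondNeighborhoodsDistinct_of_isSparse {σ : Equiv.Perm (ladder n).edgeSet}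
    (h : IsSparse 1 6 σ) : SecondNeighborhoodsDistinct (baseIncidence (ladder n) σ) := by
  classical
  intro e f hef hN
  have key : ∀ g, (g ≠ e ∧ ∃ x, baseIncidence (ladder n) σ x e ∧ baseIncidence (ladder n) σ x g) ↔
      (g ≠ f ∧ ∃ x, baseIncidence (ladder n) σ x f ∧ baseIncidence (ladder n) σ x g) := by
    intro g
    have := Set.ext_iff.1 hN (Sum.inr g)
    rw [mem_secondNeighborhood_bipartiteGraph, mem_secondNeighborhood_bipartiteGraph] at this
    simpa using this
  -- A common vertex would put `f` into its own second neighborhood.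
  have hdisj : ∀ v ∈ (e : Sym2 (ZMod (2 * n))), v ∉ (f : Sym2 (ZMod (2 * n))) := by
    intro v hv hv'
    exact ((key f).1 ⟨hef.symm, (v, 0), Or.inl ⟨rfl, hv⟩, Or.inl ⟨rfl, hv'⟩⟩).1 rfl
  -- an edge meeting one of the two edges only is close to the other one in the second layer
  have near : ∀ {e f : (ladder n).edgeSet}, (∀ g, (g ≠ e ∧ ∃ x, baseIncidence (ladder n) σ x e ∧
        baseIncidence (ladder n) σ x g) → (g ≠ f ∧ ∃ x, baseIncidence (ladder n) σ x f ∧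
        baseIncidence (ladder n) σ x g)) → ∀ {a g}, g ≠ e → a ∈ (e : Sym2 (ZMod (2 * n))) →
        a ∈ (g : Sym2 (ZMod (2 * n))) →
        (∀ v ∈ (g : Sym2 (ZMod (2 * n))), v ∉ (f : Sym2 (ZMod (2 * n)))) →
        ∃ v ∈ (σ g : Sym2 (ZMod (2 * n))), v ∈ (σ f : Sym2 (ZMod (2 * n))) := by
    intro e f key a g hge hae hag hg
    obtain ⟨_, ⟨v, j⟩, h1, h2⟩ := key g ⟨hge, (a, 0), Or.inl ⟨rfl, hae⟩, Or.inl ⟨rfl, hag⟩⟩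
    rcases h1 with ⟨hj, h1⟩ | ⟨hj, h1⟩
    · rcases h2 with ⟨_, h2⟩ | ⟨hj', _⟩
      · exact (hg v h2 h1).elim
      · rw [hj] at hj'; simp at hj'
    · rcases h2 with ⟨hj', _⟩ | ⟨_, h2⟩
      · rw [hj] at hj'; simp at hj'
      · exact ⟨v, h2, h1⟩
  obtain ⟨a, b, hab, -, heab⟩ := exists_edge_eq e
  obtain ⟨c, d, hcd, -, hfcd⟩ := exists_edge_eq f
  obtain ⟨a', _, -, -, hσe⟩ := exists_edge_eq (σ e)
  obtain ⟨c', _, -, -, hσf⟩ := exists_edge_eq (σ f)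
  have ha : a ∈ (e : Sym2 (ZMod (2 * n))) := by rw [heab]; simp
  have hb : b ∈ (e : Sym2 (ZMod (2 * n))) := by rw [heab]; simp
  have hc : c ∈ (f : Sym2 (ZMod (2 * n))) := by rw [hfcd]; simp
  have hd : d ∈ (f : Sym2 (ZMod (2 * n))) := by rw [hfcd]; simp
  have ha' : a' ∈ (σ e : Sym2 (ZMod (2 * n))) := by rw [hσe]; simp
  have hc' : c' ∈ (σ f : Sym2 (ZMod (2 * n))) := by rw [hσf]; simp
  obtain ⟨g₁, n₁, m₁, d₁⟩ := exists_edge_disjoint ha (hdisj a ha)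
  obtain ⟨g₂, n₂, m₂, d₂⟩ := exists_edge_disjoint hb (hdisj b hb)
  obtain ⟨g₃, n₃, m₃, d₃⟩ := exists_edge_disjoint (f := e) hc (fun h => hdisj c h hc)
  obtain ⟨g₄, n₄, m₄, d₄⟩ := exists_edge_disjoint (f := e) hd (fun h => hdisj d h hd)
  have e12 : g₁ ≠ g₂ := by
    rintro rfl; exact n₁ (edge_eq_of_mem hab m₁ m₂ ha hb)
  have e34 : g₃ ≠ g₄ := by
    rintro rfl; exact n₃ (edge_eq_of_mem hcd m₃ m₄ hc hd)
  have e1f : g₁ ≠ f := by rintro rfl; exact d₁ c hc hc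
  have e2f : g₂ ≠ f := by rintro rfl; exact d₂ c hc hc
  have e3e : g₃ ≠ e := by rintro rfl; exact d₃ a ha ha
  have e4e : g₄ ≠ e := by rintro rfl; exact d₄ a ha ha
  have e13 : g₁ ≠ g₃ := by rintro rfl; exact d₃ a m₁ ha
  have e14 : g₁ ≠ g₄ := by rintro rfl; exact d₄ a m₁ ha
  have e23 : g₂ ≠ g₃ := by rintro rfl; exact d₃ b m₂ hb
  have e24 : g₂ ≠ g₄ := by rintro rfl; exact d₄ b m₂ hb
  have hcard : ({e, f, g₁, g₂, g₃, g₄} : Finset (ladder n).edgeSet).card = 6 := by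
    rw [Finset.card_insert_of_notMem, Finset.card_insert_of_notMem, Finset.card_insert_of_notMem,
      Finset.card_insert_of_notMem, Finset.card_pair e34]
    · simp [e23, e24]
    · simp [e12, e13, e14]
    · simp [e1f.symm, e2f.symm, n₃.symm, n₄.symm]
    · simp [hef, n₁.symm, n₂.symm, e3e.symm, e4e.symm]
  have := h {a, c} {a', c'} {e, f, g₁, g₂, g₃, g₄} hcard.le ?_ ?_
  · have h1 := Finset.card_le_two (a := a) (b := c)
    have h2 := Finset.card_le_two (a := a') (b := c')
    omega
  · intro x hx
    simp only [Finset.mem_insert, Finset.mem_singleton] at hx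
    rcases hx with rfl | rfl | rfl | rfl | rfl | rfl
    · exact ⟨a, by simp, a, ha, IsNear.refl _ _⟩
    · exact ⟨c, by simp, c, hc, IsNear.refl _ _⟩
    · exact ⟨a, by simp, a, m₁, IsNear.refl _ _⟩
    · exact ⟨a, by simp, b, m₂, isNear_one_of_mem ha hb⟩
    · exact ⟨c, by simp, c, m₃, IsNear.refl _ _⟩
    · exact ⟨c, by simp, d, m₄, isNear_one_of_mem hc hd⟩
  · intro x hx
    simp only [Finset.mem_insert, Finset.mem_singleton] at hx
    rcases hx with rfl | rfl | rfl | rfl | rfl | rfl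
    · exact ⟨a', by simp, a', ha', IsNear.refl _ _⟩
    · exact ⟨c', by simp, c', hc', IsNear.refl _ _⟩
    · obtain ⟨v, hv, hv'⟩ := near (fun g => (key g).1) n₁ ha m₁ d₁
      exact ⟨c', by simp, v, hv, isNear_one_of_mem hc' hv'⟩
    · obtain ⟨v, hv, hv'⟩ := near (fun g => (key g).1) n₂ hb m₂ d₂
      exact ⟨c', by simp, v, hv, isNear_one_of_mem hc' hv'⟩
    · obtain ⟨v, hv, hv'⟩ := near (fun g => (key g).2) n₃ hc m₃ d₃
      exact ⟨a', by simp, v, hv, isNear_one_of_mem ha' hv'⟩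
    · obtain ⟨v, hv, hv'⟩ := near (fun g => (key g).2) n₄ hd m₄ d₄
      exact ⟨a', by simp, v, hv, isNear_one_of_mem ha' hv'⟩

end SecondNeighborhoods

/-! ### Automorphisms of `B(G, σ)` and split edges. -/

section IncidenceAut

variable {n : ℕ}

/-- An automorphism of `B(G, σ)` for the Möbius ladder `G`, split into its actions on the two
sides. -/
structure IncidenceAut (σ : Equiv.Perm (ladder n).edgeSet) where
  onVertex : Equiv.Perm (ZMod (2 * n) × Fin 2)
  onEdge : Equiv.Perm (ladder n).edgeSet
  mem_iff : ∀ x e, x.1 ∈ (layerPerm σ x.2 e : Sym2 (ZMod (2 * n))) ↔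
    (onVertex x).1 ∈ (layerPerm σ (onVertex x).2 (onEdge e) : Sym2 (ZMod (2 * n)))

theorem ncard_neighborSet_iso {V V' : Type*} {G : SimpleGraph V} {G' : SimpleGraph V'}
    (φ : G ≃g G') (v : V) : (G'.neighborSet (φ v)).ncard = (G.neighborSet v).ncard := by
  have : G'.neighborSet (φ v) = φ '' G.neighborSet v := by
    ext u
    constructor
    · intro hu
      refine ⟨φ.symm u, ?_, φ.apply_symm_apply u⟩
      rw [SimpleGraph.mem_neighborSet] at hu ⊢
      rw [← φ.map_adj_iff, φ.apply_symm_apply]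
      exact hu
    · rintro ⟨w, hw, rfl⟩
      exact φ.map_adj_iff.2 hw
  rw [this, Set.ncard_image_of_injective _ φ.injective]

/-- The sides are told apart by degree: three for a vertex of the ladder, at least four for an edge.
-/
theorem exists_incidenceAut [Fact (6 ≤ n)] {σ : Equiv.Perm (ladder n).edgeSet}
    (φ : bipartiteGraph (baseIncidence (ladder n) σ) ≃g
      bipartiteGraph (baseIncidence (ladder n) σ)) :
    ∃ A : IncidenceAut σ, (∀ x, φ (Sum.inl x) = Sum.inl (A.onVertex x)) ∧
      ∀ e, φ (Sum.inr e) = Sum.inr (A.onEdge e) := by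
  have hleft : ∀ x, ((bipartiteGraph (baseIncidence (ladder n) σ)).neighborSet
      (Sum.inl x)).ncard = 3 := by
    intro x
    have : (bipartiteGraph (baseIncidence (ladder n) σ)).neighborSet (Sum.inl x) =
        (fun f => Sum.inr ((layerPerm σ x.2)⁻¹ f)) ''
          {f : (ladder n).edgeSet | x.1 ∈ (f : Sym2 (ZMod (2 * n)))} := by
      ext z
      rcases z with y | e
      · simp [SimpleGraph.mem_neighborSet, not_bipartiteGraph_adj_inl_inl]
      · rw [SimpleGraph.mem_neighborSet, bipartiteGraph_adj_inl_inr, baseIncidence_iff]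
        constructor
        · intro h; exact ⟨_, h, by simp⟩
        · rintro ⟨f, hf, h⟩
          rw [← Sum.inr_injective h]; simpa using hf
    rw [this, Set.ncard_image_of_injective, ncard_edges_at]
    exact Sum.inr_injective.comp (Equiv.injective _)
  have hright : ∀ e, ((bipartiteGraph (baseIncidence (ladder n) σ)).neighborSet
      (Sum.inr e)).ncard ≠ 3 := by
    intro e
    obtain ⟨u, v, huv, -, h0⟩ := exists_edge_eq e
    obtain ⟨u', v', huv', -, h1⟩ := exists_edge_eq (σ e)
    have hsub : (Sum.inl '' (({(u, 0), (v, 0), (u', 1), (v', 1)} :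
        Finset (ZMod (2 * n) × Fin 2)) : Set (ZMod (2 * n) × Fin 2))) ⊆
        (bipartiteGraph (baseIncidence (ladder n) σ)).neighborSet (Sum.inr e) := by
      rintro _ ⟨x, hx, rfl⟩
      rw [SimpleGraph.mem_neighborSet, bipartiteGraph_adj_inr_inl, baseIncidence_iff]
      simp only [Finset.coe_insert, Finset.coe_singleton, Set.mem_insert_iff,
        Set.mem_singleton_iff] at hx
      rcases hx with rfl | rfl | rfl | rfl <;> simp [h0, h1]
    have hfin : ((bipartiteGraph (baseIncidence (ladder n) σ)).neighborSet (Sum.inr e)).Finite :=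
      Set.toFinite _
    have := Set.ncard_le_ncard hsub hfin
    rw [Set.ncard_image_of_injective _ Sum.inl_injective, Set.ncard_coe_finset,
      Finset.card_insert_of_notMem (by simp [huv]), Finset.card_insert_of_notMem (by simp),
      Finset.card_insert_of_notMem (by simp [huv']), Finset.card_singleton] at this
    omega
  have toLeft : ∀ (ψ : bipartiteGraph (baseIncidence (ladder n) σ) ≃g
      bipartiteGraph (baseIncidence (ladder n) σ)) x, ∃ y, ψ (Sum.inl x) = Sum.inl y := by
    intro ψ x
    rcases h : ψ (Sum.inl x) with y | e
    · exact ⟨y, rfl⟩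
    · have h1 := ncard_neighborSet_iso ψ (Sum.inl x)
      rw [h, hleft] at h1
      exact (hright e h1).elim
  have toRight : ∀ (ψ : bipartiteGraph (baseIncidence (ladder n) σ) ≃g
      bipartiteGraph (baseIncidence (ladder n) σ)) e, ∃ f, ψ (Sum.inr e) = Sum.inr f := by
    intro ψ e
    rcases h : ψ (Sum.inr e) with y | f
    · have h1 := ncard_neighborSet_iso ψ (Sum.inr e)
      rw [h, hleft] at h1
      exact (hright e h1.symm).elim
    · exact ⟨f, rfl⟩
  choose a ha using toLeft φ
  choose a' ha' using toLeft φ.symm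
  choose b hb using toRight φ
  choose b' hb' using toRight φ.symm
  refine ⟨⟨⟨a, a', fun x => ?_, fun x => ?_⟩, ⟨b, b', fun e => ?_, fun e => ?_⟩, fun x e => ?_⟩,
    ha, hb⟩
  · apply Sum.inl_injective (β := (ladder n).edgeSet)
    rw [← ha', ← ha, φ.symm_apply_apply]
  · apply Sum.inl_injective (β := (ladder n).edgeSet)
    rw [← ha, ← ha', φ.apply_symm_apply]
  · apply Sum.inr_injective (α := ZMod (2 * n) × Fin 2)
    rw [← hb', ← hb, φ.symm_apply_apply]
  · apply Sum.inr_injective (α := ZMod (2 * n) × Fin 2)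
    rw [← hb, ← hb', φ.apply_symm_apply]
  · have h1 := bipartiteGraph_adj_inl_inr (E := baseIncidence (ladder n) σ) (v := x) (w := e)
    have h2 := bipartiteGraph_adj_inl_inr (E := baseIncidence (ladder n) σ) (v := a x) (w := b e)
    rw [baseIncidence_iff] at h1 h2
    refine h1.symm.trans (Iff.trans ?_ h2)
    rw [← ha, ← hb]
    exact φ.map_adj_iff.symm

namespace IncidenceAut

variable {σ : Equiv.Perm (ladder n).edgeSet} (A : IncidenceAut σ) (j : Fin 2)

/-- The layer to which the vertex `u` of layer `j` is mapped. -/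
def color (u : ZMod (2 * n)) : Fin 2 := (A.onVertex (u, j)).2

/-- The position to which the vertex `u` of layer `j` is mapped. -/
def place (u : ZMod (2 * n)) : ZMod (2 * n) := (A.onVertex (u, j)).1

/-- The image of the vertex of `W_B` that is the edge `f` in layer `j`. -/
def edgeImage (f : (ladder n).edgeSet) : (ladder n).edgeSet := A.onEdge ((layerPerm σ j)⁻¹ f)

theorem onVertex_eq (u : ZMod (2 * n)) : A.onVertex (u, j) = (A.place j u, A.color j u) := rfl

variable {A j}

theorem place_ne {u v : ZMod (2 * n)} (h : u ≠ v) (hc : A.color j u = A.color j v) :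
    A.place j u ≠ A.place j v := by
  intro hp
  have : A.onVertex (u, j) = A.onVertex (v, j) := by rw [onVertex_eq, onVertex_eq, hp, hc]
  exact h (congrArg Prod.fst (A.onVertex.injective this))

theorem place_mem {f : (ladder n).edgeSet} {u : ZMod (2 * n)}
    (hu : u ∈ (f : Sym2 (ZMod (2 * n)))) :
    A.place j u ∈ (layerPerm σ (A.color j u) (A.edgeImage j f) : Sym2 (ZMod (2 * n))) := by
  have := (A.mem_iff (u, j) ((layerPerm σ j)⁻¹ f)).1 (by simpa using hu)
  exact this

theorem adj_place {u v : ZMod (2 * n)} (h : (ladder n).Adj u v)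
    (hc : A.color j u = A.color j v) : (ladder n).Adj (A.place j u) (A.place j v) := by
  have h1 := place_mem (A := A) (j := j) (f := ⟨s(u, v), h⟩) (u := u) (by simp)
  have h2 := place_mem (A := A) (j := j) (f := ⟨s(u, v), h⟩) (u := v) (by simp)
  rw [← hc] at h2
  exact adj_of_mem_edge (place_ne h.ne hc) h1 h2

variable (A j)

/-- The edge `f` of layer `j` has endpoints mapped to different layers. -/
def IsSplit (f : (ladder n).edgeSet) : Prop :=
  ∃ u ∈ (f : Sym2 (ZMod (2 * n))), ∃ v ∈ (f : Sym2 (ZMod (2 * n))), A.color j u ≠ A.color j v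

/-- Two vertices of layer `j` are mapped to nearby vertices of the same layer. -/
def SameNear (R : ℕ) (c u : ZMod (2 * n)) : Prop :=
  A.color j c = A.color j u ∧ IsNear R (A.place j c) (A.place j u)

variable {A j}

theorem SameNear.refl (R : ℕ) (u : ZMod (2 * n)) : A.SameNear j R u u := ⟨rfl, IsNear.refl R _⟩

theorem SameNear.trans {R S T : ℕ} {u v w : ZMod (2 * n)} (h : A.SameNear j R u v)
    (h' : A.SameNear j S v w) (hT : R + S ≤ T) : A.SameNear j T u w :=
  ⟨h.1.trans h'.1, h.2.trans h'.2 hT⟩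

theorem SameNear.mono {R S : ℕ} {u v : ZMod (2 * n)} (h : A.SameNear j R u v) (hS : R ≤ S) :
    A.SameNear j S u v := ⟨h.1, h.2.mono hS⟩

theorem SameNear.of_adj {u v : ZMod (2 * n)} (h : (ladder n).Adj u v)
    (hc : A.color j u = A.color j v) : A.SameNear j 1 u v :=
  ⟨hc, IsNear.of_adj (adj_place h hc) le_rfl⟩

/-- The image of a split edge is near a cluster centre in both layers. The centres of color `k`
serve as ball centres in layer `k`, so the balls number at most `|C|` in total and sparsity applies.
-/
theorem card_le_of_isSplit {R K : ℕ} (hσ : IsSparse R K σ) {L : Finset (ladder n).edgeSet}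
    {C : Finset (ZMod (2 * n))} (hK : L.card ≤ K) (hL : ∀ f ∈ L, A.IsSplit j f)
    (hC : ∀ f ∈ L, ∀ u ∈ (f : Sym2 (ZMod (2 * n))), ∃ c ∈ C, A.SameNear j R c u) :
    L.card ≤ C.card := by
  classical
  have hinj : Function.Injective (A.edgeImage j) := fun f g h => by
    simpa [edgeImage] using h
  have hends : ∀ f ∈ L, ∀ k : Fin 2, ∃ u ∈ (f : Sym2 (ZMod (2 * n))), A.color j u = k := by
    intro f hf k
    obtain ⟨u, hu, v, hv, huv⟩ := hL f hf
    by_cases h : A.color j u = k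
    · exact ⟨u, hu, h⟩
    · exact ⟨v, hv, by omega⟩
  have hside : ∀ k : Fin 2, ∀ e ∈ L.image (A.edgeImage j),
      ∃ a ∈ (C.filter fun c => A.color j c = k).image (A.place j),
        ∃ v ∈ (layerPerm σ k e : Sym2 (ZMod (2 * n))), IsNear R a v := by
    intro k e he
    obtain ⟨f, hf, rfl⟩ := Finset.mem_image.1 he
    obtain ⟨u, hu, huk⟩ := hends f hf k
    obtain ⟨c, hc, hcu⟩ := hC f hf u hu
    refine ⟨A.place j c, Finset.mem_image_of_mem _ (Finset.mem_filter.2 ⟨hc, hcu.1.trans huk⟩),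
      A.place j u, ?_, hcu.2⟩
    rw [← huk]
    exact place_mem hu
  have := hσ _ _ (L.image (A.edgeImage j)) (by rwa [Finset.card_image_of_injective _ hinj])
    (hside 0) (hside 1)
  rw [Finset.card_image_of_injective _ hinj] at this
  refine this.trans ((Nat.add_le_add Finset.card_image_le Finset.card_image_le).trans ?_)
  rw [← Finset.card_union_of_disjoint]
  · apply Finset.card_le_card
    intro c hc
    rcases Finset.mem_union.1 hc with h | h <;> exact (Finset.mem_filter.1 h).1
  · rw [Finset.disjoint_left]
    intro c h1 h2
    have h1 := (Finset.mem_filter.1 h1).2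
    have h2 := (Finset.mem_filter.1 h2).2
    rw [h1] at h2
    simp at h2

/-- In a square with vertices of both colors, the side opposite to the rung `p p'` contributes
one more split edge than new clusters. -/
theorem exists_split_side {a a' p p' : ZMod (2 * n)} {e₁ e₂ e₃ : (ladder n).edgeSet}
    (h₁ : (e₁ : Sym2 (ZMod (2 * n))) = s(a, p)) (h₂ : (e₂ : Sym2 (ZMod (2 * n))) = s(a', p'))
    (h₃ : (e₃ : Sym2 (ZMod (2 * n))) = s(a, a')) (hp : (ladder n).Adj p p')
    (h12 : e₁ ≠ e₂) (h13 : e₁ ≠ e₃) (h23 : e₂ ≠ e₃)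
    (hcol : ¬ (A.color j a = A.color j p ∧ A.color j a' = A.color j p ∧
      A.color j p' = A.color j p)) :
    ∃ (L : Finset (ladder n).edgeSet) (C : Finset (ZMod (2 * n))),
      (∀ f ∈ L, f = e₁ ∨ f = e₂ ∨ f = e₃) ∧ L.card = C.card + 1 ∧ (∀ f ∈ L, A.IsSplit j f) ∧
      ∀ f ∈ L, ∀ u ∈ (f : Sym2 (ZMod (2 * n))),
        ∃ c, (c ∈ C ∨ c = p ∨ c = p') ∧ A.SameNear j 2 c u := by
  classical
  have adj₁ : (ladder n).Adj a p := by
    rw [← SimpleGraph.mem_edgeSet, ← h₁]; exact e₁.2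
  have adj₂ : (ladder n).Adj a' p' := by
    rw [← SimpleGraph.mem_edgeSet, ← h₂]; exact e₂.2
  have adj₃ : (ladder n).Adj a a' := by
    rw [← SimpleGraph.mem_edgeSet, ← h₃]; exact e₃.2
  have s₁ : A.color j a ≠ A.color j p → A.IsSplit j e₁ := fun h =>
    ⟨a, by rw [h₁]; simp, p, by rw [h₁]; simp, h⟩
  have s₂ : A.color j a' ≠ A.color j p' → A.IsSplit j e₂ := fun h =>
    ⟨a', by rw [h₂]; simp, p', by rw [h₂]; simp, h⟩
  have s₃ : A.color j a ≠ A.color j a' → A.IsSplit j e₃ := fun h =>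
    ⟨a, by rw [h₃]; simp, a', by rw [h₃]; simp, h⟩
  -- On the path `p, a, a', p'` every edge that is not split merges two clusters. If `s` of the
  -- three edges are split, `s - 1` clusters remain besides those of `p` and `p'`; and `s ≥ 1` by
  -- `hcol`.
  by_cases c₁ : A.color j a = A.color j p
  · have n₁ : A.SameNear j 2 p a := (SameNear.of_adj adj₁.symm c₁.symm).mono (by norm_num)
    by_cases c₂ : A.color j a' = A.color j p'
    · have n₂ : A.SameNear j 2 p' a' := (SameNear.of_adj adj₂.symm c₂.symm).mono (by norm_num)
      have c₃ : A.color j a ≠ A.color j a' := fun h =>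
        hcol ⟨c₁, by rw [← h, c₁], by rw [← c₂, ← h, c₁]⟩
      refine ⟨{e₃}, ∅, by simp, by simp, by simpa using s₃ c₃, ?_⟩
      simp only [Finset.mem_singleton, forall_eq, h₃, Sym2.mem_iff]
      rintro u (rfl | rfl)
      · exact ⟨p, by simp, n₁⟩
      · exact ⟨p', by simp, n₂⟩
    · by_cases c₃ : A.color j a = A.color j a'
      · refine ⟨{e₂}, ∅, by simp, by simp, by simpa using s₂ c₂, ?_⟩
        simp only [Finset.mem_singleton, forall_eq, h₂, Sym2.mem_iff]
        rintro u (rfl | rfl)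
        · exact ⟨p, by simp, (SameNear.of_adj adj₁.symm c₁.symm).trans (SameNear.of_adj adj₃ c₃)
            (by norm_num)⟩
        · exact ⟨u, by simp, SameNear.refl _ _⟩
      · refine ⟨{e₂, e₃}, {a'}, by simp, by rw [Finset.card_pair h23]; simp, ?_, ?_⟩
        · simpa using ⟨s₂ c₂, s₃ c₃⟩
        · simp only [Finset.mem_insert, Finset.mem_singleton, forall_eq_or_imp, forall_eq, h₂, h₃,
            Sym2.mem_iff]
          refine ⟨?_, ?_⟩
          · exact ⟨⟨_, by simp, SameNear.refl _ _⟩,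
              ⟨_, by simp, SameNear.refl _ _⟩⟩
          · exact ⟨⟨p, by simp, n₁⟩,
              ⟨_, by simp, SameNear.refl _ _⟩⟩
  · by_cases c₂ : A.color j a' = A.color j p'
    · have n₂ : A.SameNear j 2 p' a' := (SameNear.of_adj adj₂.symm c₂.symm).mono (by norm_num)
      by_cases c₃ : A.color j a = A.color j a'
      · refine ⟨{e₁}, ∅, by simp, by simp, by simpa using s₁ c₁, ?_⟩
        simp only [Finset.mem_singleton, forall_eq, h₁, Sym2.mem_iff]
        rintro u (rfl | rfl)
        · exact ⟨p', by simp, (SameNear.of_adj adj₂.symm c₂.symm).trans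
            (SameNear.of_adj adj₃.symm c₃.symm) (by norm_num)⟩
        · exact ⟨u, by simp, SameNear.refl _ _⟩
      · refine ⟨{e₁, e₃}, {a}, ?_, by rw [Finset.card_pair h13]; simp, ?_, ?_⟩
        · simp only [Finset.mem_insert, Finset.mem_singleton]; tauto
        · simpa using ⟨s₁ c₁, s₃ c₃⟩
        · simp only [Finset.mem_insert, Finset.mem_singleton, forall_eq_or_imp, forall_eq, h₁, h₃,
            Sym2.mem_iff]
          refine ⟨?_, ?_⟩
          · exact ⟨⟨_, by simp, SameNear.refl _ _⟩,
              ⟨_, by simp, SameNear.refl _ _⟩⟩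
          · exact ⟨⟨_, by simp, SameNear.refl _ _⟩,
              ⟨p', by simp, n₂⟩⟩
    · by_cases c₃ : A.color j a = A.color j a'
      · refine ⟨{e₁, e₂}, {a}, ?_, by rw [Finset.card_pair h12]; simp, ?_, ?_⟩
        · simp only [Finset.mem_insert, Finset.mem_singleton]; tauto
        · simpa using ⟨s₁ c₁, s₂ c₂⟩
        · simp only [Finset.mem_insert, Finset.mem_singleton, forall_eq_or_imp, forall_eq, h₁, h₂,
            Sym2.mem_iff]
          refine ⟨?_, ?_⟩
          · exact ⟨⟨_, by simp, SameNear.refl _ _⟩,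
              ⟨_, by simp, SameNear.refl _ _⟩⟩
          · exact ⟨⟨a, by simp, (SameNear.of_adj adj₃ c₃).mono (by norm_num)⟩,
              ⟨_, by simp, SameNear.refl _ _⟩⟩
      · refine ⟨{e₁, e₂, e₃}, {a, a'}, by simp, ?_, ?_, ?_⟩
        · rw [Finset.card_insert_of_notMem (by simp [h12, h13]), Finset.card_pair h23,
            Finset.card_pair adj₃.ne]
        · simpa using ⟨s₁ c₁, s₂ c₂, s₃ c₃⟩
        · simp only [Finset.mem_insert, Finset.mem_singleton, forall_eq_or_imp, forall_eq, h₁, h₂,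
            h₃, Sym2.mem_iff]
          refine ⟨⟨?_, ?_⟩, ⟨?_, ?_⟩, ⟨?_, ?_⟩⟩ <;> exact ⟨_, by simp, SameNear.refl _ _⟩

end IncidenceAut

end IncidenceAut

/-! ### Squares that are mapped into one layer. -/

namespace IncidenceAut

variable {n : ℕ} {σ : Equiv.Perm (ladder n).edgeSet} {A : IncidenceAut σ} {j : Fin 2}

variable (A j) in
/-- The four vertices of the square at `x` in layer `j` are mapped to the same layer. -/
def IsMono (x : ZMod (2 * n)) : Prop :=
  A.color j (x + 1) = A.color j x ∧ A.color j (x + n) = A.color j x ∧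
    A.color j (x + 1 + n) = A.color j x

theorem not_isMono_iff {x : ZMod (2 * n)} : ¬ A.IsMono j x ↔
    ¬ (A.color j x = A.color j (x + 1) ∧ A.color j (x + n) = A.color j (x + 1) ∧
      A.color j (x + 1 + n) = A.color j (x + 1)) := by
  unfold IsMono
  constructor
  · rintro h ⟨h1, h2, h3⟩
    exact h ⟨h1.symm, h2.trans h1.symm, h3.trans h1.symm⟩
  · rintro h ⟨h1, h2, h3⟩
    exact h ⟨h1.symm, h2.trans h1.symm, h3.trans h1.symm⟩

theorem natCast_add_ne {d : ℕ} (h0 : 0 < d) (h : d < n) (b : ℤ) :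
    ((d : ZMod (2 * n)) + b * n) ≠ 0 := by
  intro h'
  have := intCast_add_mul_eq_zero (n := n) (a := d) (b := b) (by rw [abs_lt]; omega) (by exact_mod_cast h')
  omega

variable [hn : Fact (6 ≤ n)]

theorem adj_succ (x : ZMod (2 * n)) : (ladder n).Adj x (x + 1) := ladder_adj.2 (Or.inl rfl)

theorem adj_antipode (x : ZMod (2 * n)) : (ladder n).Adj x (x + n) :=
  ladder_adj.2 (Or.inr (Or.inr rfl))

theorem sameNear_of_isMono {x : ZMod (2 * n)} {d : ℕ}
    (h : ∀ i < d, A.IsMono j (x + (i : ℕ))) : A.SameNear j d x (x + (d : ℕ)) := by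
  induction d with
  | zero => rw [Nat.cast_zero, add_zero]; exact SameNear.refl _ _
  | succ d ih =>
    have h1 := ih fun i hi => h i (by omega)
    have h2 := (h d (by omega)).1
    push_cast
    rw [← add_assoc]
    exact h1.trans (SameNear.of_adj (adj_succ _) h2.symm) le_rfl

/-- This connects the exceptional squares at `x` and `x + d`. If `d > 1`, the squares between them
merge the facing rungs into a single cluster. If `d = 1` the rungs coincide; they need a second
cluster only if this rung is split, which adds an edge to `L`. -/
theorem exists_split_middle {x : ZMod (2 * n)} {d : ℕ} (hd : 1 ≤ d)
    (h : ∀ i, 0 < i → i < d → A.IsMono j (x + (i : ℕ))) :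
    ∃ (L : Finset (ladder n).edgeSet) (C : Finset (ZMod (2 * n))),
      (∀ f ∈ L, f = rung (x + 1)) ∧ C.card ≤ L.card + 1 ∧ (∀ f ∈ L, A.IsSplit j f) ∧
      (∀ u, (u = x + 1 ∨ u = x + 1 + n ∨ u = x + (d : ℕ) ∨ u = x + (d : ℕ) + n) →
        ∃ c ∈ C, A.SameNear j (d + 1) c u) := by
  classical
  by_cases hd1 : d = 1
  · subst hd1
    rw [Nat.cast_one]
    by_cases hc : A.color j (x + 1) = A.color j (x + 1 + n)
    · refine ⟨∅, {x + 1}, by simp, by simp, by simp, ?_⟩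
      rintro u (rfl | rfl | rfl | rfl)
      · exact ⟨_, by simp, SameNear.refl _ _⟩
      · exact ⟨_, by simp, (SameNear.of_adj (adj_antipode _) hc).mono (by norm_num)⟩
      · exact ⟨_, by simp, SameNear.refl _ _⟩
      · exact ⟨_, by simp, (SameNear.of_adj (adj_antipode _) hc).mono (by norm_num)⟩
    · refine ⟨{rung (x + 1)}, {x + 1, x + 1 + n}, by simp, ?_, ?_, ?_⟩
      · rw [Finset.card_singleton]; exact Finset.card_le_two
      · simp only [Finset.mem_singleton, forall_eq]
        exact ⟨x + 1, mem_rung.2 (Or.inl rfl), x + 1 + n, mem_rung.2 (Or.inr rfl), hc⟩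
      · rintro u (rfl | rfl | rfl | rfl) <;> exact ⟨_, by simp, SameNear.refl _ _⟩
  · have hmono : ∀ k, k < d - 1 → A.IsMono j (x + 1 + (k : ℕ)) := by
      intro k hk
      have := h (k + 1) (by omega) (by omega)
      rwa [Nat.cast_add, Nat.cast_one, add_comm (k : ZMod (2 * n)), ← add_assoc] at this
    have hfirst : A.SameNear j 1 (x + 1) (x + 1 + n) := by
      have := (hmono 0 (by omega)).2.1
      rw [Nat.cast_zero, add_zero] at this
      exact SameNear.of_adj (adj_antipode _) this.symm
    have hend : (x + (d : ℕ) : ZMod (2 * n)) = x + 1 + (d - 2 : ℕ) + 1 := by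
      obtain ⟨d, rfl⟩ : ∃ d', d = d' + 2 := ⟨d - 2, by omega⟩
      push_cast [Nat.add_sub_cancel]; ring
    have hlast : A.SameNear j (d - 1) (x + 1) (x + (d : ℕ)) := by
      have := sameNear_of_isMono hmono
      have e : (x + 1 + (d - 1 : ℕ) : ZMod (2 * n)) = x + (d : ℕ) := by
        rw [Nat.cast_sub hd]; push_cast; ring
      rwa [e] at this
    have hlast' : A.SameNear j 1 (x + (d : ℕ)) (x + (d : ℕ) + n) := by
      have := hmono (d - 2) (by omega)
      rw [hend]
      exact SameNear.of_adj (adj_antipode _) (this.1.trans this.2.2.symm)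
    refine ⟨∅, {x + 1}, by simp, by simp, by simp, ?_⟩
    rintro u (rfl | rfl | rfl | rfl)
    · exact ⟨_, by simp, SameNear.refl _ _⟩
    · exact ⟨_, by simp, hfirst.mono (by omega)⟩
    · exact ⟨_, by simp, hlast.mono (by omega)⟩
    · exact ⟨_, by simp, hlast.trans hlast' (by omega)⟩

/-- Squares that are not mapped into a single layer are far from each other. -/
theorem isMono_add {w : ℕ} (hσ : IsSparse (w + 3) 7 σ) (hw : w + 1 < n) {x : ZMod (2 * n)}
    (hx : ¬ A.IsMono j x) {d : ℕ} (hd : 1 ≤ d) (hdw : d ≤ w) : A.IsMono j (x + (d : ℕ)) := by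
  classical
  -- For the smallest counterexample `d` all squares strictly between are monochromatic.
  induction d using Nat.strong_induction_on with
  | _ d ih =>
  by_contra hy
  have h2n := two_mul_natCast_zmod n
  have hd0 := natCast_add_ne (n := n) hd (by omega)
  have hd1 := natCast_add_ne (n := n) (d := d + 1) (by omega) (by omega)
  have d0 := hd0 0
  have d1 := hd0 1
  have d1' := hd0 (-1)
  have f0 := hd1 0
  have f1 := hd1 1
  have f1' := hd1 (-1)
  push_cast at d0 d1 d1' f0 f1 f1'
  obtain ⟨L₀, C₀, hL₀, hc₀, hs₀, hn₀⟩ := exists_split_middle (A := A) (j := j) (x := x) hd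
    (fun i hi hid => ih i hid hi (by omega))
  obtain ⟨L₁, C₁, hL₁, hc₁, hs₁, hn₁⟩ := exists_split_side (A := A) (j := j) (a := x)
    (a' := x + n) (p := x + 1) (p' := x + 1 + n) (e₁ := rim x) (e₂ := rim (x + n)) (e₃ := rung x)
    rfl (by rw [rim]; simp only [Sym2.eq_iff]; left; exact ⟨trivial, by ring⟩) rfl
    (adj_antipode _)
    (fun h => zmod_half_ne (n := n) (by linear_combination -(rim_injective h)))
    (rim_ne_rung _ _) (rim_ne_rung _ _) (not_isMono_iff.1 hx)
  obtain ⟨L₂, C₂, hL₂, hc₂, hs₂, hn₂⟩ := exists_split_side (A := A) (j := j) (a := x + d + 1)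
    (a' := x + d + 1 + n) (p := x + d) (p' := x + d + n) (e₁ := rim (x + d))
    (e₂ := rim (x + d + n)) (e₃ := rung (x + d + 1))
    Sym2.eq_swap (by rw [rim]; simp only [Sym2.eq_iff]; right; exact ⟨trivial, by ring⟩) rfl
    (adj_antipode _)
    (fun h => zmod_half_ne (n := n) (by linear_combination -(rim_injective h)))
    (rim_ne_rung _ _) (rim_ne_rung _ _)
    (fun h => hy ⟨h.1, h.2.2, h.2.1⟩)
  have hdisj01 : Disjoint L₀ L₁ := by
    rw [Finset.disjoint_left]
    intro f h h'
    have h := hL₀ f h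
    rcases hL₁ f h' with h' | h' | h'
    · exact rim_ne_rung _ _ (h'.symm.trans h)
    · exact rim_ne_rung _ _ (h'.symm.trans h)
    · rcases rung_eq_iff.1 (h.symm.trans h') with k | k
      · exact zmod_one_ne (n := n) (by linear_combination k)
      · exact zmod_half_sub_one_ne (n := n) (by linear_combination -k)
  have hdisj02 : Disjoint L₀ L₂ := by
    rw [Finset.disjoint_left]
    intro f h h'
    have h := hL₀ f h
    rcases hL₂ f h' with h' | h' | h'
    · exact rim_ne_rung _ _ (h'.symm.trans h)
    · exact rim_ne_rung _ _ (h'.symm.trans h)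
    · rcases rung_eq_iff.1 (h.symm.trans h') with k | k
      · exact d0 (by linear_combination -k)
      · exact d1 (by linear_combination -k)
  have hdisj12 : Disjoint L₁ L₂ := by
    rw [Finset.disjoint_left]
    intro f h h'
    rcases hL₁ f h with h | h | h <;> rcases hL₂ f h' with h' | h' | h' <;>
      have k := h.symm.trans h'
    · exact d0 (by linear_combination -(rim_injective k))
    · exact d1 (by linear_combination -(rim_injective k))
    · exact rim_ne_rung _ _ k
    · exact d1' (by linear_combination -(rim_injective k))
    · exact d0 (by linear_combination -(rim_injective k))
    · exact rim_ne_rung _ _ k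
    · exact rim_ne_rung _ _ k.symm
    · exact rim_ne_rung _ _ k.symm
    · rcases rung_eq_iff.1 k with k | k
      · exact f0 (by linear_combination -k)
      · exact f1 (by linear_combination -k)
  have hcardL : (L₀ ∪ L₁ ∪ L₂).card = L₀.card + L₁.card + L₂.card := by
    rw [Finset.card_union_of_disjoint (Finset.disjoint_union_left.2 ⟨hdisj02, hdisj12⟩),
      Finset.card_union_of_disjoint hdisj01]
  have b₀ : L₀.card ≤ 1 := by
    refine (Finset.card_le_card (t := {rung (x + 1)}) ?_).trans (by simp)
    intro f hf; simpa using hL₀ f hf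
  have b₁ : L₁.card ≤ 3 := by
    refine (Finset.card_le_card (t := {rim x, rim (x + (n : ZMod (2 * n))), rung x}) ?_).trans Finset.card_le_three
    intro f hf; simpa using hL₁ f hf
  have b₂ : L₂.card ≤ 3 := by
    refine (Finset.card_le_card (t := {rim (x + (d : ZMod (2 * n))),
      rim (x + (d : ZMod (2 * n)) + (n : ZMod (2 * n))), rung (x + (d : ZMod (2 * n)) + 1)}) ?_).trans
      Finset.card_le_three
    intro f hf; simpa using hL₂ f hf
  -- Since `|C₀| ≤ |L₀| + 1` and `|Lᵢ| = |Cᵢ| + 1` for `i = 1, 2`, there are more split edges than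
  -- clusters. The edges number at most `1 + 3 + 3 = 7`, and the radius is at most `(w + 1) + 2`.
  have := card_le_of_isSplit (A := A) (j := j) hσ (L := L₀ ∪ L₁ ∪ L₂) (C := C₀ ∪ C₁ ∪ C₂)
    (by omega) ?_ ?_
  · have h1 := Finset.card_union_le (C₀ ∪ C₁) C₂
    have h2 := Finset.card_union_le C₀ C₁
    omega
  · intro f hf
    rcases Finset.mem_union.1 hf with hf | hf
    · rcases Finset.mem_union.1 hf with hf | hf
      · exact hs₀ f hf
      · exact hs₁ f hf
    · exact hs₂ f hf
  · intro f hf u hu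
    rcases Finset.mem_union.1 hf with hf | hf
    · rcases Finset.mem_union.1 hf with hf | hf
      · rw [hL₀ f hf, mem_rung] at hu
        obtain ⟨c, hc, hcu⟩ := hn₀ u (by tauto)
        exact ⟨c, by simp [hc], hcu.mono (by omega)⟩
      · obtain ⟨c, hc, hcu⟩ := hn₁ f hf u hu
        rcases hc with hc | hc
        · exact ⟨c, by simp [hc], hcu.mono (by omega)⟩
        · obtain ⟨c', hc', hcc'⟩ := hn₀ c (by tauto)
          exact ⟨c', by simp [hc'], hcc'.trans hcu (by omega)⟩
    · obtain ⟨c, hc, hcu⟩ := hn₂ f hf u hu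
      rcases hc with hc | hc
      · exact ⟨c, by simp [hc], hcu.mono (by omega)⟩
      · obtain ⟨c', hc', hcc'⟩ := hn₀ c (by tauto)
        exact ⟨c', by simp [hc'], hcc'.trans hcu (by omega)⟩

theorem isMono_sub {w : ℕ} (hσ : IsSparse (w + 3) 7 σ) (hw : w + 1 < n) {x : ZMod (2 * n)}
    (hx : ¬ A.IsMono j x) {d : ℕ} (hd : 1 ≤ d) (hdw : d ≤ w) : A.IsMono j (x - (d : ℕ)) := by
  by_contra hy
  have := isMono_add hσ hw hy hd hdw
  rw [sub_add_cancel] at this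
  exact hx this

end IncidenceAut

/-! ### The automorphisms `x ↦ ± x + b` of the ladder. -/

section Slide

variable {n : ℕ}

/-- The image of `x` under the automorphism `x ↦ ± x + b` of the Möbius ladder. -/
def slide (s : Bool) (b x : ZMod (2 * n)) : ZMod (2 * n) := (if s then x else -x) + b

theorem slide_add_half (s : Bool) (b x : ZMod (2 * n)) : slide s b (x + n) = slide s b x + n := by
  have := two_mul_natCast_zmod n
  cases s <;> simp only [slide, if_true, Bool.false_eq_true, if_false]
  · linear_combination -this
  · ring

variable [hn : Fact (6 ≤ n)]

theorem slide_adj (s : Bool) (b : ZMod (2 * n)) {x y : ZMod (2 * n)} (h : (ladder n).Adj x y) :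
    (ladder n).Adj (slide s b x) (slide s b y) := by
  have h2n := two_mul_natCast_zmod n
  rw [ladder_adj] at h ⊢
  rcases h with rfl | rfl | rfl
  · cases s <;> simp only [slide, if_true, Bool.false_eq_true, if_false]
    · right; left; ring
    · left; ring
  · cases s <;> simp only [slide, if_true, Bool.false_eq_true, if_false]
    · left; ring
    · right; left; ring
  · right; right; exact slide_add_half s b x

/-- The action of `x ↦ ± x + b` on edges. -/
def slideEdge (s : Bool) (b : ZMod (2 * n)) : (ladder n).edgeSet → (ladder n).edgeSet :=
  SimpleGraph.Hom.mapEdgeSet ⟨slide s b, fun h => slide_adj s b h⟩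

theorem slide_mem_slideEdge (s : Bool) (b : ZMod (2 * n)) {e : (ladder n).edgeSet}
    {u : ZMod (2 * n)} (hu : u ∈ (e : Sym2 (ZMod (2 * n)))) :
    slide s b u ∈ (slideEdge s b e : Sym2 (ZMod (2 * n))) := Sym2.mem_map.2 ⟨u, hu, rfl⟩


end Slide

/-! ### Local description of an automorphism by states. -/

section States

variable {n : ℕ}

/-- The square of the Möbius ladder at `x`. -/
def InSquare (x u : ZMod (2 * n)) : Prop := u = x ∨ u = x + 1 ∨ u = x + n ∨ u = x + 1 + n

namespace IncidenceAut

variable {σ : Equiv.Perm (ladder n).edgeSet} {A : IncidenceAut σ} {j : Fin 2}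

variable (A j) in
/-- On the square at `x`, the automorphism `A` is given by `st`: the first component tells
whether the layer changes, the others describe the affine map. -/
def IsState (x : ZMod (2 * n)) (st : Fin 2 × Bool × ZMod (2 * n)) : Prop :=
  ∀ u, InSquare x u → A.color j u = j + st.1 ∧ A.place j u = slide st.2.1 st.2.2 u

theorem IsState.isMono {x : ZMod (2 * n)} {st : Fin 2 × Bool × ZMod (2 * n)}
    (h : A.IsState j x st) : A.IsMono j x := by
  have h1 := (h x (Or.inl rfl)).1
  exact ⟨(h _ (Or.inr (Or.inl rfl))).1.trans h1.symm,
    (h _ (Or.inr (Or.inr (Or.inl rfl)))).1.trans h1.symm,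
    (h _ (Or.inr (Or.inr (Or.inr rfl)))).1.trans h1.symm⟩

/-- In layer `k` the image of `e` has only two endpoints, and both are taken by the endpoints of `e`
from layer `j`. -/
theorem color_ne_of_not_isSplit {j' : Fin 2} (hj : j ≠ j') {e : (ladder n).edgeSet} {k : Fin 2}
    (h : ∀ u ∈ (layerPerm σ j e : Sym2 (ZMod (2 * n))), A.color j u = k) {v : ZMod (2 * n)}
    (hv : v ∈ (layerPerm σ j' e : Sym2 (ZMod (2 * n)))) : A.color j' v ≠ k := by
  intro hk
  obtain ⟨u, u', huu, -, he⟩ := exists_edge_eq (layerPerm σ j e)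
  have hu : u ∈ (layerPerm σ j e : Sym2 (ZMod (2 * n))) := by rw [he]; simp
  have hu' : u' ∈ (layerPerm σ j e : Sym2 (ZMod (2 * n))) := by rw [he]; simp
  have m1 := (A.mem_iff (u, j) e).1 hu
  have m2 := (A.mem_iff (u', j) e).1 hu'
  have m3 := (A.mem_iff (v, j') e).1 hv
  rw [onVertex_eq] at m1 m2 m3
  simp only [h u hu, h u' hu', hk] at m1 m2 m3
  have hpp := place_ne (A := A) (j := j) huu ((h u hu).trans (h u' hu').symm)
  have := (Sym2.mem_and_mem_iff hpp).1 ⟨m1, m2⟩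
  rw [this, Sym2.mem_iff] at m3
  rcases m3 with m3 | m3
  · have : A.onVertex (v, j') = A.onVertex (u, j) := by
      rw [onVertex_eq, onVertex_eq, m3, hk, h u hu]
    exact hj (congrArg Prod.snd (A.onVertex.injective this)).symm
  · have : A.onVertex (v, j') = A.onVertex (u', j) := by
      rw [onVertex_eq, onVertex_eq, m3, hk, h u' hu']
    exact hj (congrArg Prod.snd (A.onVertex.injective this)).symm

/-- If `e` is not split in layer `j`, its endpoints in layer `j'` avoid that color, and only one
other color exists. -/
theorem isSplit_of_isSplit {j' : Fin 2} (hj : j ≠ j') {e : (ladder n).edgeSet}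
    (h : A.IsSplit j' (layerPerm σ j' e)) : A.IsSplit j (layerPerm σ j e) := by
  by_contra hns
  obtain ⟨u, v, huv, -, he⟩ := exists_edge_eq (layerPerm σ j e)
  have hu : u ∈ (layerPerm σ j e : Sym2 (ZMod (2 * n))) := by rw [he]; simp
  have hk : ∀ w ∈ (layerPerm σ j e : Sym2 (ZMod (2 * n))), A.color j w = A.color j u := by
    intro w hw
    by_contra hne
    exact hns ⟨w, hw, u, hu, hne⟩
  obtain ⟨x, hx, y, hy, hxy⟩ := h
  have h1 := color_ne_of_not_isSplit hj hk hx
  have h2 := color_ne_of_not_isSplit hj hk hy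
  omega

variable [hn : Fact (6 ≤ n)]

theorem IsState.unique {x : ZMod (2 * n)} {st st' : Fin 2 × Bool × ZMod (2 * n)}
    (h : A.IsState j x st) (h' : A.IsState j x st') : st = st' := by
  obtain ⟨c, s, b⟩ := st
  obtain ⟨c', s', b'⟩ := st'
  obtain ⟨h1, h2⟩ := h x (Or.inl rfl)
  obtain ⟨h3, h4⟩ := h (x + 1) (Or.inr (Or.inl rfl))
  obtain ⟨h1', h2'⟩ := h' x (Or.inl rfl)
  obtain ⟨h3', h4'⟩ := h' (x + 1) (Or.inr (Or.inl rfl))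
  have hc : c = c' := add_left_cancel (h1.symm.trans h1')
  have e1 := h2.symm.trans h2'
  have e2 := h4.symm.trans h4'
  have h2ne := zmod_two_ne (n := n)
  cases s <;> cases s' <;>
    simp only [slide, if_true, Bool.false_eq_true, if_false] at e1 e2
  · rw [hc, add_left_cancel e1]
  · exact (h2ne (by linear_combination e1 - e2)).elim
  · exact (h2ne (by linear_combination e2 - e1)).elim
  · rw [hc, add_left_cancel e1]

/-- The images of two squares with a common rung are 4-cycles, hence squares, with a common edge.
Injectivity forces that edge to be a rung and both squares to run in the same direction. -/
theorem isState_of_isMono {x : ZMod (2 * n)} (h : A.IsMono j x) (h' : A.IsMono j (x + 1)) :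
    ∃ st, A.IsState j x st ∧ A.IsState j (x + 1) st := by
  have h2n := two_mul_natCast_zmod n
  obtain ⟨c1, c2, c3⟩ := h
  obtain ⟨c4, c5, c6⟩ := h'
  rw [c1] at c4 c5 c6
  have a1 := adj_place (adj_succ x) c1.symm
  have a2 := adj_place (adj_antipode (x + 1)) (c1.trans c3.symm)
  have a3 : (ladder n).Adj (A.place j (x + 1 + n)) (A.place j (x + n)) := by
    apply adj_place _ (c3.trans c2.symm)
    rw [ladder_adj]; right; left; ring
  have a4 := (adj_place (adj_antipode x) c2.symm).symm
  have b1 := adj_place (adj_succ (x + 1)) (c1.trans c4.symm)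
  have b2 := adj_place (adj_antipode (x + 1 + 1)) (c4.trans c6.symm)
  have b3 : (ladder n).Adj (A.place j (x + 1 + 1 + n)) (A.place j (x + 1 + n)) := by
    apply adj_place _ (c6.trans c3.symm)
    rw [ladder_adj]; right; left; ring
  have b4 := a2.symm
  have d1 : A.place j x ≠ A.place j (x + 1 + n) := place_ne
    (fun h => zmod_half_add_one_ne (n := n) (by linear_combination -h)) c3.symm
  have d2 : A.place j (x + 1) ≠ A.place j (x + n) := place_ne
    (fun h => zmod_half_sub_one_ne (n := n) (by linear_combination -h)) (c1.trans c2.symm)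
  have d3 : A.place j (x + 1) ≠ A.place j (x + 1 + 1 + n) := place_ne
    (fun h => zmod_half_add_one_ne (n := n) (by linear_combination -h)) (c1.trans c6.symm)
  have d4 : A.place j (x + 1 + 1) ≠ A.place j (x + 1 + n) := place_ne
    (fun h => zmod_half_sub_one_ne (n := n) (by linear_combination -h)) (c4.trans c3.symm)
  have d5 : A.place j (x + 1 + 1) ≠ A.place j x := place_ne
    (fun h => zmod_two_ne (n := n) (by linear_combination h)) c4
  rcases ladder_four_cycle a1 a2 a3 a4 d1 d2 with ⟨k1, k2, k3⟩ | ⟨k1, k2, k3⟩ <;>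
  rcases ladder_four_cycle b1 b2 b3 b4 d3 d4 with ⟨l1, l2, l3⟩ | ⟨l1, l2, l3⟩
  · exact (d5 (by rw [l1, k1]; linear_combination h2n)).elim
  · exact (d1 (by rw [l1, k1]; linear_combination -h2n)).elim
  · exact (d4 (by rw [l1, k3])).elim
  -- Rungs go to rungs here, so only the direction of the first rim step is left to decide the sign.
  · have main : ∃ st : Fin 2 × Bool × ZMod (2 * n), A.color j x = j + st.1 ∧
        A.place j x = slide st.2.1 st.2.2 x ∧ A.place j (x + 1) = slide st.2.1 st.2.2 (x + 1) ∧
        A.place j (x + 1 + 1) = slide st.2.1 st.2.2 (x + 1 + 1) := by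
      rcases k2 with k2 | k2
      · refine ⟨(A.color j x - j, true, A.place j x - x), (add_sub_cancel _ _).symm, ?_, ?_, ?_⟩ <;>
          simp only [slide, if_true]
        · ring
        · rw [k2]; ring
        · rcases l2 with l2 | l2
          · rw [l2, k2]; ring
          · exact (d5 (by rw [l2, k2]; ring)).elim
      · refine ⟨(A.color j x - j, false, A.place j x + x), (add_sub_cancel _ _).symm, ?_, ?_, ?_⟩ <;>
          simp only [slide, Bool.false_eq_true, if_false]
        · ring
        · rw [k2]; ring
        · rcases l2 with l2 | l2
          · exact (d5 (by rw [l2, k2]; ring)).elim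
          · rw [l2, k2]; ring
    obtain ⟨⟨c, s, b⟩, m0, m1, m2, m3⟩ := main
    refine ⟨(c, s, b), ?_, ?_⟩
    · rintro u (rfl | rfl | rfl | rfl)
      · exact ⟨m0, m1⟩
      · exact ⟨c1.trans m0, m2⟩
      · exact ⟨c2.trans m0, by rw [slide_add_half, k1, m1]⟩
      · exact ⟨c3.trans m0, by rw [slide_add_half, l1, m2]⟩
    · rintro u (rfl | rfl | rfl | rfl)
      · exact ⟨c1.trans m0, m2⟩
      · exact ⟨c4.trans m0, m3⟩
      · exact ⟨c3.trans m0, by rw [slide_add_half, l1, m2]⟩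
      · exact ⟨c6.trans m0, by rw [slide_add_half, l3, m3]⟩

variable (A j) in
open Classical in
/-- The description of `A` on the square at `x`, if it maps this square into one layer. -/
noncomputable def state (x : ZMod (2 * n)) : Option (Fin 2 × Bool × ZMod (2 * n)) :=
  if h : ∃ st, A.IsState j x st then some h.choose else none

theorem state_eq_some_iff {x : ZMod (2 * n)} {st : Fin 2 × Bool × ZMod (2 * n)} :
    A.state j x = some st ↔ A.IsState j x st := by
  unfold state
  split_ifs with h
  · rw [Option.some.injEq]
    exact ⟨fun h' => h' ▸ h.choose_spec, fun h' => h.choose_spec.unique h'⟩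
  · exact ⟨fun h' => by simp at h', fun h' => (h ⟨st, h'⟩).elim⟩

/-- A monochromatic square has a monochromatic neighbor to form a state with: if the one at `x + 1`
is exceptional, the one at `x - 1` is not, being only two steps away from it. -/
theorem state_eq_none_iff {w : ℕ} (hσ : IsSparse (w + 3) 7 σ) (hw : w + 1 < n) (h2 : 2 ≤ w)
    {x : ZMod (2 * n)} : A.state j x = none ↔ ¬ A.IsMono j x := by
  constructor
  · intro h hx
    by_cases h1 : A.IsMono j (x + 1)
    · obtain ⟨st, hst, _⟩ := isState_of_isMono hx h1
      rw [state_eq_some_iff.2 hst] at h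
      simp at h
    · have h3 := isMono_sub hσ hw h1 (d := 2) (by norm_num) h2
      have e : (x + 1 - (2 : ℕ) : ZMod (2 * n)) = x - 1 := by push_cast; ring
      rw [e] at h3
      obtain ⟨st, -, hst⟩ := isState_of_isMono h3 (by rwa [sub_add_cancel])
      rw [sub_add_cancel] at hst
      rw [state_eq_some_iff.2 hst] at h
      simp at h
  · intro h
    rcases hs : A.state j x with _ | st
    · rfl
    · exact (h (state_eq_some_iff.1 hs).isMono).elim

theorem state_succ (x : ZMod (2 * n)) :
    A.state j x = none ∨ A.state j (x + 1) = none ∨ A.state j x = A.state j (x + 1) := by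
  rcases h : A.state j x with _ | st
  · exact Or.inl rfl
  rcases h' : A.state j (x + 1) with _ | st'
  · exact Or.inr (Or.inl rfl)
  right; right
  obtain ⟨t, h1, h2⟩ := isState_of_isMono (state_eq_some_iff.1 h).isMono
    (state_eq_some_iff.1 h').isMono
  rw [(state_eq_some_iff.1 h).unique h1, (state_eq_some_iff.1 h').unique h2]

end IncidenceAut

variable [hn : Fact (6 ≤ n)]

open Classical in
/-- The partial action on edges described by a state for every square. -/
noncomputable def stateLift (S : ZMod (2 * n) → Option (Fin 2 × Bool × ZMod (2 * n)))
    (f : (ladder n).edgeSet) : Option (Fin 2 × (ladder n).edgeSet) :=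
  if h : ∃ st : Fin 2 × Bool × ZMod (2 * n), ∃ x, S x = some st ∧
      ∀ u ∈ (f : Sym2 (ZMod (2 * n))), InSquare x u then
    some (h.choose.1, slideEdge h.choose.2.1 h.choose.2.2 f) else none

theorem exists_of_stateLift_eq_some {S : ZMod (2 * n) → Option (Fin 2 × Bool × ZMod (2 * n))}
    {f y : (ladder n).edgeSet} {c : Fin 2} (h : stateLift S f = some (c, y)) :
    ∃ s b x, S x = some (c, s, b) ∧ (∀ u ∈ (f : Sym2 (ZMod (2 * n))), InSquare x u) ∧
      y = slideEdge s b f := by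
  unfold stateLift at h
  split_ifs at h with h'
  simp only [Option.some.injEq, Prod.mk.injEq] at h
  obtain ⟨x, hx, hf⟩ := h'.choose_spec
  refine ⟨h'.choose.2.1, h'.choose.2.2, x, ?_, hf, h.2.symm⟩
  rw [hx, ← h.1]

theorem stateLift_ne_none {S : ZMod (2 * n) → Option (Fin 2 × Bool × ZMod (2 * n))}
    {f : (ladder n).edgeSet} {x : ZMod (2 * n)} (hx : S x ≠ none)
    (hf : ∀ u ∈ (f : Sym2 (ZMod (2 * n))), InSquare x u) : stateLift S f ≠ none := by
  unfold stateLift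
  rw [dif_pos]
  · simp
  · obtain ⟨st, hst⟩ := Option.ne_none_iff_exists'.1 hx
    exact ⟨st, x, hst, hf⟩

theorem inSquare_of_mem_rim {x : ZMod (2 * n)} :
    ∀ u ∈ (rim x : Sym2 (ZMod (2 * n))), InSquare x u := by
  intro u hu
  rcases mem_rim.1 hu with h | h
  · exact Or.inl h
  · exact Or.inr (Or.inl h)

theorem inSquare_of_mem_rung {x : ZMod (2 * n)} :
    ∀ u ∈ (rung x : Sym2 (ZMod (2 * n))), InSquare x u := by
  intro u hu
  rcases mem_rung.1 hu with h | h
  · exact Or.inl h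
  · exact Or.inr (Or.inr (Or.inl h))

theorem inSquare_sub_one_of_mem_rung {x : ZMod (2 * n)} :
    ∀ u ∈ (rung x : Sym2 (ZMod (2 * n))), InSquare (x - 1) u := by
  intro u hu
  rcases mem_rung.1 hu with h | h
  · right; left; rw [h]; ring
  · right; right; right; rw [h]; ring

namespace IncidenceAut

variable {σ : Equiv.Perm (ladder n).edgeSet} {A : IncidenceAut σ} {j : Fin 2}

theorem color_of_stateLift {f y : (ladder n).edgeSet} {c : Fin 2}
    (h : stateLift (A.state j) f = some (c, y)) :
    ∀ u ∈ (f : Sym2 (ZMod (2 * n))), A.color j u = j + c := by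
  obtain ⟨s, b, x, hx, hf, -⟩ := exists_of_stateLift_eq_some h
  exact fun u hu => (state_eq_some_iff.1 hx u (hf u hu)).1

/-- An edge is determined by its two endpoints. This ties the partial map on edges to `A`, and makes
it injective. -/
theorem edgeImage_of_stateLift {f y : (ladder n).edgeSet} {c : Fin 2}
    (h : stateLift (A.state j) f = some (c, y)) : layerPerm σ (j + c) (A.edgeImage j f) = y := by
  obtain ⟨s, b, x, hx, hf, rfl⟩ := exists_of_stateLift_eq_some h
  have hst := state_eq_some_iff.1 hx
  obtain ⟨u, v, huv, -, hfuv⟩ := exists_edge_eq f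
  have hu : u ∈ (f : Sym2 (ZMod (2 * n))) := by rw [hfuv]; simp
  have hv : v ∈ (f : Sym2 (ZMod (2 * n))) := by rw [hfuv]; simp
  obtain ⟨c1, p1⟩ := hst u (hf u hu)
  obtain ⟨c2, p2⟩ := hst v (hf v hv)
  have m1 := place_mem (A := A) (j := j) hu
  have m2 := place_mem (A := A) (j := j) hv
  rw [c1] at m1
  rw [c2] at m2
  refine edge_eq_of_mem (place_ne huv (c1.trans c2.symm)) m1 m2 ?_ ?_
  · rw [p1]; exact slide_mem_slideEdge s b hu
  · rw [p2]; exact slide_mem_slideEdge s b hv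

theorem stateLift_injective {f g : (ladder n).edgeSet}
    (h : stateLift (A.state j) f = stateLift (A.state j) g)
    (hf : stateLift (A.state j) f ≠ none) : f = g := by
  obtain ⟨⟨c, y⟩, hy⟩ := Option.ne_none_iff_exists'.1 hf
  have h1 := edgeImage_of_stateLift hy
  have h2 := edgeImage_of_stateLift (h ▸ hy)
  have h3 := (layerPerm σ (j + c)).injective (h1.trans h2.symm)
  simpa [edgeImage] using h3

/-- The neighboring squares are monochromatic, so both rungs of the square at `x` are unsplit. Were
the rim unsplit too, the square would be monochromatic. -/
theorem isSplit_rim {w : ℕ} (hσ : IsSparse (w + 3) 7 σ) (hw : w + 1 < n) (h2 : 2 ≤ w)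
    {x : ZMod (2 * n)} (hx : A.state j x = none) :
    A.color j x ≠ A.color j (x + 1) := by
  have hnm := (state_eq_none_iff hσ hw h2).1 hx
  have h1 := isMono_add hσ hw hnm (d := 1) le_rfl (by omega)
  have h3 := isMono_sub hσ hw hnm (d := 1) le_rfl (by omega)
  rw [Nat.cast_one] at h1 h3
  obtain ⟨c1, c2, c3⟩ := h3
  rw [sub_add_cancel] at c1 c3
  intro h
  exact hnm ⟨h.symm, c3.trans c1.symm, h1.2.1.trans h.symm⟩

/-- A rung lies in two consecutive squares, which are not both exceptional; so only rims can lack a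
lift. -/
theorem stateLift_eq_none_iff {w : ℕ} (hσ : IsSparse (w + 3) 7 σ) (hw : w + 1 < n) (h2 : 2 ≤ w)
    {f : (ladder n).edgeSet} :
    stateLift (A.state j) f = none ↔ A.IsSplit j f := by
  constructor
  · intro h
    rcases edge_cases f with ⟨x, rfl⟩ | ⟨x, rfl⟩
    · have hx : A.state j x = none := by
        by_contra hx
        exact stateLift_ne_none hx inSquare_of_mem_rim h
      exact ⟨x, mem_rim.2 (Or.inl rfl), x + 1, mem_rim.2 (Or.inr rfl), isSplit_rim hσ hw h2 hx⟩
    · exfalso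
      have hx : A.state j x = none := by
        by_contra hx
        exact stateLift_ne_none hx inSquare_of_mem_rung h
      have hx' : A.state j (x - 1) = none := by
        by_contra hx
        exact stateLift_ne_none hx inSquare_sub_one_of_mem_rung h
      rw [state_eq_none_iff hσ hw h2] at hx hx'
      have := isMono_sub hσ hw hx (d := 1) le_rfl (by omega)
      rw [Nat.cast_one] at this
      exact hx' this
  · rintro ⟨u, hu, v, hv, huv⟩
    rcases h : stateLift (A.state j) f with _ | ⟨c, y⟩
    · rfl
    · exact (huv ((color_of_stateLift h u hu).trans (color_of_stateLift h v hv).symm)).elim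

/-- The element `A.onEdge e` is computed once from `e` in layer 0 and once from `σ e` in layer 1.
Comparing the results gives the preserved form if layers are kept at `e` and the reversed form if
they are swapped. -/
theorem isTransported {w : ℕ} (hσ : IsSparse (w + 3) 7 σ) (hw : w + 1 < n) (h2 : 2 ≤ w)
    {e : (ladder n).edgeSet} (h : stateLift (A.state 0) e ≠ none)
    (h' : stateLift (A.state 0) e ≠ some (0, e)) :
    IsTransported (stateLift (A.state 0)) (stateLift (A.state 1)) σ e := by
  obtain ⟨⟨c, x⟩, hx⟩ := Option.ne_none_iff_exists'.1 h
  have hns : ¬ A.IsSplit 0 e := fun hs => h ((stateLift_eq_none_iff hσ hw h2).2 hs)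
  have h1 : stateLift (A.state 1) (σ e) ≠ none := fun h0 => hns
    (isSplit_of_isSplit (j := 0) (j' := 1) (by decide) ((stateLift_eq_none_iff hσ hw h2).1 h0))
  obtain ⟨⟨c', y⟩, hy⟩ := Option.ne_none_iff_exists'.1 h1
  -- The endpoints of the edge in layer 1 avoid the layer taken by those in layer 0, so `1 + c' ≠ c`
  -- modulo 2.
  have hcc : c' = c := by
    have k1 := color_of_stateLift hx
    obtain ⟨v, _, -, -, hv⟩ := exists_edge_eq (σ e)
    have hv : v ∈ (σ e : Sym2 (ZMod (2 * n))) := by rw [hv]; simp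
    have k2 := color_ne_of_not_isSplit (A := A) (j := 0) (j' := 1) (e := e) (by decide) k1 hv
    rw [color_of_stateLift hy v hv] at k2
    clear * - k2
    revert k2; revert c c'; decide
  subst hcc
  have k1 := edgeImage_of_stateLift hx
  have k2 := edgeImage_of_stateLift hy
  have e0 : A.edgeImage 0 e = A.onEdge e := rfl
  have e1 : A.edgeImage 1 (σ e) = A.onEdge e := by simp [edgeImage]
  rw [e0] at k1
  rw [e1] at k2
  have hc : c' = 0 ∨ c' = 1 := by omega
  rcases hc with rfl | rfl
  · left
    refine ⟨x, hx, ?_, ?_⟩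
    · rintro rfl; exact h' hx
    · rw [hy, ← k2, ← k1]; rfl
  · right
    refine ⟨y, ?_, hy⟩
    rw [hx, ← k2, ← k1]; rfl

end IncidenceAut

end States

/-! ### Counting state functions and the edges they move. -/

section StateCount

variable {n : ℕ} [hn : Fact (6 ≤ n)]

open Classical in
/-- The squares without a state. -/
noncomputable def noneSet (S : ZMod (2 * n) → Option (Fin 2 × Bool × ZMod (2 * n))) :
    Finset (ZMod (2 * n)) := Finset.univ.filter fun x => S x = none

open Classical in
/-- The edges moved by the partial action of `S`. -/
noncomputable def movedEdges (S : ZMod (2 * n) → Option (Fin 2 × Bool × ZMod (2 * n))) :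
    Finset (ladder n).edgeSet :=
  Finset.univ.filter fun e => stateLift S e ≠ none ∧ stateLift S e ≠ some (0, e)

open Classical in
/-- The state functions with `t` exceptional squares that are constant in between. -/
noncomputable def stateFunctions (n t : ℕ) [Fact (6 ≤ n)] :
    Finset (ZMod (2 * n) → Option (Fin 2 × Bool × ZMod (2 * n))) :=
  Finset.univ.filter fun S => (noneSet S).card = t ∧
    ∀ x, S x = none ∨ S (x + 1) = none ∨ S x = S (x + 1)

theorem mem_noneSet {S : ZMod (2 * n) → Option (Fin 2 × Bool × ZMod (2 * n))}
    {x : ZMod (2 * n)} : x ∈ noneSet S ↔ S x = none := by simp [noneSet]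

theorem mem_movedEdges {S : ZMod (2 * n) → Option (Fin 2 × Bool × ZMod (2 * n))}
    {e : (ladder n).edgeSet} :
    e ∈ movedEdges S ↔ stateLift S e ≠ none ∧ stateLift S e ≠ some (0, e) := by
  simp [movedEdges]

theorem mem_stateFunctions {S : ZMod (2 * n) → Option (Fin 2 × Bool × ZMod (2 * n))} {t : ℕ} :
    S ∈ stateFunctions n t ↔ (noneSet S).card = t ∧
      ∀ x, S x = none ∨ S (x + 1) = none ∨ S x = S (x + 1) := by simp [stateFunctions]

/-- A state function is recovered from the exceptional positions, the value just after each of them,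
and the value at 0. There are `2 * 2 * 2n = 8n` states, and one more value for none. -/
theorem card_stateFunctions_le (t : ℕ) :
    (stateFunctions n t).card ≤ (2 * n) ^ t * ((8 * n + 1) ^ t * (8 * n + 1)) := by
  classical
  have hz : ∀ S ∈ stateFunctions n t, ∃ z : Fin t → ZMod (2 * n), ∀ x, S x = none ↔ ∃ i, z i = x := by
    intro S hS
    have e := Finset.equivFinOfCardEq (mem_stateFunctions.1 hS).1
    refine ⟨fun i => (e.symm i).1, fun x => ⟨fun hx => ?_, ?_⟩⟩
    · exact ⟨e ⟨x, mem_noneSet.2 hx⟩, by simp⟩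
    · rintro ⟨i, rfl⟩
      exact mem_noneSet.1 (e.symm i).2
  choose! z hz using hz
  have hcard : Fintype.card ((Fin t → ZMod (2 * n)) ×
      (Fin t → Option (Fin 2 × Bool × ZMod (2 * n))) × Option (Fin 2 × Bool × ZMod (2 * n))) =
      (2 * n) ^ t * ((8 * n + 1) ^ t * (8 * n + 1)) := by
    have h8 : 2 * (2 * (2 * n)) = 8 * n := by ring
    simp [ZMod.card, h8]
  rw [← hcard, ← Finset.card_univ]
  refine Finset.card_le_card_of_injOn
    (fun S => (z S, fun i => S (z S i + 1), S 0)) (by simp) ?_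
  intro S hS S' hS' h
  simp only [Prod.mk.injEq] at h
  obtain ⟨h1, h2, h3⟩ := h
  have hS := Finset.mem_coe.1 hS
  have hS' := Finset.mem_coe.1 hS'
  have hnone : ∀ x, S x = none ↔ S' x = none := by
    intro x
    rw [hz S hS, hz S' hS', h1]
  have key : ∀ k : ℕ, S (k : ZMod (2 * n)) = S' (k : ZMod (2 * n)) := by
    intro k
    induction k with
    | zero => simpa using h3
    | succ k ih =>
      push_cast
      rcases (mem_stateFunctions.1 hS).2 k with h | h | h
      · obtain ⟨i, hi⟩ := (hz S hS _).1 h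
        have := congrFun h2 i
        simp only [← h1, hi] at this
        exact this
      · rw [h, ((hnone _).1 h)]
      · rcases (mem_stateFunctions.1 hS').2 k with h' | h' | h'
        · have h0 := (hnone _).2 h'
          obtain ⟨i, hi⟩ := (hz S hS _).1 h0
          have := congrFun h2 i
          simp only [← h1, hi] at this
          exact this
        · rw [h', ((hnone _).2 h')]
        · rw [← h, ← h', ih]
  funext x
  have := key x.val
  rwa [ZMod.natCast_zmod_val] at this

theorem stateLift_eq_of_forall {S : ZMod (2 * n) → Option (Fin 2 × Bool × ZMod (2 * n))}
    {c : Fin 2} {s : Bool} {b : ZMod (2 * n)} (h : ∀ x, S x = some (c, s, b))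
    (f : (ladder n).edgeSet) : stateLift S f = some (c, slideEdge s b f) := by
  have hne : stateLift S f ≠ none := by
    rcases edge_cases f with ⟨x, rfl⟩ | ⟨x, rfl⟩
    · exact stateLift_ne_none (by rw [h x]; simp) inSquare_of_mem_rim
    · exact stateLift_ne_none (by rw [h x]; simp) inSquare_of_mem_rung
  obtain ⟨⟨c', y⟩, hy⟩ := Option.ne_none_iff_exists'.1 hne
  obtain ⟨s', b', x, hx, -, rfl⟩ := exists_of_stateLift_eq_some hy
  rw [h x] at hx
  simp only [Option.some.injEq, Prod.mk.injEq] at hx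
  rw [hy, hx.1, hx.2.1, hx.2.2]

/-- Two fixed consecutive rims have a fixed common vertex, and a reflection there would exchange
them. -/
theorem eq_of_slideEdge_rim {s : Bool} {b x : ZMod (2 * n)} (h1 : slideEdge s b (rim x) = rim x)
    (h2 : slideEdge s b (rim (x + 1)) = rim (x + 1)) : s = true ∧ b = 0 := by
  have k1 := slide_mem_slideEdge s b (e := rim x) (u := x + 1) (mem_rim.2 (Or.inr rfl))
  have k2 := slide_mem_slideEdge s b (e := rim (x + 1)) (u := x + 1) (mem_rim.2 (Or.inl rfl))
  have k3 := slide_mem_slideEdge s b (e := rim (x + 1)) (u := x + 1 + 1) (mem_rim.2 (Or.inr rfl))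
  rw [h1, mem_rim] at k1
  rw [h2, mem_rim] at k2 k3
  have e : slide s b (x + 1) = x + 1 := by
    rcases k1 with k1 | k1
    · rcases k2 with k2 | k2
      · exact k2
      · exact (zmod_two_ne (n := n) (by linear_combination k1 - k2)).elim
    · exact k1
  cases s <;> simp only [slide, if_true, Bool.false_eq_true, if_false] at e k3
  · rcases k3 with k3 | k3
    · exact (zmod_one_ne (n := n) (by linear_combination e - k3)).elim
    · exact (zmod_two_ne (n := n) (by linear_combination e - k3)).elim
  · exact ⟨rfl, by linear_combination e⟩

/-- By `eq_of_slideEdge_rim` an unmoved rim is followed by a moved one, so at least half of the `2 *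
n` rims are moved. -/
theorem le_card_movedEdges {S : ZMod (2 * n) → Option (Fin 2 × Bool × ZMod (2 * n))}
    {c : Fin 2} {s : Bool} {b : ZMod (2 * n)} (h : ∀ x, S x = some (c, s, b))
    (hne : ¬ (c = 0 ∧ s = true ∧ b = 0)) : n ≤ (movedEdges S).card := by
  classical
  set T : Finset (ZMod (2 * n)) := Finset.univ.filter fun x => rim x ∈ movedEdges S with hT
  have h1 : T.card ≤ (movedEdges S).card := by
    apply Finset.card_le_card_of_injOn rim
    · intro x hx
      exact (Finset.mem_filter.1 hx).2
    · exact rim_injective.injOn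
  have h2 : Tᶜ.card ≤ T.card := by
    apply Finset.card_le_card_of_injOn (· + 1)
    · intro x hx
      simp only [hT, Finset.coe_compl, Set.mem_compl_iff, Finset.mem_coe, Finset.mem_filter,
        Finset.mem_univ, true_and] at hx ⊢
      by_contra hx'
      rw [mem_movedEdges, stateLift_eq_of_forall h] at hx hx'
      simp only [ne_eq, reduceCtorEq, not_false_eq_true, Option.some.injEq, Prod.mk.injEq,
        true_and, not_not] at hx hx'
      exact hne ⟨hx.1, eq_of_slideEdge_rim hx.2 hx'.2⟩
    · exact (add_left_injective 1).injOn
  have h3 := Finset.card_compl_add_card T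
  rw [ZMod.card] at h3
  omega

end StateCount

/-! ### Exceptional squares force many moved edges. -/

namespace IncidenceAut

variable {n : ℕ} [hn : Fact (6 ≤ n)] {σ : Equiv.Perm (ladder n).edgeSet} {A : IncidenceAut σ}

/-- The identity on layer 0 fixes every edge, and a vertex of layer 1 is determined by its incident
edges. -/
theorem eq_one_of_state {A : IncidenceAut σ} (h : ∀ x, A.state 0 x = some (0, true, 0)) :
    (∀ x, A.onVertex x = x) ∧ ∀ e, A.onEdge e = e := by
  have h0 : ∀ u, A.onVertex (u, 0) = (u, 0) := by
    intro u
    obtain ⟨h1, h2⟩ := state_eq_some_iff.1 (h u) u (Or.inl rfl)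
    rw [onVertex_eq, h1, h2]
    simp [slide]
  have he : ∀ e, A.onEdge e = e := by
    intro e
    have := edgeImage_of_stateLift (stateLift_eq_of_forall h e)
    have hs : slideEdge true 0 e = e := by
      obtain ⟨u, v, huv, -, he⟩ := exists_edge_eq e
      have hu : u ∈ (e : Sym2 (ZMod (2 * n))) := by rw [he]; simp
      have hv : v ∈ (e : Sym2 (ZMod (2 * n))) := by rw [he]; simp
      have k1 := slide_mem_slideEdge true 0 hu
      have k2 := slide_mem_slideEdge true 0 hv
      simp only [slide, if_true, add_zero] at k1 k2
      exact edge_eq_of_mem huv k1 k2 hu hv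
    rw [hs] at this
    exact this
  refine ⟨?_, he⟩
  rintro ⟨v, k⟩
  have hk : k = 0 ∨ k = 1 := by omega
  rcases hk with rfl | rfl
  · exact h0 v
  rcases hx : A.onVertex (v, 1) with ⟨u, k⟩
  have hk : k = 0 ∨ k = 1 := by omega
  rcases hk with rfl | rfl
  · have := A.onVertex.injective (hx.trans (h0 u).symm)
    simp at this
  · have key : ∀ f : (ladder n).edgeSet, v ∈ (f : Sym2 (ZMod (2 * n))) →
        u ∈ (f : Sym2 (ZMod (2 * n))) := by
      intro f hf
      have := (A.mem_iff (v, 1) (σ⁻¹ f)).1 (by simpa using hf)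
      rw [hx, he] at this
      simpa using this
    have k1 := mem_rim.1 (key (rim v) (mem_rim.2 (Or.inl rfl)))
    have k2 := mem_rim.1 (key (rim (v - 1)) (mem_rim.2 (Or.inr (by ring))))
    rcases k1 with k1 | k1
    · rw [k1]
    · rcases k2 with k2 | k2
      · exact (zmod_two_ne (n := n) (by linear_combination k2 - k1)).elim
      · rw [k2]; simp

/-- Exceptional squares correspond to split rims, all split edges are rims, and `σ` matches the
split edges of the two layers. -/
theorem card_noneSet_eq {w : ℕ} (hσ : IsSparse (w + 3) 7 σ) (hw : w + 1 < n) (h2 : 2 ≤ w) :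
    (noneSet (A.state 1)).card = (noneSet (A.state 0)).card := by
  classical
  have key : ∀ j, (noneSet (A.state j)).image rim = Finset.univ.filter fun f => A.IsSplit j f := by
    intro j
    ext f
    simp only [Finset.mem_image, mem_noneSet, Finset.mem_filter, Finset.mem_univ, true_and]
    constructor
    · rintro ⟨x, hx, rfl⟩
      exact ⟨x, mem_rim.2 (Or.inl rfl), x + 1, mem_rim.2 (Or.inr rfl), isSplit_rim hσ hw h2 hx⟩
    · intro hf
      have h0 := (stateLift_eq_none_iff hσ hw h2).2 hf
      rcases edge_cases f with ⟨x, rfl⟩ | ⟨x, rfl⟩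
      · refine ⟨x, ?_, rfl⟩
        by_contra hx
        exact stateLift_ne_none hx inSquare_of_mem_rim h0
      · exfalso
        have hx : A.state j x = none := by
          by_contra hx
          exact stateLift_ne_none hx inSquare_of_mem_rung h0
        have hx' : A.state j (x - 1) = none := by
          by_contra hx
          exact stateLift_ne_none hx inSquare_sub_one_of_mem_rung h0
        rw [state_eq_none_iff hσ hw h2] at hx hx'
        have := isMono_sub hσ hw hx (d := 1) le_rfl (by omega)
        rw [Nat.cast_one] at this
        exact hx' this
  rw [← Finset.card_image_of_injective _ rim_injective,
    ← Finset.card_image_of_injective (noneSet (A.state 0)) rim_injective, key, key,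
    ← Finset.card_image_of_injective (Finset.univ.filter fun f => A.IsSplit 0 f) σ.injective]
  congr 1
  ext f
  simp only [Finset.mem_image, Finset.mem_filter, Finset.mem_univ, true_and]
  constructor
  · intro hf
    refine ⟨σ⁻¹ f, isSplit_of_isSplit (j := 0) (j' := 1) (by decide) (by simpa using hf),
      by simp⟩
  · rintro ⟨e, he, rfl⟩
    exact isSplit_of_isSplit (j := 1) (j' := 0) (by decide) he

/-- Next to a square whose vertices are mapped to both layers there is a long run of squares
that change the layer. -/
theorem exists_direction {w m : ℕ} (hσ : IsSparse (w + 3) 7 σ) (hw : w + 1 < n) (h2 : 2 ≤ w)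
    (hm : 2 * m ≤ w) {z : ZMod (2 * n)} (hz : A.state 0 z = none) :
    ∃ ε : ℤ, (ε = 1 ∨ ε = -1) ∧ ∀ i : ℕ, 1 ≤ i → i ≤ m →
      rim (z + ((ε * i : ℤ) : ZMod (2 * n))) ∈ movedEdges (A.state 0) := by
  have hnm := (state_eq_none_iff hσ hw h2).1 hz
  have hne := isSplit_rim hσ hw h2 hz
  have moved : ∀ x, A.IsMono 0 x → A.color 0 x = 1 → rim x ∈ movedEdges (A.state 0) := by
    intro x hx hc
    rw [mem_movedEdges]
    have h1 : stateLift (A.state 0) (rim x) ≠ none := by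
      apply stateLift_ne_none _ inSquare_of_mem_rim
      intro h
      exact (state_eq_none_iff hσ hw h2).1 h hx
    refine ⟨h1, fun h => ?_⟩
    have := color_of_stateLift h x (mem_rim.2 (Or.inl rfl))
    rw [hc] at this
    simp at this
  -- The rim at `z` is split, so one of its ends goes to layer 1. The monochromatic squares on that
  -- side carry this color on.
  have hcase : A.color 0 (z + 1) = 1 ∨ A.color 0 z = 1 := by omega
  rcases hcase with hc | hc
  · refine ⟨1, Or.inl rfl, fun i hi him => ?_⟩
    have e : z + ((1 * i : ℤ) : ZMod (2 * n)) = z + (i : ℕ) := by push_cast; ring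
    rw [e]
    apply moved _ (isMono_add hσ hw hnm hi (by omega))
    have h := (sameNear_of_isMono (A := A) (j := 0) (x := z + 1) (d := i - 1) fun k hk => by
      have := isMono_add hσ hw hnm (d := k + 1) (by omega) (by omega)
      rwa [Nat.cast_add, Nat.cast_one, add_comm (k : ZMod (2 * n)), ← add_assoc] at this).1
    have e' : z + 1 + ((i - 1 : ℕ) : ZMod (2 * n)) = z + (i : ℕ) := by
      rw [Nat.cast_sub hi]; push_cast; ring
    rw [e'] at h
    rw [← h, hc]
  · refine ⟨-1, Or.inr rfl, fun i hi him => ?_⟩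
    have e : z + ((-1 * i : ℤ) : ZMod (2 * n)) = z - (i : ℕ) := by push_cast; ring
    rw [e]
    apply moved _ (isMono_sub hσ hw hnm hi (by omega))
    have h := (sameNear_of_isMono (A := A) (j := 0) (x := z - (i : ℕ)) (d := i) fun k hk => by
      have := isMono_sub hσ hw hnm (d := i - k) (by omega) (by omega)
      rw [Nat.cast_sub hk.le] at this
      convert this using 1
      ring).1
    rw [sub_add_cancel] at h
    rw [h, hc]

/-- Exceptional squares are more than `w ≥ 2 * m` apart, so their runs of `m` moved rims are
disjoint, whichever directions they take. The second bound leaves enough unrevealed points for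
`permProb_transported_le`. -/
theorem card_noneSet_mul_le {w m : ℕ} (hσ : IsSparse (w + 3) 7 σ) (hw : w + 1 < n) (h2 : 2 ≤ w)
    (hm : 2 * m ≤ w) : (noneSet (A.state 0)).card * m ≤ (movedEdges (A.state 0)).card ∧
      (noneSet (A.state 0)).card * m ≤ 2 * n := by
  classical
  have hd : ∀ z ∈ noneSet (A.state 0), ∃ ε : ℤ, (ε = 1 ∨ ε = -1) ∧ ∀ i : ℕ, 1 ≤ i → i ≤ m →
      rim (z + ((ε * i : ℤ) : ZMod (2 * n))) ∈ movedEdges (A.state 0) := fun z hz =>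
    exists_direction hσ hw h2 hm (mem_noneSet.1 hz)
  choose! ε hε hmoved using hd
  have hinj : Set.InjOn (fun q : ZMod (2 * n) × ℕ => q.1 + ((ε q.1 * q.2 : ℤ) : ZMod (2 * n)))
      (((noneSet (A.state 0)) ×ˢ Finset.Icc 1 m : Finset _) : Set (ZMod (2 * n) × ℕ)) := by
    rintro ⟨z, i⟩ hz ⟨z', i'⟩ hz' h
    simp only [Finset.coe_product, Set.mem_prod, Finset.mem_coe, Finset.mem_Icc] at hz hz' h
    obtain ⟨hz, hi1, him⟩ := hz
    obtain ⟨hz', hi1', him'⟩ := hz'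
    have h3 : z' = z + ((ε z * i - ε z' * i' : ℤ) : ZMod (2 * n)) := by
      push_cast at h ⊢; linear_combination -h
    set a : ℤ := ε z * i - ε z' * i' with ha
    have habs : |a| ≤ 2 * m := by
      rw [abs_le]
      rcases hε z hz with e | e <;> rcases hε z' hz' with e' | e' <;> rw [ha, e, e'] <;>
        constructor <;> omega
    have n1 := (state_eq_none_iff hσ hw h2).1 (mem_noneSet.1 hz)
    have n2 := (state_eq_none_iff hσ hw h2).1 (mem_noneSet.1 hz')
    have ha0 : a = 0 := by
      rcases lt_trichotomy a 0 with h0 | h0 | h0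
      · exfalso
        obtain ⟨d, hd⟩ : ∃ d : ℕ, a = -d := ⟨a.natAbs, by omega⟩
        rw [abs_le] at habs
        have := isMono_sub hσ hw n1 (d := d) (by omega) (by omega)
        rw [h3, hd] at n2
        apply n2
        convert this using 1
        push_cast; ring
      · exact h0
      · exfalso
        obtain ⟨d, hd⟩ : ∃ d : ℕ, a = d := ⟨a.natAbs, by omega⟩
        rw [abs_le] at habs
        have := isMono_add hσ hw n1 (d := d) (by omega) (by omega)
        rw [h3, hd] at n2
        apply n2
        convert this using 1
        push_cast; ring
    rw [ha0] at h3
    have hzz : z' = z := by simpa using h3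
    subst hzz
    rw [ha] at ha0
    rcases hε z' hz with e | e <;> rw [e] at ha0 <;>
      · have : i = i' := by omega
        rw [this]
  have hcard : ((noneSet (A.state 0)) ×ˢ Finset.Icc 1 m).card = (noneSet (A.state 0)).card * m := by
    rw [Finset.card_product, Nat.card_Icc, Nat.add_sub_cancel]
  rw [← hcard]
  constructor
  · apply Finset.card_le_card_of_injOn
      (fun q : ZMod (2 * n) × ℕ => rim (q.1 + ((ε q.1 * q.2 : ℤ) : ZMod (2 * n))))
    · rintro ⟨z, i⟩ hz
      simp only [Finset.coe_product, Set.mem_prod, Finset.mem_coe, Finset.mem_Icc] at hz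
      exact hmoved z hz.1 i hz.2.1 hz.2.2
    · exact rim_injective.comp_injOn hinj
  · have := Finset.card_le_card_of_injOn (t := Finset.univ) _ (by simp) hinj
    rwa [Finset.card_univ, ZMod.card] at this

end IncidenceAut

/-! ### The base graph is rigid with probability `1 - O(1/n)`. -/

section Rigid

variable {n : ℕ} [hn : Fact (6 ≤ n)]

/-- The number of independent constraints that are used for `t` exceptional squares. -/
def constraintCount (t : ℕ) : ℕ := if t = 0 then 3 else 7 * t

theorem exists_stateFunctions_of_not_isRigid (h29 : 29 < n) {σ : Equiv.Perm (ladder n).edgeSet}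
    (hσ : IsSparse 31 7 σ) (hr : ¬ IsRigid (bipartiteGraph (baseIncidence (ladder n) σ))) :
    ∃ t ∈ Finset.range (2 * n + 1), ∃ S ∈ stateFunctions n t ×ˢ stateFunctions n t,
      ((∀ f g, stateLift S.2 f = stateLift S.2 g → stateLift S.2 f ≠ none → f = g) ∧
        2 * constraintCount t ≤ (movedEdges S.1).card ∧ 2 * constraintCount t ≤ 2 * n) ∧
      ∀ e ∈ movedEdges S.1, IsTransported (stateLift S.1) (stateLift S.2) σ e := by
  unfold IsRigid at hr
  push Not at hr
  obtain ⟨φ, v, hv⟩ := hr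
  obtain ⟨A, hl, hr⟩ := exists_incidenceAut φ
  have hA : ¬ ((∀ x, A.onVertex x = x) ∧ ∀ e, A.onEdge e = e) := by
    rintro ⟨h1, h2⟩
    rcases v with x | e
    · exact hv (by rw [hl, h1])
    · exact hv (by rw [hr, h2])
  have hσ' : IsSparse (28 + 3) 7 σ := hσ
  have hw : 28 + 1 < n := h29
  refine ⟨(noneSet (A.state 0)).card, ?_, (A.state 0, A.state 1), ?_, ⟨?_, ?_⟩, ?_⟩
  · rw [Finset.mem_range]
    have := Finset.card_le_univ (noneSet (A.state 0))
    rw [ZMod.card] at this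
    omega
  · rw [Finset.mem_product, mem_stateFunctions, mem_stateFunctions]
    exact ⟨⟨rfl, IncidenceAut.state_succ⟩,
      ⟨IncidenceAut.card_noneSet_eq hσ' hw (by norm_num), IncidenceAut.state_succ⟩⟩
  · exact fun f g => IncidenceAut.stateLift_injective
  · unfold constraintCount
    split_ifs with h0
    · have h0' : ∀ x, A.state 0 x ≠ none := by
        intro x hx
        rw [Finset.card_eq_zero] at h0
        have := mem_noneSet.2 hx
        rw [h0] at this
        simp at this
      have hconst : ∀ k : ℕ, A.state 0 (k : ZMod (2 * n)) = A.state 0 0 := by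
        intro k
        induction k with
        | zero => rw [Nat.cast_zero]
        | succ k ih =>
          push_cast
          rcases IncidenceAut.state_succ (A := A) (j := 0) (k : ZMod (2 * n)) with h | h | h
          · exact (h0' _ h).elim
          · exact (h0' _ h).elim
          · rw [← h, ih]
      obtain ⟨⟨c, s, b⟩, h00⟩ := Option.ne_none_iff_exists'.1 (h0' 0)
      have hall : ∀ x, A.state 0 x = some (c, s, b) := by
        intro x
        have := hconst x.val
        rwa [ZMod.natCast_zmod_val, h00] at this
      -- Without exceptional squares the state is constant; it is not the identity, so at least `n ≥
      -- 6` edges move.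
      have := le_card_movedEdges hall (by
        rintro ⟨rfl, rfl, rfl⟩
        exact hA (IncidenceAut.eq_one_of_state hall))
      have := hn.out
      dsimp only
      omega
    -- Runs of length 14 (hence `w = 28`) give two edges for each of the `7 * t` constraints.
    · have := IncidenceAut.card_noneSet_mul_le (A := A) (m := 14) hσ' hw (by norm_num)
        (by norm_num)
      dsimp only
      omega
  · intro e he
    rw [mem_movedEdges] at he
    exact IncidenceAut.isTransported hσ' hw (by norm_num) he.1 he.2

/-- Pairs of state functions number about `x ^ (4t + 2)`. Against `x ^ (-7t)` this leaves `x ^ (2 -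
3t)`, at most `1/x` for `t ≥ 1`; for `t = 0`, three constraints suffice against `x ^ 2`. -/
theorem constraint_term_le {x : ℝ} (hx : 100 ≤ x) (t : ℕ) :
    ((2 * x) ^ t * ((8 * x + 1) ^ t * (8 * x + 1))) ^ 2 * (2 / x) ^ constraintCount t ≤
      10 ^ 7 * (1 / 2) ^ t * (1 / x) := by
  have hx' : 0 < x := by linarith
  have h9 : 8 * x + 1 ≤ 9 * x := by linarith
  unfold constraintCount
  split_ifs with h0
  · subst h0
    calc ((2 * x) ^ 0 * ((8 * x + 1) ^ 0 * (8 * x + 1))) ^ 2 * (2 / x) ^ 3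
        ≤ (9 * x) ^ 2 * (2 / x) ^ 3 := by
          rw [pow_zero, pow_zero, one_mul, one_mul]; gcongr
      _ = 648 * (1 / x) := by field_simp; norm_num
      _ ≤ 10 ^ 7 * (1 / 2) ^ 0 * (1 / x) := by gcongr; norm_num
  · obtain ⟨t, rfl⟩ : ∃ t', t = t' + 1 := ⟨t - 1, by omega⟩
    -- The constant is `2 ^ 2 * 9 ^ 2 * 2 ^ 7`. One such factor absorbs `(9 * x) ^ 2`, the others
    -- give a geometric series.
    have hc : 41472 / x ^ 3 ≤ 1 / 2 := by
      rw [div_le_div_iff₀ (by positivity) (by norm_num)]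
      have : (100 : ℝ) ^ 3 ≤ x ^ 3 := by gcongr
      linarith
    have hpow : ∀ a b c : ℝ, (a ^ (t + 1) * (b ^ (t + 1) * b)) ^ 2 * c ^ (t + 1) =
        b ^ 2 * (a ^ 2 * b ^ 2 * c) ^ (t + 1) := by
      intro a b c; ring
    calc ((2 * x) ^ (t + 1) * ((8 * x + 1) ^ (t + 1) * (8 * x + 1))) ^ 2 *
          (2 / x) ^ (7 * (t + 1))
        ≤ ((2 * x) ^ (t + 1) * ((9 * x) ^ (t + 1) * (9 * x))) ^ 2 *
          (2 / x) ^ (7 * (t + 1)) := by gcongr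
      _ = (9 * x) ^ 2 * ((2 * x) ^ 2 * (9 * x) ^ 2 * (2 / x) ^ 7) ^ (t + 1) := by
          rw [pow_mul, hpow]
      _ = (9 * x) ^ 2 * (41472 / x ^ 3) ^ (t + 1) := by
          congr 2; field_simp; norm_num
      _ = (9 * x) ^ 2 * (41472 / x ^ 3) * (41472 / x ^ 3) ^ t := by ring
      _ ≤ (9 * x) ^ 2 * (41472 / x ^ 3) * (1 / 2) ^ t := by gcongr
      _ = 6718464 * (1 / 2) ^ (t + 1) * (1 / x) := by
          rw [pow_succ (1 / 2 : ℝ)]; generalize (1 / 2 : ℝ) ^ t = y; field_simp; ring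
      _ ≤ 10 ^ 7 * (1 / 2) ^ (t + 1) * (1 / x) := by gcongr; norm_num

theorem permProb_not_isRigid_bipartiteGraph_le (h100 : 100 ≤ n) :
    permProb (fun σ : Equiv.Perm (ladder n).edgeSet =>
      ¬ IsRigid (bipartiteGraph (baseIncidence (ladder n) σ))) ≤
      ((7 + 1) ^ 3 * (2 ^ (2 * 7 * (6 * (2 * 31 + 1))) * Nat.factorial 7) + 2 * 10 ^ 7) *
        (1 / n) := by
  classical
  have hn' : (0 : ℝ) < n := by exact_mod_cast (by omega : 0 < n)
  have hsp := permProb_not_isSparse_le (n := n) 31 7 (by omega)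
  refine (permProb_mono (Q := fun σ => ¬ IsSparse 31 7 σ ∨ ∃ t ∈ Finset.range (2 * n + 1),
    ∃ S ∈ stateFunctions n t ×ˢ stateFunctions n t,
      ((∀ f g, stateLift S.2 f = stateLift S.2 g → stateLift S.2 f ≠ none → f = g) ∧
        2 * constraintCount t ≤ (movedEdges S.1).card ∧ 2 * constraintCount t ≤ 2 * n) ∧
      ∀ e ∈ movedEdges S.1, IsTransported (stateLift S.1) (stateLift S.2) σ e) ?_).trans
    ((permProb_or_le _ _).trans ?_)
  · intro σ hr
    by_cases hσ : IsSparse 31 7 σ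
    · exact Or.inr (exists_stateFunctions_of_not_isRigid (by omega) hσ hr)
    · exact Or.inl hσ
  · rw [add_mul]
    refine add_le_add (by exact_mod_cast hsp) ?_
    refine (permProb_exists_le _ _).trans ((Finset.sum_le_sum (g := fun t : ℕ =>
      (10 ^ 7 * (1 / 2) ^ t * (1 / n) : ℝ)) fun t _ => ?_).trans ?_)
    · refine (permProb_le_card_mul _ _ (c := (2 / n : ℝ) ^ constraintCount t) ?_).trans
        (le_trans ?_ (constraint_term_le (x := n) (by exact_mod_cast h100) t))
      · rintro S -
        by_cases hS : (∀ f g, stateLift S.2 f = stateLift S.2 g → stateLift S.2 f ≠ none → f = g) ∧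
          2 * constraintCount t ≤ (movedEdges S.1).card ∧ 2 * constraintCount t ≤ 2 * n
        · refine (permProb_mono fun σ h => h.2).trans
            -- Here `D = n`: at most `2 * n` of the `3 * n` edges are revealed.
            (permProb_transported_le _ _ hS.1 _ hS.2.1 ?_ (by omega))
          rw [card_edgeSet_ladder]; omega
        · rw [permProb_eq_zero fun σ h => hS h.1]; positivity
      · rw [Finset.card_product, ← sq]
        push_cast
        gcongr
        exact_mod_cast card_stateFunctions_le t
    · rw [← Finset.sum_mul, ← Finset.mul_sum]
      have := sum_geometric_two_le (2 * n + 1)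
      exact mul_le_mul_of_nonneg_right (by linarith) (by positivity)

end Rigid

/-! ### Transfer matrix bounds for closed binary sequences. -/

section ClosedSequences

/-- The weight of a sequence in a transfer matrix computation. -/
def pathWeight (T : Bool → Bool → ℝ) {m : ℕ} (y : Fin (m + 1) → Bool) : ℝ :=
  ∏ i : Fin m, T (y i.castSucc) (y i.succ)

theorem pathWeight_nonneg {T : Bool → Bool → ℝ} (hT : ∀ a b, 0 ≤ T a b) {m : ℕ}
    (y : Fin (m + 1) → Bool) : 0 ≤ pathWeight T y := Finset.prod_nonneg fun _ _ => hT _ _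

/-- `u` is a sub-eigenvector of the transfer matrix, so each step multiplies by at most `c`. -/
theorem sum_pathWeight_le {T : Bool → Bool → ℝ} (hT : ∀ a b, 0 ≤ T a b) {u : Bool → ℝ} {c : ℝ}
    (hc : 0 ≤ c) (h : ∀ a, ∑ b, T a b * u b ≤ c * u a) (m : ℕ) (a : Bool) :
    ∑ y : Fin m → Bool, pathWeight T (Fin.cons a y : Fin (m + 1) → Bool) *
      u ((Fin.cons a y : Fin (m + 1) → Bool) (Fin.last m)) ≤ c ^ m * u a := by
  induction m generalizing a with
  | zero => simp [pathWeight]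
  | succ m ih =>
    rw [← (Fin.consEquiv fun _ : Fin (m + 1) => Bool).sum_comp, Fintype.sum_prod_type]
    have key : ∀ (b : Bool) (y : Fin m → Bool),
        pathWeight T (Fin.cons a (Fin.cons b y : Fin (m + 1) → Bool) : Fin (m + 1 + 1) → Bool) *
          u ((Fin.cons a (Fin.cons b y : Fin (m + 1) → Bool) : Fin (m + 1 + 1) → Bool)
            (Fin.last (m + 1))) =
        T a b * (pathWeight T (Fin.cons b y : Fin (m + 1) → Bool) *
          u ((Fin.cons b y : Fin (m + 1) → Bool) (Fin.last m))) := by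
      intro b y
      have h1 : (Fin.cons a (Fin.cons b y : Fin (m + 1) → Bool) : Fin (m + 1 + 1) → Bool)
          (Fin.last (m + 1)) = (Fin.cons b y : Fin (m + 1) → Bool) (Fin.last m) := by
        rw [← Fin.succ_last, Fin.cons_succ]
      rw [h1, ← mul_assoc]
      congr 1
      rw [pathWeight, Fin.prod_univ_succ, pathWeight]
      congr 1
    calc _ = ∑ b, T a b * ∑ y : Fin m → Bool, (pathWeight T (Fin.cons b y : Fin (m + 1) → Bool) *
          u ((Fin.cons b y : Fin (m + 1) → Bool) (Fin.last m))) := by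
          refine Finset.sum_congr rfl fun b _ => ?_
          rw [Finset.mul_sum]
          exact Finset.sum_congr rfl fun y _ => key b y
      _ ≤ ∑ b, T a b * (c ^ m * u b) := by
          gcongr with b _
          · exact hT a b
          · exact ih b
      _ = c ^ m * ∑ b, T a b * u b := by
          rw [Finset.mul_sum]; exact Finset.sum_congr rfl fun b _ => by ring
      _ ≤ c ^ m * (c * u a) := by gcongr; exact h a
      _ = c ^ (m + 1) * u a := by ring

/-- For a closed sequence the factor `u` at the end equals the one at the start and cancels; the 2
counts the starting values. -/
theorem sum_closed_pathWeight_le {T : Bool → Bool → ℝ} (hT : ∀ a b, 0 ≤ T a b) {u : Bool → ℝ}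
    {c : ℝ} (hc : 0 ≤ c) (hu : ∀ a, 0 < u a) (h : ∀ a, ∑ b, T a b * u b ≤ c * u a) (m : ℕ) :
    ∑ y : Fin (m + 1) → Bool with y 0 = y (Fin.last m), pathWeight T y ≤ 2 * c ^ m := by
  rw [Finset.sum_filter, ← (Fin.consEquiv fun _ : Fin (m + 1) => Bool).sum_comp,
    Fintype.sum_prod_type]
  have key : ∀ a : Bool, (∑ y : Fin m → Bool,
      if (Fin.cons a y : Fin (m + 1) → Bool) 0 = (Fin.cons a y : Fin (m + 1) → Bool) (Fin.last m)
      then pathWeight T (Fin.cons a y : Fin (m + 1) → Bool) else 0) ≤ c ^ m := by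
    intro a
    rw [← mul_le_mul_iff_left₀ (hu a), Finset.sum_mul]
    refine le_trans (Finset.sum_le_sum fun y _ => ?_) (sum_pathWeight_le hT hc h m a)
    split_ifs with h0
    · rw [← h0, Fin.cons_zero]
    · rw [zero_mul]; exact mul_nonneg (pathWeight_nonneg hT _) (hu _).le
  rw [Fintype.sum_bool, two_mul]
  exact add_le_add (key true) (key false)

/-- The number of edges of an even subgraph of the ladder that are charged to a position. -/
def stepCost (a b : Bool) : ℕ := 2 * a.toNat + if a = b then 0 else 1

theorem sum_closed_stepCost_le {q : ℝ} (hq : 0 < q) (hq2 : 2 * q ^ 2 ≤ 1) (m : ℕ) :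
    ∑ y : Fin (m + 1) → Bool with y 0 = y (Fin.last m),
      pathWeight (fun a b => q ^ stepCost a b) y ≤ 2 * (1 + 2 * q ^ 4) ^ m := by
  have h3 : 0 < q ^ 3 := by positivity
  have h7 : 0 < q ^ 7 := by positivity
  -- The matrix has rows `(1, q)` and `(q ^ 3, q ^ 2)`. With the vector `(1, 2 * q ^ 3)` the first
  -- row gives exactly `1 + 2 * q ^ 4`, and the second uses `2 * q ^ 2 ≤ 1`.
  refine sum_closed_pathWeight_le (u := fun a => if a then 2 * q ^ 3 else 1)
    (fun a b => by positivity) (by positivity) ?_ ?_ m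
  · intro a; cases a
    · simp
    · simpa using h3
  · intro a
    cases a
    · simp [stepCost]; nlinarith [hq2]
    · simp [stepCost]; nlinarith [hq2]

end ClosedSequences

/-! ### Even edge sets of the ladder. -/

section EvenSets

variable {n : ℕ} [hn : Fact (6 ≤ n)]

/-- Every vertex of the ladder is incident with an even number of edges of `X`. -/
def IsEvenSet (X : Finset (ladder n).edgeSet) : Prop :=
  ∀ v, rung v ∈ X ↔ ¬ (rim (v - 1) ∈ X ↔ rim v ∈ X)

theorem isEvenSet_of_ncard {X : Finset (ladder n).edgeSet}
    (h : ∀ v, ¬ Odd ((X : Set (ladder n).edgeSet) ∩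
      {e | v ∈ (e : Sym2 (ZMod (2 * n)))}).ncard) : IsEvenSet X := by
  classical
  intro v
  have hv := h v
  have hset : (X : Set (ladder n).edgeSet) ∩ {e | v ∈ (e : Sym2 (ZMod (2 * n)))} =
      ((({rim v, rim (v - 1), rung v} : Finset (ladder n).edgeSet).filter (· ∈ X) : Finset _) :
        Set (ladder n).edgeSet) := by
    rw [edges_at]
    ext e
    simp [and_comm]
  rw [hset, Set.ncard_coe_finset, Finset.card_filter, Finset.sum_insert, Finset.sum_pair] at hv
  · by_cases h1 : rim v ∈ X <;> by_cases h2 : rim (v - 1) ∈ X <;> by_cases h3 : rung v ∈ X <;>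
      simp [h1, h2, h3] at hv ⊢ <;> exact absurd hv (by decide)
  · exact rim_ne_rung _ _
  · simp [rim_ne_rim_sub_one, rim_ne_rung]

theorem exists_even_of_not_isOdd {σ : Equiv.Perm (ladder n).edgeSet}
    [DecidableEq (ladder n).edgeSet]
    (h : ¬ IsOddBipartite (baseIncidence (ladder n) σ)) :
    ∃ X : Finset (ladder n).edgeSet, X.Nonempty ∧ IsEvenSet X ∧ IsEvenSet (X.image σ) := by
  classical
  unfold IsOddBipartite at h
  push Not at h
  obtain ⟨X, hX, hodd⟩ := h
  refine ⟨X.toFinset, by simpa using hX, isEvenSet_of_ncard fun v => ?_,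
    isEvenSet_of_ncard fun v => ?_⟩
  · have := hodd (v, 0)
    rw [Set.coe_toFinset]
    convert this using 4
    simp [baseIncidence]
  · have := hodd (v, 1)
    rw [← Set.ncard_image_of_injective (X ∩ {w | baseIncidence (ladder n) σ (v, 1) w})
      σ.injective] at this
    convert this using 3
    ext f
    simp only [Finset.coe_image, Set.coe_toFinset, Set.mem_inter_iff, Set.mem_image]
    constructor
    · rintro ⟨⟨e, he, rfl⟩, hf⟩
      exact ⟨e, ⟨he, Or.inr ⟨rfl, hf⟩⟩, rfl⟩
    · rintro ⟨e, ⟨he, h1⟩, rfl⟩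
      have h1 : v ∈ (σ e : Sym2 (ZMod (2 * n))) := by simpa [baseIncidence] using h1
      exact ⟨⟨e, he, rfl⟩, h1⟩

/-- The rungs at `v` and `v + n` are the same edge, so membership of rims changes at `v` exactly if
it changes at `v + n`. -/
theorem IsEvenSet.antipode {X : Finset (ladder n).edgeSet} (hX : IsEvenSet X)
    (v : ZMod (2 * n)) : (rim v ∈ X ↔ rim (v + (n : ZMod (2 * n))) ∈ X) ↔
      (rim 0 ∈ X ↔ rim (n : ZMod (2 * n)) ∈ X) := by
  have aux : ∀ {a b a' b' c : Prop}, (c ↔ ¬ (a ↔ b)) → (c ↔ ¬ (a' ↔ b')) →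
      ((b ↔ b') ↔ (a ↔ a')) := by
    intros; tauto
  have key : ∀ k : ℕ, (rim (k : ZMod (2 * n)) ∈ X ↔ rim ((k : ZMod (2 * n)) + (n : ZMod (2 * n))) ∈ X) ↔
      (rim 0 ∈ X ↔ rim (n : ZMod (2 * n)) ∈ X) := by
    intro k
    induction k with
    | zero => simp
    | succ k ih =>
      have h1 := hX ((k : ZMod (2 * n)) + 1)
      have h2 := hX ((k : ZMod (2 * n)) + 1 + (n : ZMod (2 * n)))
      rw [rung_add] at h2
      have e1 : ((k : ZMod (2 * n)) + 1 - 1) = k := by ring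
      have e2 : ((k : ZMod (2 * n)) + 1 + (n : ZMod (2 * n)) - 1) =
        (k : ZMod (2 * n)) + (n : ZMod (2 * n)) := by ring
      rw [e1] at h1
      rw [e2] at h2
      rw [Nat.cast_succ]
      exact (aux h1 h2).trans ih
  have := key v.val
  rwa [ZMod.natCast_zmod_val] at this

/-- The first `n + 1` rim edges of `X`. -/
def rimCode [DecidableEq (ladder n).edgeSet] (X : Finset (ladder n).edgeSet) :
    Fin (n + 1) → Bool := fun i => decide (rim ((i : ℕ) : ZMod (2 * n)) ∈ X)

variable [DecidableEq (ladder n).edgeSet]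

/-- The entries at 0 and `n` tell whether antipodal rims agree, which gives the remaining rims;
parity then gives the rungs. -/
theorem rimCode_injOn {X Y : Finset (ladder n).edgeSet} (hX : IsEvenSet X) (hY : IsEvenSet Y)
    (h : rimCode X = rimCode Y) : X = Y := by
  have aux : ∀ {a b c d a' b' c' d' : Prop}, ((a ↔ b) ↔ (c ↔ d)) → ((a' ↔ b') ↔ (c' ↔ d')) →
      (a ↔ a') → (c ↔ c') → (d ↔ d') → (b ↔ b') := by
    intro a b c d a' b' c' d' h1 h2 ha hc hd
    rw [← ha, ← hc, ← hd] at h2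
    have h3 := h1.trans h2.symm
    clear h1 h2 ha hc hd
    tauto
  have h1 : ∀ k : ℕ, k ≤ n → (rim (k : ZMod (2 * n)) ∈ X ↔ rim (k : ZMod (2 * n)) ∈ Y) := by
    intro k hk
    have := congrFun h ⟨k, by omega⟩
    simpa [rimCode] using this
  have h2 : ∀ v : ZMod (2 * n), rim v ∈ X ↔ rim v ∈ Y := by
    intro v
    have hv : v.val < 2 * n := ZMod.val_lt v
    have hval : ((v.val : ℕ) : ZMod (2 * n)) = v := ZMod.natCast_zmod_val v
    by_cases hle : v.val ≤ n
    · have := h1 v.val hle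
      rwa [hval] at this
    · have h3 := h1 (v.val - n) (by omega)
      have e : v = ((v.val - n : ℕ) : ZMod (2 * n)) + n := by
        rw [Nat.cast_sub (by omega), hval]; ring
      have hX' := hX.antipode ((v.val - n : ℕ) : ZMod (2 * n))
      have hY' := hY.antipode ((v.val - n : ℕ) : ZMod (2 * n))
      have h0 := h1 0 (by omega)
      have hnn := h1 n le_rfl
      rw [Nat.cast_zero] at h0
      rw [← e] at hX' hY'
      exact aux hX' hY' h3 h0 hnn
  ext e
  rcases edge_cases e with ⟨v, rfl⟩ | ⟨v, rfl⟩
  · exact h2 v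
  · rw [hX v, hY v, h2, h2]

/-- A chosen rim pays 2, for itself and its antipode; a change between consecutive rims pays 1, for
the rung between them. -/
theorem sum_stepCost_le_card {X : Finset (ladder n).edgeSet} (hX : IsEvenSet X)
    (h0 : rim 0 ∈ X ↔ rim (n : ZMod (2 * n)) ∈ X) :
    ∑ i : Fin n, stepCost (rimCode X i.castSucc) (rimCode X i.succ) ≤ X.card := by
  have hcast : ∀ (i j : Fin n) (b : ℤ), (((i : ℕ) : ZMod (2 * n)) = ((j : ℕ) : ZMod (2 * n)) + b * n) →
      i = j ∧ Even b := by
    intro i j b h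
    have := intCast_add_mul_eq_zero (n := n) (a := (i : ℤ) - j) (b := -b)
      (by rw [abs_lt]; omega) (by push_cast; linear_combination h)
    exact ⟨by ext; omega, by simpa using this.2⟩
  set S : Finset (Fin n) := Finset.univ.filter fun i => rimCode X i.castSucc = true with hS
  set C : Finset (Fin n) := Finset.univ.filter fun i => rimCode X i.castSucc ≠ rimCode X i.succ
    with hC
  have hsum : ∑ i : Fin n, stepCost (rimCode X i.castSucc) (rimCode X i.succ) =
      S.card + S.card + C.card := by
    rw [hS, hC, Finset.card_filter, Finset.card_filter, ← Finset.sum_add_distrib,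
      ← Finset.sum_add_distrib]
    refine Finset.sum_congr rfl fun i _ => ?_
    unfold stepCost
    cases rimCode X i.castSucc <;> cases rimCode X i.succ <;> simp
  set f₁ : Fin n → (ladder n).edgeSet := fun i => rim ((i : ℕ) : ZMod (2 * n)) with hf₁
  set f₂ : Fin n → (ladder n).edgeSet := fun i => rim (((i : ℕ) : ZMod (2 * n)) + n) with hf₂
  set f₃ : Fin n → (ladder n).edgeSet := fun i => rung (((i : ℕ) : ZMod (2 * n)) + 1) with hf₃
  have i₁ : Function.Injective f₁ := fun i j h =>
    (hcast i j 0 (by have := rim_injective h; rw [this]; simp)).1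
  have i₂ : Function.Injective f₂ := fun i j h =>
    (hcast i j 0 (by have := rim_injective h; simpa using this)).1
  have i₃ : Function.Injective f₃ := fun i j h => by
    rcases rung_eq_iff.1 h with h | h
    · exact (hcast i j 0 (by simpa using h)).1
    · exact (hcast i j 1 (by push_cast; linear_combination h)).1
  have d12 : Disjoint (S.image f₁) (S.image f₂) := by
    rw [Finset.disjoint_left]
    intro e h1 h2
    obtain ⟨i, -, rfl⟩ := Finset.mem_image.1 h1
    obtain ⟨j, -, h⟩ := Finset.mem_image.1 h2
    have := (hcast i j 1 (by have := rim_injective h; push_cast; linear_combination -this)).2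
    exact absurd this (by decide)
  have d3 : Disjoint (S.image f₁ ∪ S.image f₂) (C.image f₃) := by
    rw [Finset.disjoint_left]
    intro e h1 h2
    obtain ⟨j, -, rfl⟩ := Finset.mem_image.1 h2
    rcases Finset.mem_union.1 h1 with h1 | h1 <;> obtain ⟨i, -, h⟩ := Finset.mem_image.1 h1
    · exact rim_ne_rung _ _ h
    · exact rim_ne_rung _ _ h
  rw [hsum]
  calc S.card + S.card + C.card = (S.image f₁ ∪ S.image f₂ ∪ C.image f₃).card := by
        rw [Finset.card_union_of_disjoint d3, Finset.card_union_of_disjoint d12,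
          Finset.card_image_of_injective _ i₁, Finset.card_image_of_injective _ i₂,
          Finset.card_image_of_injective _ i₃]
    _ ≤ X.card := by
        apply Finset.card_le_card
        intro e he
        rcases Finset.mem_union.1 he with he | he
        · rcases Finset.mem_union.1 he with he | he
          · obtain ⟨i, hi, rfl⟩ := Finset.mem_image.1 he
            simpa [hS, rimCode] using hi
          · obtain ⟨i, hi, rfl⟩ := Finset.mem_image.1 he
            have hi' : rim ((i : ℕ) : ZMod (2 * n)) ∈ X := by simpa [hS, rimCode] using hi
            exact ((hX.antipode ((i : ℕ) : ZMod (2 * n))).2 h0).1 hi'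
        · obtain ⟨i, hi, rfl⟩ := Finset.mem_image.1 he
          have hi' : ¬ (rim ((i : ℕ) : ZMod (2 * n)) ∈ X ↔ rim (((i : ℕ) : ZMod (2 * n)) + 1) ∈ X) := by
            simpa [hC, rimCode] using hi
          rw [hX, add_sub_cancel_right]
          exact hi'

/-- Exactly one rim of each antipodal pair is chosen. -/
theorem le_card_of_antipode {X : Finset (ladder n).edgeSet} (hX : IsEvenSet X)
    (h0 : ¬ (rim 0 ∈ X ↔ rim (n : ZMod (2 * n)) ∈ X)) : n ≤ X.card := by
  have h1 : ∀ v : ZMod (2 * n), ¬ (rim v ∈ X ↔ rim (v + (n : ZMod (2 * n))) ∈ X) := fun v h =>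
    h0 ((hX.antipode v).1 h)
  set T : Finset (ZMod (2 * n)) := Finset.univ.filter fun v => rim v ∈ X with hT
  have h2 : T.card ≤ X.card :=
    Finset.card_le_card_of_injOn rim (fun v hv => (Finset.mem_filter.1 hv).2) rim_injective.injOn
  have h3 : Tᶜ.card ≤ T.card := by
    apply Finset.card_le_card_of_injOn (· + (n : ZMod (2 * n)))
    · intro v hv
      simp only [hT, Finset.coe_compl, Set.mem_compl_iff, Finset.mem_coe, Finset.mem_filter,
        Finset.mem_univ, true_and] at hv ⊢
      have := h1 v
      tauto
    · exact (add_left_injective _).injOn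
  have h4 := Finset.card_compl_add_card T
  rw [ZMod.card] at h4
  omega

theorem two_le_card_of_isEvenSet {X : Finset (ladder n).edgeSet} (hX : IsEvenSet X)
    (hne : X.Nonempty) : 2 ≤ X.card := by
  have hn' := hn.out
  by_cases h0 : rim 0 ∈ X ↔ rim (n : ZMod (2 * n)) ∈ X
  · have hv : ∃ v, rim v ∈ X := by
      obtain ⟨e, he⟩ := hne
      rcases edge_cases e with ⟨v, rfl⟩ | ⟨v, rfl⟩
      · exact ⟨v, he⟩
      · rw [hX] at he
        by_cases h : rim v ∈ X
        · exact ⟨v, h⟩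
        · exact ⟨v - 1, by tauto⟩
    obtain ⟨v, hv⟩ := hv
    have hv' := ((hX.antipode v).2 h0).1 hv
    have hne : rim v ≠ rim (v + (n : ZMod (2 * n))) :=
      fun h => zmod_half_ne (n := n) (by linear_combination -(rim_injective h))
    refine (Finset.card_pair hne).symm.le.trans (Finset.card_le_card fun e he => ?_)
    rcases Finset.mem_insert.1 he with rfl | he
    · exact hv
    · rw [Finset.mem_singleton.1 he]; exact hv'
  · have := le_card_of_antipode hX h0
    omega

/-- Double counting: each vertex has degree 0 or 2 in `X`. -/
theorem card_le_of_isEvenSet {X : Finset (ladder n).edgeSet} (hX : IsEvenSet X) :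
    X.card ≤ 2 * n := by
  classical
  have h1 : ∑ e ∈ X, (Finset.univ.filter fun v => v ∈ (e : Sym2 (ZMod (2 * n)))).card =
      X.card * 2 := by
    rw [Finset.sum_const_nat]
    intro e _
    obtain ⟨u, v, huv, -, he⟩ := exists_edge_eq e
    refine Eq.trans ?_ (Finset.card_pair huv)
    congr 1
    ext w
    simp [he]
  have h2 : ∀ v : ZMod (2 * n), (X.filter fun e : (ladder n).edgeSet => v ∈ (e : Sym2 (ZMod (2 * n)))).card ≤ 2 := by
    intro v
    have hsub : (X.filter fun e : (ladder n).edgeSet => v ∈ (e : Sym2 (ZMod (2 * n)))) ⊆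
        ({rim v, rim (v - 1), rung v} : Finset (ladder n).edgeSet).filter (· ∈ X) := by
      intro e he
      obtain ⟨he, hv⟩ := Finset.mem_filter.1 he
      have := mem_edge_iff.1 hv
      exact Finset.mem_filter.2 ⟨by simpa using this, he⟩
    refine (Finset.card_le_card hsub).trans ?_
    rw [Finset.card_filter, Finset.sum_insert (by simp [rim_ne_rim_sub_one, rim_ne_rung]),
      Finset.sum_pair (rim_ne_rung _ _)]
    have := hX v
    by_cases h1 : rim v ∈ X <;> by_cases h2 : rim (v - 1) ∈ X <;> by_cases h3 : rung v ∈ X <;>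
      simp [h1, h2, h3] at this ⊢
  have h3 : ∑ e ∈ X, (Finset.univ.filter fun v => v ∈ (e : Sym2 (ZMod (2 * n)))).card =
      ∑ v : ZMod (2 * n), (X.filter fun e : (ladder n).edgeSet => v ∈ (e : Sym2 (ZMod (2 * n)))).card := by
    simp only [Finset.card_filter]
    exact Finset.sum_comm
  have h4 : ∑ v : ZMod (2 * n), (X.filter fun e : (ladder n).edgeSet => v ∈ (e : Sym2 (ZMod (2 * n)))).card ≤
      2 * n * 2 := by
    refine (Finset.sum_le_card_nsmul _ _ 2 fun v _ => h2 v).trans ?_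
    rw [Finset.card_univ, ZMod.card, smul_eq_mul]
  omega

variable (n) in
open Classical in
/-- All even edge sets. -/
noncomputable def evenSets : Finset (Finset (ladder n).edgeSet) := Finset.univ.filter IsEvenSet

theorem mem_evenSets {X : Finset (ladder n).edgeSet} : X ∈ evenSets n ↔ IsEvenSet X := by
  simp [evenSets]

theorem card_evenSets_le : (evenSets n).card ≤ 2 ^ (n + 1) := by
  have : Fintype.card (Fin (n + 1) → Bool) = 2 ^ (n + 1) := by simp
  rw [← this, ← Finset.card_univ]
  refine Finset.card_le_card_of_injOn rimCode (by simp) ?_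
  intro X hX Y hY h
  exact rimCode_injOn (mem_evenSets.1 hX) (mem_evenSets.1 hY) h

/-- The generating function of even sets at `q` dominates the term of size `k`. For `k < n`
antipodal rims agree, so the codes are closed sequences. -/
theorem card_evenSets_card_mul_pow_le {k : ℕ} (hk : k < n) {q : ℝ} (hq : 0 < q)
    (hq2 : 2 * q ^ 2 ≤ 1) :
    (((evenSets n).filter fun X => X.card = k).card : ℝ) * q ^ k ≤ 2 * (1 + 2 * q ^ 4) ^ n := by
  have hq1 : q ≤ 1 := by nlinarith
  refine le_trans ?_ (sum_closed_stepCost_le hq hq2 n)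
  have hmem : ∀ X ∈ (evenSets n).filter fun X => X.card = k,
      IsEvenSet X ∧ X.card = k ∧ (rim 0 ∈ X ↔ rim (n : ZMod (2 * n)) ∈ X) := by
    intro X hX
    obtain ⟨h1, h2⟩ := Finset.mem_filter.1 hX
    have h1 := mem_evenSets.1 h1
    refine ⟨h1, h2, ?_⟩
    by_contra h
    have := le_card_of_antipode h1 h
    omega
  calc (((evenSets n).filter fun X => X.card = k).card : ℝ) * q ^ k
      = ∑ X ∈ (evenSets n).filter fun X => X.card = k, q ^ k := by
        rw [Finset.sum_const, nsmul_eq_mul]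
    _ ≤ ∑ X ∈ (evenSets n).filter fun X => X.card = k,
          pathWeight (fun a b => q ^ stepCost a b) (rimCode X) := by
        apply Finset.sum_le_sum
        intro X hX
        obtain ⟨h1, h2, h3⟩ := hmem X hX
        rw [pathWeight, Finset.prod_pow_eq_pow_sum, ← h2]
        exact pow_le_pow_of_le_one hq.le hq1 (sum_stepCost_le_card h1 h3)
    _ = ∑ y ∈ ((evenSets n).filter fun X => X.card = k).image rimCode,
          pathWeight (fun a b => q ^ stepCost a b) y := by
        rw [Finset.sum_image]
        intro X hX Y hY h
        exact rimCode_injOn (hmem X hX).1 (hmem Y hY).1 h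
    _ ≤ _ := by
        apply Finset.sum_le_sum_of_subset_of_nonneg
        · intro y hy
          obtain ⟨X, hX, rfl⟩ := Finset.mem_image.1 hy
          obtain ⟨h1, h2, h3⟩ := hmem X hX
          simp only [Finset.mem_filter, Finset.mem_univ, true_and, rimCode, Fin.val_zero,
            Nat.cast_zero, Fin.val_last, decide_eq_decide]
          exact h3
        · intro y _ _
          exact pathWeight_nonneg (fun a b => by positivity) y

end EvenSets

/-! ### Numerical estimates for binomial coefficients. -/

theorem factorial_le_mul_div_exp_pow {k : ℕ} (hk : 1 ≤ k) :
    (k.factorial : ℝ) ≤ Real.exp 1 * k * (k / Real.exp 1) ^ k := by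
  induction k, hk using Nat.le_induction with
  | base => simp
  | succ k hk ih =>
    have he := Real.exp_pos 1
    have hk0 : (0 : ℝ) < k := by exact_mod_cast hk
    have h1 : ((k : ℝ) / (k + 1)) ^ (k + 1) ≤ (Real.exp 1)⁻¹ := by
      have h2 : (k : ℝ) / (k + 1) ≤ Real.exp (-(1 / (k + 1))) := by
        have := Real.add_one_le_exp (-(1 / ((k : ℝ) + 1)))
        have e : (k : ℝ) / (k + 1) = -(1 / (k + 1)) + 1 := by field_simp; ring
        rwa [e]
      calc ((k : ℝ) / (k + 1)) ^ (k + 1) ≤ (Real.exp (-(1 / (k + 1)))) ^ (k + 1) := by gcongr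
        _ = (Real.exp 1)⁻¹ := by
          rw [← Real.exp_nat_mul, ← Real.exp_neg]
          congr 1
          push_cast
          field_simp
    rw [Nat.factorial_succ]
    push_cast
    calc ((k : ℝ) + 1) * k.factorial ≤ (k + 1) * (Real.exp 1 * k * (k / Real.exp 1) ^ k) := by
          gcongr
      _ = Real.exp 1 * (k + 1) * (((k : ℝ) + 1) ^ (k + 1) / Real.exp 1 ^ k) *
          ((k : ℝ) / (k + 1)) ^ (k + 1) := by
          rw [div_pow, div_pow]
          field_simp
          ring
      _ ≤ Real.exp 1 * (k + 1) * (((k : ℝ) + 1) ^ (k + 1) / Real.exp 1 ^ k) *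
          (Real.exp 1)⁻¹ := by gcongr
      _ = _ := by rw [div_pow]; field_simp; ring

theorem one_div_choose_three_mul_le {n k : ℕ} (hn : 1 ≤ n) (hk : k ≤ n) :
    1 / ((3 * n).choose k : ℝ) ≤ k.factorial / (2 * n) ^ k := by
  have h1 : (2 * n) ^ k ≤ (3 * n).descFactorial k :=
    (Nat.pow_le_pow_left (by omega) k).trans (Nat.pow_sub_le_descFactorial (3 * n) k)
  rw [Nat.descFactorial_eq_factorial_mul_choose] at h1
  have h1' : ((2 * n : ℝ)) ^ k ≤ k.factorial * (3 * n).choose k := by exact_mod_cast h1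
  have h2 : (0 : ℝ) < (3 * n).choose k := by exact_mod_cast Nat.choose_pos (by omega)
  have h3 : (0 : ℝ) < n := by exact_mod_cast hn
  rw [div_le_div_iff₀ h2 (by positivity)]
  linarith

/-- Optimizing `q` makes the `k`-th term at most a multiple of `k * B ^ k`, with `B ^ 2` of order `k
/ n` and `B` bounded away from 1. -/
theorem sq_div_choose_le {n k : ℕ} (hk2 : 2 ≤ k) (hk : k < n) {z : ℝ} (hz : 0 ≤ z)
    (h : ∀ q : ℝ, 0 < q → 2 * q ^ 2 ≤ 1 → z * q ^ k ≤ 2 * (1 + 2 * q ^ 4) ^ n) :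
    z ^ 2 * (1 / ((3 * n).choose k : ℝ)) ≤ 12 * ((k : ℝ) ^ 2 * (7 / 8) ^ k) * (1 / n) := by
  have hk0 : (0 : ℝ) < k := by exact_mod_cast (by omega : 0 < k)
  have hn0 : (0 : ℝ) < n := by exact_mod_cast (by omega : 0 < n)
  have hkn : (k : ℝ) ≤ n := by exact_mod_cast hk.le
  have he := Real.exp_pos 1
  -- The choice is `q = √s`, so that `q ^ 4 = k / (8 * n)` and the bound in `h` becomes `2 * exp (k
  -- / 4)`.
  set s : ℝ := Real.sqrt (k / (8 * n)) with hs
  have hs0 : 0 < s := Real.sqrt_pos.2 (by positivity)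
  have hs2 : s ^ 2 = k / (8 * n) := Real.sq_sqrt (by positivity)
  set r : ℝ := Real.exp (1 / 2) with hr
  have hr0 : 0 < r := Real.exp_pos _
  have hr2 : r ^ 2 = Real.exp 1 := by rw [hr, ← Real.exp_nat_mul]; norm_num
  have hz1 : z ^ 2 * s ^ k ≤ 4 * r ^ k := by
    have hq2 : Real.sqrt s ^ 2 = s := Real.sq_sqrt hs0.le
    have hq4 : Real.sqrt s ^ 4 = k / (8 * n) := by
      rw [← hs2, ← hq2, ← pow_mul, hq2]
    have hs1 : 2 * s ≤ 1 := by
      have : s ^ 2 ≤ 1 / 4 := by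
        rw [hs2, div_le_div_iff₀ (by positivity) (by norm_num)]; linarith
      nlinarith
    have h1 := h (Real.sqrt s) (Real.sqrt_pos.2 hs0) (by rw [hq2]; exact hs1)
    rw [hq4] at h1
    have h2 : (1 + 2 * ((k : ℝ) / (8 * n))) ^ n ≤ Real.exp (k / 4) := by
      calc (1 + 2 * ((k : ℝ) / (8 * n))) ^ n ≤ Real.exp (2 * ((k : ℝ) / (8 * n))) ^ n := by
            gcongr
            rw [add_comm]
            exact Real.add_one_le_exp _
        _ = Real.exp (k / 4) := by
            rw [← Real.exp_nat_mul]; congr 1; field_simp; norm_num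
    have h3 : z * Real.sqrt s ^ k ≤ 2 * Real.exp (k / 4) := h1.trans (by gcongr)
    calc z ^ 2 * s ^ k = (z * Real.sqrt s ^ k) ^ 2 := by
          rw [mul_pow, ← pow_mul, mul_comm k 2, pow_mul, hq2]
      _ ≤ (2 * Real.exp (k / 4)) ^ 2 := by gcongr
      _ = 4 * r ^ k := by
          rw [mul_pow, ← Real.exp_nat_mul, hr, ← Real.exp_nat_mul]
          norm_num
          ring
  set B : ℝ := r / s * (k / Real.exp 1) / (2 * n) with hB
  have hB0 : 0 < B := by positivity
  have hB2 : B ^ 2 ≤ 3 / 4 * (k * (1 / n)) := by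
    have e : B ^ 2 = 2 / Real.exp 1 * (k * (1 / n)) := by
      rw [hB, div_pow, mul_pow, div_pow, hr2, hs2]
      field_simp
      norm_num
    have he2 : 2 / Real.exp 1 ≤ 3 / 4 := by
      rw [div_le_div_iff₀ he (by norm_num)]
      have := Real.exp_one_gt_d9
      linarith
    rw [e]
    exact mul_le_mul_of_nonneg_right he2 (by positivity)
  have hB1 : B ≤ 7 / 8 := by
    have : (k : ℝ) * (1 / n) ≤ 1 := by rw [mul_one_div, div_le_one hn0]; exact hkn
    nlinarith
  obtain ⟨j, rfl⟩ : ∃ j, k = j + 2 := ⟨k - 2, by omega⟩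
  set k := j + 2 with hkj
  calc z ^ 2 * (1 / ((3 * n).choose k : ℝ))
      ≤ z ^ 2 * (Real.exp 1 * k * (k / Real.exp 1) ^ k / (2 * n) ^ k) := by
        refine mul_le_mul_of_nonneg_left ((one_div_choose_three_mul_le (by omega) hk.le).trans ?_)
          (by positivity)
        gcongr
        exact factorial_le_mul_div_exp_pow (by omega)
    _ = (z ^ 2 * s ^ k) * (Real.exp 1 * k * ((k / Real.exp 1) / s / (2 * n)) ^ k) := by
        simp only [div_pow, mul_pow]
        field_simp
    _ ≤ (4 * r ^ k) * (Real.exp 1 * k * ((k / Real.exp 1) / s / (2 * n)) ^ k) := by gcongr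
    _ = 4 * Real.exp 1 * k * B ^ k := by
        rw [hB]
        simp only [div_pow, mul_pow]
        field_simp
    -- Two factors `B` supply `1/n`; this is where `2 ≤ k` is needed. The other factors give
    -- geometric decay.
    _ = 4 * Real.exp 1 * k * (B ^ 2 * B ^ j) := by rw [hkj]; ring
    _ ≤ 4 * 2.75 * k * ((3 / 4 * (k * (1 / n))) * (7 / 8) ^ j) := by
        have := Real.exp_one_lt_d9
        gcongr
        linarith
    _ = 4 * 2.75 * (3 / 4) * (64 / 49) * ((k : ℝ) ^ 2 * (7 / 8) ^ k) * (1 / n) := by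
        rw [hkj, pow_add (7 / 8 : ℝ)]; ring
    _ ≤ _ := by gcongr; norm_num

theorem choose_three_mul_succ (n : ℕ) :
    (3 * (n + 1)).choose (n + 1) * ((n + 1) * ((2 * n + 2) * (2 * n + 1))) =
      (3 * n).choose n * ((3 * n + 3) * ((3 * n + 2) * (3 * n + 1))) := by
  have h1 := Nat.choose_mul_succ_eq (3 * n) n
  have h2 := Nat.choose_mul_succ_eq (3 * n + 1) n
  have h3 := Nat.add_one_mul_choose_eq (3 * n + 2) n
  have e1 : 3 * n + 1 - n = 2 * n + 1 := by omega
  have e2 : 3 * n + 1 + 1 - n = 2 * n + 2 := by omega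
  rw [e1] at h1
  rw [e2] at h2
  have e3 : 3 * (n + 1) = 3 * n + 2 + 1 := by ring
  rw [e3]
  calc _ = ((3 * n + 2 + 1).choose (n + 1) * (n + 1)) * ((2 * n + 2) * (2 * n + 1)) := by ring
    _ = (3 * n + 3) * ((3 * n + 1 + 1).choose n * (2 * n + 2)) * (2 * n + 1) := by
      rw [← h3]; ring
    _ = (3 * n + 3) * (3 * n + 2) * ((3 * n + 1).choose n * (2 * n + 1)) := by rw [← h2]; ring
    _ = _ := by rw [← h1]; ring

/-- The quotient of consecutive terms, given by `choose_three_mul_succ`, is at least 5 from `n = 1`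
on. -/
theorem three_mul_five_pow_le_choose {n : ℕ} (hn : 1 ≤ n) :
    3 * 5 ^ n ≤ 5 * (3 * n).choose n := by
  induction n, hn using Nat.le_induction with
  | base => decide
  | succ n hn ih =>
    have h := choose_three_mul_succ n
    have hpos : 0 < (n + 1) * ((2 * n + 2) * (2 * n + 1)) := by positivity
    have hq : 5 * ((n + 1) * ((2 * n + 2) * (2 * n + 1))) ≤
        (3 * n + 3) * ((3 * n + 2) * (3 * n + 1)) := by
      obtain ⟨m, rfl⟩ : ∃ m, n = m + 1 := ⟨n - 1, by omega⟩
      nlinarith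
    refine Nat.le_of_mul_le_mul_right ?_ hpos
    calc 3 * 5 ^ (n + 1) * ((n + 1) * ((2 * n + 2) * (2 * n + 1)))
        = (3 * 5 ^ n) * (5 * ((n + 1) * ((2 * n + 2) * (2 * n + 1)))) := by ring
      _ ≤ (5 * (3 * n).choose n) * ((3 * n + 3) * ((3 * n + 2) * (3 * n + 1))) :=
          Nat.mul_le_mul ih hq
      _ = _ := by rw [mul_assoc, ← h]; ring

theorem choose_mono_of_le_half {N a b : ℕ} (hab : a ≤ b) (hb : 2 * b ≤ N) :
    N.choose a ≤ N.choose b := by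
  induction b, hab using Nat.le_induction with
  | base => exact le_rfl
  | succ b _ ih =>
    exact (ih (by omega)).trans (Nat.choose_le_succ_of_lt_half_left (by omega))

theorem choose_three_mul_le_choose {n k : ℕ} (h1 : n ≤ k) (h2 : k ≤ 2 * n) :
    (3 * n).choose n ≤ (3 * n).choose k := by
  by_cases h : 2 * k ≤ 3 * n
  · exact choose_mono_of_le_half h1 (by omega)
  · rw [← Nat.choose_symm (show k ≤ 3 * n by omega)]
    exact choose_mono_of_le_half (by omega) (by omega)

/-- There are at most `4 ^ (n + 1)` pairs of even sets, while by unimodality the binomial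
coefficient is at least `(3/5) * 5 ^ n`. Bernoulli's inequality turns `(4/5) ^ n` into `4 / n`. -/
theorem four_mul_four_pow_div_choose_le {n k : ℕ} (hn : 1 ≤ n) (h1 : n ≤ k) (h2 : k ≤ 2 * n) :
    ((2 : ℝ) ^ (n + 1)) ^ 2 * (1 / ((3 * n).choose k : ℝ)) ≤ 27 * (1 / n) := by
  have hc : 3 * 5 ^ n ≤ 5 * (3 * n).choose k :=
    (three_mul_five_pow_le_choose hn).trans (by gcongr; exact choose_three_mul_le_choose h1 h2)
  have hc' : (3 : ℝ) * 5 ^ n ≤ 5 * (3 * n).choose k := by exact_mod_cast hc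
  have hn0 : (0 : ℝ) < n := by exact_mod_cast hn
  have hb : (n : ℝ) / 4 ≤ (5 / 4) ^ n := by
    have := one_add_mul_le_pow (a := (1 / 4 : ℝ)) (by norm_num) n
    norm_num at this
    linarith
  have h0 : (0 : ℝ) < (3 * n).choose k := by exact_mod_cast Nat.choose_pos (by omega)
  have h5 : (5 : ℝ) ^ n = (5 / 4) ^ n * 4 ^ n := by rw [← mul_pow]; norm_num
  have h4 : ((2 : ℝ) ^ (n + 1)) ^ 2 = 4 * 4 ^ n := by
    rw [← pow_mul, mul_comm, pow_mul, pow_succ]; norm_num; ring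
  rw [h4, mul_one_div, mul_one_div, div_le_div_iff₀ h0 hn0]
  have h44 : (0 : ℝ) < 4 ^ n := by positivity
  nlinarith [mul_le_mul_of_nonneg_right hb h44.le]

/-! ### The base graph is odd with probability `1 - O(1/n)`. -/

section Odd

variable {n : ℕ} [hn : Fact (6 ≤ n)]

/-- Union bound over pairs of even sets, split at size `n`: small sizes sum to a convergent series
times `1/n`, and the large ones use only the total number of even sets. -/
theorem permProb_not_isOddBipartite_le :
    permProb (fun σ : Equiv.Perm (ladder n).edgeSet =>
      ¬ IsOddBipartite (baseIncidence (ladder n) σ)) ≤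
    (12 * (∑' k : ℕ, (k : ℝ) ^ 2 * (7 / 8) ^ k) + 27) * (1 / n) := by
  classical
  have hn' := hn.out
  set E : ℕ → Finset (Finset (ladder n).edgeSet) := fun k =>
    (evenSets n).filter fun X => X.card = k with hE
  set L : Finset (Finset (ladder n).edgeSet × Finset (ladder n).edgeSet) :=
    (evenSets n ×ˢ evenSets n).filter fun p => n ≤ p.1.card with hL
  have h1 : permProb (fun σ : Equiv.Perm (ladder n).edgeSet =>
      ∃ k ∈ Finset.Ico 2 n, ∃ p ∈ E k ×ˢ E k, p.1.image σ = p.2) ≤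
      12 * (∑' k : ℕ, (k : ℝ) ^ 2 * (7 / 8) ^ k) * (1 / n) := by
    refine (permProb_exists_le _ _).trans ?_
    have hk : ∀ k ∈ Finset.Ico 2 n, permProb (fun σ : Equiv.Perm (ladder n).edgeSet =>
        ∃ p ∈ E k ×ˢ E k, p.1.image σ = p.2) ≤
        12 * ((k : ℝ) ^ 2 * (7 / 8) ^ k) * (1 / n) := by
      intro k hk
      obtain ⟨hk2, hkn⟩ := Finset.mem_Ico.1 hk
      refine le_trans ?_ (sq_div_choose_le hk2 hkn (Nat.cast_nonneg (E k).card)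
        fun q hq hq2 => card_evenSets_card_mul_pow_le hkn hq hq2)
      refine (permProb_le_card_mul (E k ×ˢ E k) _ (c := 1 / ((3 * n).choose k : ℝ)) ?_).trans
        (le_of_eq ?_)
      · rintro ⟨X, Y⟩ hp
        have hX : X.card = k := (Finset.mem_filter.1 (Finset.mem_product.1 hp).1).2
        have := permProb_image_eq_le X Y
        rwa [hX, card_edgeSet_ladder] at this
      · rw [Finset.card_product]; push_cast; ring
    refine (Finset.sum_le_sum hk).trans ?_
    rw [← Finset.sum_mul, ← Finset.mul_sum]
    gcongr
    refine Summable.sum_le_tsum _ (fun k _ => by positivity) ?_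
    exact summable_pow_mul_geometric_of_norm_lt_one 2 (by norm_num)
  have h2 : permProb (fun σ : Equiv.Perm (ladder n).edgeSet =>
      ∃ p ∈ L, p.1.image σ = p.2) ≤ 27 * (1 / n) := by
    refine (permProb_le_card_mul L _ (c := 27 * (1 / (n : ℝ)) / ((2 : ℝ) ^ (n + 1)) ^ 2) ?_).trans ?_
    · rintro ⟨X, Y⟩ hp
      obtain ⟨hp, hc⟩ := Finset.mem_filter.1 hp
      have hX := mem_evenSets.1 (Finset.mem_product.1 hp).1
      have := permProb_image_eq_le X Y
      rw [card_edgeSet_ladder] at this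
      refine this.trans ?_
      rw [le_div_iff₀ (by positivity), mul_comm]
      exact four_mul_four_pow_div_choose_le (by omega) hc (card_le_of_isEvenSet hX)
    · have hcard : (L.card : ℝ) ≤ ((2 : ℝ) ^ (n + 1)) ^ 2 := by
        have h := (Finset.card_filter_le (evenSets n ×ˢ evenSets n) fun p => n ≤ p.1.card).trans
          (le_of_eq (Finset.card_product _ _))
        have h' := h.trans (Nat.mul_le_mul card_evenSets_le card_evenSets_le)
        rw [← sq] at h'
        exact_mod_cast h'
      calc (L.card : ℝ) * (27 * (1 / (n : ℝ)) / ((2 : ℝ) ^ (n + 1)) ^ 2) ≤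
          ((2 : ℝ) ^ (n + 1)) ^ 2 * (27 * (1 / (n : ℝ)) / ((2 : ℝ) ^ (n + 1)) ^ 2) := by gcongr
        _ = 27 * (1 / (n : ℝ)) := by field_simp
  refine le_trans (permProb_mono ?_) ((permProb_or_le _ _).trans
    ((add_le_add h1 h2).trans (le_of_eq (by ring))))
  intro σ hσ
  obtain ⟨X, hne, hX, hY⟩ := exists_even_of_not_isOdd hσ
  have hcard : (X.image σ).card = X.card := Finset.card_image_of_injective _ σ.injective
  by_cases hlt : X.card < n
  · exact Or.inl ⟨X.card, Finset.mem_Ico.2 ⟨two_le_card_of_isEvenSet hX hne, hlt⟩, (X, X.image σ),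
      Finset.mem_product.2 ⟨Finset.mem_filter.2 ⟨mem_evenSets.2 hX, rfl⟩,
        Finset.mem_filter.2 ⟨mem_evenSets.2 hY, hcard⟩⟩, rfl⟩
  · exact Or.inr ⟨(X, X.image σ), Finset.mem_filter.2 ⟨Finset.mem_product.2
      ⟨mem_evenSets.2 hX, mem_evenSets.2 hY⟩, not_lt.1 hlt⟩, rfl⟩

end Odd

/-! ### Rigidity of multipede graphs. -/

section Multipede

variable {V W : Type*} {E : V → W → Prop}

theorem multipede_adj_inl_inr {p : Σ v : V, InnerVertex E v} {q : W × Bool} :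
    (multipede E).Adj (Sum.inl p) (Sum.inr q) ↔ E p.1 q.1 ∧ (q.2 = true ↔ q.1 ∈ p.2.1) := by
  obtain ⟨v, S⟩ := p
  obtain ⟨w, c⟩ := q
  constructor
  · rintro ⟨-, ⟨v', S', w', c', h1, h2, h3⟩ | ⟨v', S', w', c', h1, -, -⟩⟩
    · cases h1; cases h2; exact h3
    · cases h1
  · rintro ⟨h1, h2⟩
    exact ⟨by simp, Or.inl ⟨v, S, w, c, rfl, rfl, h1, h2⟩⟩

theorem not_multipede_adj_inl_inl {p p' : Σ v : V, InnerVertex E v} :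
    ¬ (multipede E).Adj (Sum.inl p) (Sum.inl p') := by
  rintro ⟨-, ⟨v', S', w', c', -, h2, -⟩ | ⟨v', S', w', c', -, h2, -⟩⟩ <;> cases h2

theorem not_multipede_adj_inr_inr {q q' : W × Bool} :
    ¬ (multipede E).Adj (Sum.inr q) (Sum.inr q') := by
  rintro ⟨-, ⟨v', S', w', c', h2, -, -⟩ | ⟨v', S', w', c', h2, -, -⟩⟩ <;> cases h2

theorem ncard_neighborSet_multipede_inl {p : Σ v : V, InnerVertex E v} :
    ((multipede E).neighborSet (Sum.inl p)).ncard = {w | E p.1 w}.ncard := by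
  classical
  have : (multipede E).neighborSet (Sum.inl p) =
      (fun w : W => Sum.inr (w, decide (w ∈ p.2.1))) '' {w | E p.1 w} := by
    ext x
    rw [SimpleGraph.mem_neighborSet]
    rcases x with x | ⟨w, c⟩
    · simp [not_multipede_adj_inl_inl]
    · rw [multipede_adj_inl_inr]
      constructor
      · rintro ⟨h1, h2⟩
        refine ⟨w, h1, ?_⟩
        have : c = decide (w ∈ p.2.1) := by rw [Bool.eq_iff_iff, h2, decide_eq_true_iff]
        rw [this]
      · rintro ⟨w', h1, h2⟩
        simp only [Sum.inr.injEq, Prod.mk.injEq] at h2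
        obtain ⟨rfl, rfl⟩ := h2
        exact ⟨h1, by simp⟩
  rw [this, Set.ncard_image_of_injective]
  intro w w' h
  simpa using congrArg (fun x => Sum.elim (fun _ => w) Prod.fst x) h

/-- The third neighbor of `v` is free to correct the parity. -/
theorem exists_innerVertex {v : V} (h3 : {w | E v w}.ncard = 3) {w w' : W} (hw : E v w)
    (hw' : E v w') (hne : w ≠ w') (c c' : Bool) :
    ∃ S : InnerVertex E v, (c = true ↔ w ∈ S.1) ∧ (c' = true ↔ w' ∈ S.1) := by
  classical
  obtain ⟨x, hx, hxw, hxw'⟩ : ∃ x, E v x ∧ x ≠ w ∧ x ≠ w' := by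
    by_contra! hcon
    have hsub : {u | E v u} ⊆ ({w, w'} : Set W) := by
      intro u hu
      by_cases h : u = w
      · exact Or.inl h
      · exact Or.inr (hcon u hu h)
    have := Set.ncard_le_ncard hsub (Set.toFinite _)
    rw [h3, Set.ncard_pair hne] at this
    omega
  cases c <;> cases c'
  · exact ⟨⟨∅, by simp, by simp⟩, by simp⟩
  · exact ⟨⟨{w', x}, by simp [hw', hx], by rw [Finset.card_pair hxw'.symm]; decide⟩,
      by simp [hne, hxw.symm]⟩
  · exact ⟨⟨{w, x}, by simp [hw, hx], by rw [Finset.card_pair hxw.symm]; decide⟩,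
      by simp [hne.symm, hxw'.symm]⟩
  · exact ⟨⟨{w, w'}, by simp [hw, hw'], by rw [Finset.card_pair hne]; decide⟩, by simp⟩

theorem exists_innerVertex_pair {v : V} (h3 : {w | E v w}.ncard = 3) {w : W} (hw : E v w)
    (c : Bool) : ∃ S S' : InnerVertex E v, S ≠ S' ∧ (c = true ↔ w ∈ S.1) ∧
      (c = true ↔ w ∈ S'.1) := by
  obtain ⟨x, hx, hxw⟩ : ∃ x, E v x ∧ x ≠ w := by
    by_contra! hcon
    have hsub : {u | E v u} ⊆ ({w} : Set W) := fun u hu => hcon u hu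
    have := Set.ncard_le_ncard hsub (Set.toFinite _)
    rw [h3, Set.ncard_singleton] at this
    omega
  obtain ⟨S, hS, hSx⟩ := exists_innerVertex h3 hw hx hxw.symm c true
  obtain ⟨S', hS', hSx'⟩ := exists_innerVertex h3 hw hx hxw.symm c false
  refine ⟨S, S', ?_, hS, hS'⟩
  rintro rfl
  simpa using hSx.trans hSx'.symm

/-- Each of the gadgets of `v` and `v'` contributes two neighbors, so the degree is at least four;
this separates the sides of the multipede. -/
theorem ncard_neighborSet_multipede_inr_ne (h3 : ∀ v, {w | E v w}.ncard = 3) {q : W × Bool}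
    {v v' : V} (hne : v ≠ v') (hv : E v q.1) (hv' : E v' q.1) :
    ((multipede E).neighborSet (Sum.inr q)).ncard ≠ 3 := by
  classical
  intro hcard
  obtain ⟨S, S', hS, h1, h2⟩ := exists_innerVertex_pair (h3 v) hv q.2
  obtain ⟨T, T', hT, h1', h2'⟩ := exists_innerVertex_pair (h3 v') hv' q.2
  have hsub : (({Sum.inl ⟨v, S⟩, Sum.inl ⟨v, S'⟩, Sum.inl ⟨v', T⟩, Sum.inl ⟨v', T'⟩} :
      Finset ((Σ v : V, InnerVertex E v) ⊕ (W × Bool))) : Set _) ⊆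
        (multipede E).neighborSet (Sum.inr q) := by
    intro x hx
    rw [SimpleGraph.mem_neighborSet, SimpleGraph.adj_comm]
    simp only [Finset.coe_insert, Finset.coe_singleton, Set.mem_insert_iff,
      Set.mem_singleton_iff] at hx
    rcases hx with rfl | rfl | rfl | rfl <;> rw [multipede_adj_inl_inr]
    · exact ⟨hv, h1⟩
    · exact ⟨hv, h2⟩
    · exact ⟨hv', h1'⟩
    · exact ⟨hv', h2'⟩
  have := Set.ncard_le_ncard hsub (Set.finite_of_ncard_ne_zero (by omega))
  rw [hcard, Set.ncard_coe_finset, Finset.card_insert_of_notMem, Finset.card_insert_of_notMem,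
    Finset.card_pair] at this
  · omega
  · simpa using hT
  · simp [hne]
  · simp [hne, hS]

/-- The right side depends on `q` only through `q.1`: the vertices `a(w)` and `b(w)` share their
second neighborhood. -/
theorem mem_secondNeighborhood_multipede (h3 : ∀ v, {w | E v w}.ncard = 3) {q : W × Bool}
    {z : (Σ v : V, InnerVertex E v) ⊕ (W × Bool)} :
    z ∈ secondNeighborhood (multipede E) (Sum.inr q) ↔
      ∃ r : W × Bool, z = Sum.inr r ∧ r.1 ≠ q.1 ∧ ∃ v, E v q.1 ∧ E v r.1 := by
  constructor
  · rintro ⟨hne, x, h1, h2⟩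
    rcases x with p | x
    swap
    · exact (not_multipede_adj_inr_inr h1).elim
    rcases z with z | r
    · exact (not_multipede_adj_inl_inl h2).elim
    rw [SimpleGraph.adj_comm, multipede_adj_inl_inr] at h1
    rw [multipede_adj_inl_inr] at h2
    refine ⟨r, rfl, fun h => hne ?_, p.1, h1.1, h2.1⟩
    congr 1
    refine Prod.ext h ?_
    rw [Bool.eq_iff_iff, h2.2, h1.2, h]
  · rintro ⟨r, rfl, hne, v, h1, h2⟩
    obtain ⟨S, hS, hS'⟩ := exists_innerVertex (h3 v) h1 h2 hne.symm q.2 r.2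
    refine ⟨fun h => hne (congrArg Prod.fst (Sum.inr.inj h)), Sum.inl ⟨v, S⟩, ?_, ?_⟩
    · rw [SimpleGraph.adj_comm, multipede_adj_inl_inr]; exact ⟨h1, hS⟩
    · rw [multipede_adj_inl_inr]; exact ⟨h2, hS'⟩

theorem mem_secondNeighborhood_iso {X Y : Type*} {G : SimpleGraph X} {H : SimpleGraph Y}
    (φ : G ≃g H) {x y : X} :
    φ y ∈ secondNeighborhood H (φ x) ↔ y ∈ secondNeighborhood G x := by
  constructor
  · rintro ⟨hne, z, h1, h2⟩
    obtain ⟨z, rfl⟩ := φ.surjective z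
    exact ⟨fun h => hne (by rw [h]), z, φ.map_adj_iff.1 h1, φ.map_adj_iff.1 h2⟩
  · rintro ⟨hne, z, h1, h2⟩
    exact ⟨fun h => hne (φ.injective h), φ z, φ.map_adj_iff.2 h1, φ.map_adj_iff.2 h2⟩

/-- A pair of permutations of the two sides that respects the incidence relation is an
automorphism of the bipartite graph. -/
def bipartiteIso (ρ : V ≃ V) (π : W ≃ W) (h : ∀ v w, E (ρ v) (π w) ↔ E v w) :
    bipartiteGraph E ≃g bipartiteGraph E where
  toEquiv := Equiv.sumCongr ρ π
  map_rel_iff' := by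
    rintro (v | w) (v' | w')
    · simp [not_bipartiteGraph_adj_inl_inl]
    · simp [bipartiteGraph_adj_inl_inr, h]
    · simp [bipartiteGraph_adj_inr_inl, h]
    · simp [not_bipartiteGraph_adj_inr_inr]

theorem eq_of_isRigid (hr : IsRigid (bipartiteGraph E)) {ρ : V ≃ V} {π : W ≃ W}
    (h : ∀ v w, E (ρ v) (π w) ↔ E v w) : (∀ v, ρ v = v) ∧ ∀ w, π w = w :=
  ⟨fun v => Sum.inl.inj (hr (bipartiteIso ρ π h) (Sum.inl v)),
    fun w => Sum.inr.inj (hr (bipartiteIso ρ π h) (Sum.inr w))⟩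

/-- Two vertices with equal neighborhoods could be swapped. -/
theorem eq_of_forall_incident_iff (hr : IsRigid (bipartiteGraph E)) {v v' : V}
    (h : ∀ w, E v w ↔ E v' w) : v = v' := by
  classical
  have := (eq_of_isRigid hr (ρ := Equiv.swap v v') (π := Equiv.refl W) ?_).1 v
  · rw [Equiv.swap_apply_left] at this; exact this.symm
  · intro u w
    by_cases h1 : u = v
    · subst h1; simp [h]
    · by_cases h2 : u = v'
      · subst h2; simp [h]
      · simp [Equiv.swap_apply_of_ne_of_ne h1 h2]

/-- An automorphism of a multipede graph over a suitable base graph preserves both sides. -/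
theorem exists_side_maps (h3 : ∀ v, {w | E v w}.ncard = 3)
    (h2 : ∀ w, ∃ v v', v ≠ v' ∧ E v w ∧ E v' w) (φ : multipede E ≃g multipede E) :
    (∀ p, ∃ p', φ (Sum.inl p) = Sum.inl p') ∧ ∀ q, ∃ q', φ (Sum.inr q) = Sum.inr q' := by
  constructor
  · intro p
    rcases h : φ (Sum.inl p) with p' | q
    · exact ⟨p', rfl⟩
    · have := ncard_neighborSet_iso φ (Sum.inl p)
      rw [h, ncard_neighborSet_multipede_inl, h3] at this
      obtain ⟨v, v', hne, hv, hv'⟩ := h2 q.1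
      exact (ncard_neighborSet_multipede_inr_ne h3 hne hv hv' this).elim
  · intro q
    rcases h : φ (Sum.inr q) with p' | q'
    · have := ncard_neighborSet_iso φ (Sum.inr q)
      rw [h, ncard_neighborSet_multipede_inl, h3] at this
      obtain ⟨v, v', hne, hv, hv'⟩ := h2 q.1
      exact (ncard_neighborSet_multipede_inr_ne h3 hne hv hv' this.symm).elim
    · exact ⟨q', rfl⟩

theorem isRigid_multipede (h3 : ∀ v, {w | E v w}.ncard = 3)
    (h2 : ∀ w, ∃ v v', v ≠ v' ∧ E v w ∧ E v' w) (hodd : IsOddBipartite E)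
    (hr : IsRigid (bipartiteGraph E)) (hsn : SecondNeighborhoodsDistinct E) :
    IsRigid (multipede E) := by
  classical
  intro φ
  obtain ⟨hf, hg⟩ := exists_side_maps h3 h2 φ
  obtain ⟨hf', hg'⟩ := exists_side_maps h3 h2 φ.symm
  choose f hf using hf
  choose g hg using hg
  have hadj : ∀ p q, (E p.1 q.1 ∧ (q.2 = true ↔ q.1 ∈ p.2.1)) ↔
      (E (f p).1 (g q).1 ∧ ((g q).2 = true ↔ (g q).1 ∈ (f p).2.1)) := by
    intro p q
    rw [← multipede_adj_inl_inr, ← multipede_adj_inl_inr, ← hf, ← hg, φ.map_adj_iff]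
  have hginj : Function.Injective g := by
    intro q q' h
    exact Sum.inr.inj (φ.injective (by rw [hg, hg, h]))
  -- The images of `a(w)` and `b(w)` have equal second neighborhoods, so they lie over the same
  -- vertex of the base graph.
  have hfst : ∀ w c, (g (w, c)).1 = (g (w, true)).1 := by
    intro w c
    by_contra hne
    refine hsn _ _ hne ?_
    have key : ∀ u, (u ≠ (g (w, c)).1 ∧ ∃ v, E v (g (w, c)).1 ∧ E v u) ↔
        (u ≠ (g (w, true)).1 ∧ ∃ v, E v (g (w, true)).1 ∧ E v u) := by
      intro u
      have h1 : ∀ d, φ (φ.symm (Sum.inr (u, true))) ∈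
          secondNeighborhood (multipede E) (φ (Sum.inr (w, d))) ↔
          (u ≠ (g (w, d)).1 ∧ ∃ v, E v (g (w, d)).1 ∧ E v u) := by
        intro d
        rw [φ.apply_symm_apply, hg, mem_secondNeighborhood_multipede h3]
        constructor
        · rintro ⟨r, hr, h⟩
          obtain rfl := Sum.inr.inj hr
          exact h
        · exact fun h => ⟨_, rfl, h⟩
      rw [← h1, ← h1, mem_secondNeighborhood_iso, mem_secondNeighborhood_iso,
        mem_secondNeighborhood_multipede h3, mem_secondNeighborhood_multipede h3]
    ext z
    rw [mem_secondNeighborhood_bipartiteGraph, mem_secondNeighborhood_bipartiteGraph]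
    simp only [key]
  have hflip : ∀ w c, g (w, !c) = ((g (w, c)).1, !(g (w, c)).2) := by
    intro w c
    refine Prod.ext ((hfst w _).trans (hfst w c).symm) ?_
    have hne : g (w, !c) ≠ g (w, c) := fun h => by simpa using hginj h
    by_contra h
    refine hne (Prod.ext ((hfst w _).trans (hfst w c).symm) ?_)
    cases h1 : (g (w, !c)).2 <;> cases h2 : (g (w, c)).2 <;> simp_all
  set π₀ : W → W := fun w => (g (w, true)).1 with hπ₀
  have hπinj : Function.Injective π₀ := by
    intro w w' h
    by_cases hc : (g (w, true)).2 = (g (w', true)).2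
    · exact congrArg Prod.fst (hginj (Prod.ext h hc))
    · have : g (w, !true) = g (w', true) := by
        rw [hflip]
        refine Prod.ext h ?_
        revert hc
        change (g (w, true)).2 ≠ (g (w', true)).2 → (!(g (w, true)).2) = (g (w', true)).2
        generalize (g (w, true)).2 = a
        generalize (g (w', true)).2 = b
        revert a b
        decide
      exact congrArg Prod.fst (hginj this)
  have hπsurj : Function.Surjective π₀ := by
    intro u
    obtain ⟨⟨w, c⟩, hw⟩ := hg' (u, true)
    refine ⟨w, ?_⟩
    have : φ (Sum.inr (w, c)) = Sum.inr (u, true) := by rw [← hw, φ.apply_symm_apply]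
    rw [hg] at this
    change (g (w, true)).1 = u
    rw [← hfst w c, Sum.inr.inj this]
  have hsub : ∀ p w, E p.1 w → E (f p).1 (π₀ w) := by
    intro p w h
    have := ((hadj p (w, decide (w ∈ p.2.1))).1 ⟨h, by simp⟩).1
    rwa [hfst] at this
  have hN : ∀ p w, E (f p).1 (π₀ w) ↔ E p.1 w := by
    intro p w
    refine ⟨fun h => ?_, hsub p w⟩
    -- Both neighborhoods have size 3, so inclusion is equality.
    have himg : π₀ '' {w | E p.1 w} = {w | E (f p).1 w} := by
      apply Set.eq_of_subset_of_ncard_le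
      · rintro _ ⟨w, hw, rfl⟩
        exact hsub p w hw
      · rw [Set.ncard_image_of_injective _ hπinj, h3, h3]
      · exact Set.finite_of_ncard_ne_zero (by rw [h3]; omega)
    have hmem : π₀ w ∈ π₀ '' {w | E p.1 w} := by rw [himg]; exact h
    obtain ⟨w', hw', he⟩ := hmem
    rwa [← hπinj he]
  set ρ₀ : V → V := fun v => (f ⟨v, ⟨∅, by simp, by simp⟩⟩).1 with hρ₀
  have hρ : ∀ v w, E (ρ₀ v) (π₀ w) ↔ E v w := fun v w => hN _ w
  have hρf : ∀ p, (f p).1 = ρ₀ p.1 := by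
    intro p
    refine eq_of_forall_incident_iff hr fun w => ?_
    obtain ⟨w, rfl⟩ := hπsurj w
    rw [hN, hρ]
  have hρinj : Function.Injective ρ₀ := by
    intro v v' h
    refine eq_of_forall_incident_iff hr fun w => ?_
    rw [← hρ, h, hρ]
  have hρsurj : Function.Surjective ρ₀ := by
    intro u
    obtain ⟨p, hp⟩ := hf' ⟨u, ⟨∅, by simp, by simp⟩⟩
    refine ⟨p.1, ?_⟩
    have : φ (Sum.inl p) = Sum.inl ⟨u, ⟨∅, by simp, by simp⟩⟩ := by
      rw [← hp, φ.apply_symm_apply]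
    rw [hf] at this
    rw [← hρf, Sum.inl.inj this]
  obtain ⟨hρid, hπid⟩ := eq_of_isRigid hr (ρ := Equiv.ofBijective ρ₀ ⟨hρinj, hρsurj⟩)
    (π := Equiv.ofBijective π₀ ⟨hπinj, hπsurj⟩) hρ
  have hgfst : ∀ q, (g q).1 = q.1 := fun q => (hfst q.1 q.2).trans (hπid q.1)
  have hffst : ∀ p, (f p).1 = p.1 := fun p => (hρf p).trans (hρid p.1)
  -- The set of flipped pairs meets the neighborhood of `v` in the index of the image of `m_∅(v)`,
  -- which is even for every `v`.
  have hX : {w | (g (w, false)).2 = true} = ∅ := by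
    by_contra hne
    obtain ⟨v, hv⟩ := hodd _ (Set.nonempty_iff_ne_empty.2 hne)
    refine Nat.not_even_iff_odd.2 hv ?_
    set p : Σ v : V, InnerVertex E v := ⟨v, ⟨∅, by simp, by simp⟩⟩
    have hp : ∀ w, false = true ↔ w ∈ p.2.1 :=
      fun w => ⟨by simp, fun h => absurd h (Finset.notMem_empty w)⟩
    have hset : {w | (g (w, false)).2 = true} ∩ {w | E v w} = ((f p).2.1 : Set W) := by
      ext w
      constructor
      · rintro ⟨h1, h2⟩
        have := ((hadj p (w, false)).1 ⟨h2, hp w⟩).2.1 h1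
        rwa [hgfst] at this
      · intro hw
        have hE : E v w := by
          have := (f p).2.2.1 w hw
          rwa [hffst] at this
        refine ⟨?_, hE⟩
        have := ((hadj p (w, false)).1 ⟨hE, hp w⟩).2
        rw [hgfst] at this
        exact this.2 hw
    rw [hset, Set.ncard_coe_finset]
    exact (f p).2.2.2
  have hgfalse : ∀ w, g (w, false) = (w, false) := by
    intro w
    refine Prod.ext (hgfst _) ?_
    have : w ∉ {w | (g (w, false)).2 = true} := by rw [hX]; simp
    simpa using this
  have hgid : ∀ q, g q = q := by
    rintro ⟨w, c⟩
    cases c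
    · exact hgfalse w
    · have := hflip w false
      rw [hgfalse] at this
      exact this
  rintro (p | q)
  · rw [hf]
    congr 1
    have key : ∀ w, E p.1 w → (w ∈ (f p).2.1 ↔ w ∈ p.2.1) := by
      intro w hw
      have := ((hadj p (w, decide (w ∈ p.2.1))).1 ⟨hw, by simp⟩).2
      rw [hgid] at this
      simpa using this.symm
    have h1 := hffst p
    generalize f p = p' at h1 key
    obtain ⟨v, S⟩ := p
    obtain ⟨v', T⟩ := p'
    obtain rfl : v' = v := h1
    congr 1
    refine Subtype.ext (Finset.ext fun w => ?_)
    constructor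
    · exact fun h => (key w (T.2.1 w h)).1 h
    · exact fun h => (key w (S.2.1 w h)).2 h
  · rw [hg, hgid]

end Multipede

/-! ### From the ladder to the cycle with diagonals, and asymptotics. -/

section Transfer

theorem val_eq_val_add_iff {n : ℕ} [NeZero (2 * n)] {u v : ZMod (2 * n)} :
    (v.val = u.val + n ∨ u.val = v.val + n) ↔ v = u + n := by
  have hu := ZMod.val_lt u
  have hv := ZMod.val_lt v
  have h2 : (n : ZMod (2 * n)) + n = 0 := by
    have := ZMod.natCast_self (2 * n)
    push_cast at this
    linear_combination this
  constructor
  · rintro (h | h)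
    · rw [← ZMod.natCast_zmod_val v, h]
      push_cast
      rw [ZMod.natCast_zmod_val]
    · have : u = v + n := by
        rw [← ZMod.natCast_zmod_val u, h]
        push_cast
        rw [ZMod.natCast_zmod_val]
      rw [this, add_assoc, h2, add_zero]
  · intro h
    have hn : (n : ZMod (2 * n)).val = n := ZMod.val_natCast_of_lt (by omega)
    have hval := ZMod.val_add u (n : ZMod (2 * n))
    rw [← h, hn] at hval
    by_cases hlt : u.val + n < 2 * n
    · left; rw [hval, Nat.mod_eq_of_lt hlt]
    · right
      rw [Nat.mod_eq_sub_mod (by omega), Nat.mod_eq_of_lt (by omega)] at hval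
      omega

/-- `ZMod (2 * (m + 1))` unfolds to `Fin (2 * (m + 1))`, so this is an equality of graphs on one
vertex type. -/
theorem cycleWithDiagonals_eq_ladder (m : ℕ) :
    cycleWithDiagonals (m + 1) = (ladder (m + 1) : SimpleGraph (ZMod (2 * (m + 1)))) := by
  have h : ∀ u v : ZMod (2 * (m + 1)),
      (cycleWithDiagonals (m + 1)).Adj u v ↔ (ladder (m + 1)).Adj u v := by
    intro u v
    have h1 : (SimpleGraph.cycleGraph (2 * (m + 1))).Adj u v ↔
        u ≠ v ∧ (v = u + 1 ∨ u = v + 1) := by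
      have h2 : (SimpleGraph.cycleGraph (2 * (m + 1))).Adj u v ↔ (u - v = 1 ∨ v - u = 1) :=
        SimpleGraph.cycleGraph_adj (n := 2 * m)
      have h3 : (SimpleGraph.cycleGraph (2 * (m + 1))).Adj u v → u ≠ v :=
        (SimpleGraph.cycleGraph (2 * (m + 1))).ne_of_adj
      rw [sub_eq_iff_eq_add', sub_eq_iff_eq_add'] at h2
      exact ⟨fun h => ⟨h3 h, (h2.1 h).symm⟩, fun h => h2.2 h.2.symm⟩
    have h4 : (SimpleGraph.fromRel fun i j : Fin (2 * (m + 1)) =>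
        (j : ℕ) = (i : ℕ) + (m + 1)).Adj u v ↔ u ≠ v ∧ (v = u + ((m + 1 : ℕ) : ZMod _)) := by
      rw [← val_eq_val_add_iff]
      exact Iff.rfl
    have h5 : (cycleWithDiagonals (m + 1)).Adj u v ↔
        (SimpleGraph.cycleGraph (2 * (m + 1))).Adj u v ∨ (SimpleGraph.fromRel
          fun i j : Fin (2 * (m + 1)) => (j : ℕ) = (i : ℕ) + (m + 1)).Adj u v := Iff.rfl
    rw [h5, h1, h4]
    change _ ↔ u ≠ v ∧ (v = u + 1 ∨ u = v + 1 ∨ v = u + ((m + 1 : ℕ) : ZMod _))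
    tauto
  exact SimpleGraph.ext (funext fun u => funext fun v => propext (h u v))

/-- Statements about the ladder for all large `n` carry over to the cycle with diagonals. -/
theorem cycleWithDiagonals_induction (P : ∀ (_n : ℕ) {V : Type}, SimpleGraph V → Prop) {N : ℕ}
    (hN : 1 ≤ N) (h : ∀ n, N ≤ n → P n (ladder n)) :
    ∀ n, N ≤ n → P n (cycleWithDiagonals n) := by
  intro n hn
  obtain ⟨m, rfl⟩ : ∃ m, n = m + 1 := ⟨n - 1, by omega⟩
  rw [cycleWithDiagonals_eq_ladder]
  exact h _ hn

theorem isBigO_one_div_of_le {f : ℕ → ℝ} {c : ℝ} {N : ℕ} (h0 : ∀ n, 0 ≤ f n)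
    (h : ∀ n, N ≤ n → f n ≤ c * (1 / n)) : f =O[atTop] fun n : ℕ => 1 / (n : ℝ) := by
  refine IsBigO.of_bound c ?_
  filter_upwards [eventually_ge_atTop N] with n hn
  rw [Real.norm_of_nonneg (h0 n), Real.norm_of_nonneg (by positivity)]
  exact h n hn

theorem one_div_isBigO_log_sq_div :
    (fun n : ℕ => 1 / (n : ℝ)) =O[atTop] fun n : ℕ => (Real.log n) ^ 2 / (n : ℝ) := by
  refine IsBigO.of_bound 1 ?_
  filter_upwards [eventually_ge_atTop 3] with n hn
  rw [Real.norm_of_nonneg (by positivity), Real.norm_of_nonneg (by positivity), one_mul]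
  have h3 : (3 : ℝ) ≤ n := by exact_mod_cast hn
  have h1 : 1 ≤ Real.log n := by
    rw [Real.le_log_iff_exp_le (by linarith)]
    have := Real.exp_one_lt_d9
    linarith
  gcongr
  nlinarith

theorem permProb_nonneg {α : Type*} (P : Equiv.Perm α → Prop) : 0 ≤ permProb P := by
  unfold permProb; positivity

end Transfer

/-! ### Combining the three bad events. -/

section Ladder

variable {n : ℕ} [hn : Fact (6 ≤ n)]

theorem ncard_baseIncidence (σ : Equiv.Perm (ladder n).edgeSet) (x : ZMod (2 * n) × Fin 2) :
    {e | baseIncidence (ladder n) σ x e}.ncard = 3 := by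
  rw [← ncard_edges_at x.1, ← Set.ncard_image_of_injective _ (layerPerm σ x.2).injective]
  congr 1
  ext e
  constructor
  · rintro ⟨f, hf, rfl⟩
    exact baseIncidence_iff.1 hf
  · intro he
    refine ⟨(layerPerm σ x.2).symm e, ?_, Equiv.apply_symm_apply _ _⟩
    exact baseIncidence_iff.2 (by rwa [Equiv.apply_symm_apply])

theorem exists_two_baseIncidence (σ : Equiv.Perm (ladder n).edgeSet) (e : (ladder n).edgeSet) :
    ∃ x y, x ≠ y ∧ baseIncidence (ladder n) σ x e ∧ baseIncidence (ladder n) σ y e := by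
  obtain ⟨u, v, huv, -, he⟩ := exists_edge_eq e
  refine ⟨(u, 0), (v, 0), fun h => huv (congrArg Prod.fst h), ?_, ?_⟩ <;>
    simp [baseIncidence, he]

theorem permProb_not_isRigid_multipede_le :
    permProb (fun σ : Equiv.Perm (ladder n).edgeSet =>
      ¬ IsRigid (multipede (baseIncidence (ladder n) σ))) ≤
    permProb (fun σ : Equiv.Perm (ladder n).edgeSet =>
      ¬ IsOddBipartite (baseIncidence (ladder n) σ)) +
    (permProb (fun σ : Equiv.Perm (ladder n).edgeSet =>
      ¬ IsRigid (bipartiteGraph (baseIncidence (ladder n) σ))) +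
    permProb (fun σ : Equiv.Perm (ladder n).edgeSet =>
      ¬ SecondNeighborhoodsDistinct (baseIncidence (ladder n) σ))) := by
  refine (permProb_mono fun σ h => ?_).trans
    ((permProb_or_le _ _).trans (add_le_add le_rfl (permProb_or_le _ _)))
  by_contra! hcon
  exact h (isRigid_multipede (ncard_baseIncidence σ) (exists_two_baseIncidence σ)
    hcon.1 hcon.2.1 hcon.2.2)

theorem permProb_not_secondNeighborhoodsDistinct_le :
    permProb (fun σ : Equiv.Perm (ladder n).edgeSet =>
      ¬ SecondNeighborhoodsDistinct (baseIncidence (ladder n) σ)) ≤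
    ((6 + 1) ^ 3 * (2 ^ (2 * 6 * (6 * (2 * 1 + 1))) * Nat.factorial 6)) * (1 / n) := by
  have h := permProb_not_isSparse_le (n := n) 1 6 hn.out
  refine (permProb_mono fun σ h hs => h (secondNeighborhoodsDistinct_of_isSparse hs)).trans ?_
  exact_mod_cast h

end Ladder

theorem theorem1 :
    ((fun n : ℕ => permProb fun σ : Equiv.Perm (cycleWithDiagonals n).edgeSet =>
        ¬ IsRigid (multipede (baseIncidence (cycleWithDiagonals n) σ)))
      =O[atTop] fun n : ℕ => (Real.log n) ^ 2 / (n : ℝ)) ∧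
    ((fun n : ℕ => permProb fun σ : Equiv.Perm (cycleWithDiagonals n).edgeSet =>
        ¬ IsOddBipartite (baseIncidence (cycleWithDiagonals n) σ))
      =O[atTop] fun n : ℕ => (Real.log n) ^ 2 / (n : ℝ)) ∧
    ((fun n : ℕ => permProb fun σ : Equiv.Perm (cycleWithDiagonals n).edgeSet =>
        ¬ IsRigid (bipartiteGraph (baseIncidence (cycleWithDiagonals n) σ)))
      =O[atTop] fun n : ℕ => 1 / (n : ℝ)) ∧
    ((fun n : ℕ => permProb fun σ : Equiv.Perm (cycleWithDiagonals n).edgeSet =>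
        ¬ SecondNeighborhoodsDistinct (baseIncidence (cycleWithDiagonals n) σ))
      =O[atTop] fun n : ℕ => 1 / (n : ℝ)) := by
  have hO := isBigO_one_div_of_le (fun _ => permProb_nonneg _)
    (cycleWithDiagonals_induction (N := 100) (fun n V G => permProb (fun σ : Equiv.Perm G.edgeSet =>
      ¬ IsOddBipartite (baseIncidence G σ)) ≤ _ * (1 / (n : ℝ))) (by omega) fun n hn =>
        have : Fact (6 ≤ n) := ⟨by omega⟩
        permProb_not_isOddBipartite_le)
  have hR := isBigO_one_div_of_le (fun _ => permProb_nonneg _)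
    (cycleWithDiagonals_induction (N := 100) (fun n V G => permProb (fun σ : Equiv.Perm G.edgeSet =>
      ¬ IsRigid (bipartiteGraph (baseIncidence G σ))) ≤ _ * (1 / (n : ℝ))) (by omega) fun n hn =>
        have : Fact (6 ≤ n) := ⟨by omega⟩
        permProb_not_isRigid_bipartiteGraph_le hn)
  have hS := isBigO_one_div_of_le (fun _ => permProb_nonneg _)
    (cycleWithDiagonals_induction (N := 100) (fun n V G => permProb (fun σ : Equiv.Perm G.edgeSet =>
      ¬ SecondNeighborhoodsDistinct (baseIncidence G σ)) ≤ _ * (1 / (n : ℝ))) (by omega)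
      fun n hn =>
        have : Fact (6 ≤ n) := ⟨by omega⟩
        permProb_not_secondNeighborhoodsDistinct_le)
  -- Oddness and the multipede also satisfy `O(1/n)`; the logarithmic bounds are weaker.
  refine ⟨IsBigO.trans ?_ one_div_isBigO_log_sq_div, hO.trans one_div_isBigO_log_sq_div, hR, hS⟩
  refine IsBigO.trans (IsBigO.of_bound 1 ?_) (hO.add (hR.add hS))
  filter_upwards [eventually_ge_atTop 100] with n hn
  rw [Real.norm_of_nonneg (permProb_nonneg _), Real.norm_of_nonneg (add_nonneg
    (permProb_nonneg _) (add_nonneg (permProb_nonneg _) (permProb_nonneg _))), one_mul]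
  refine cycleWithDiagonals_induction (N := 100) (fun n V G =>
    permProb (fun σ : Equiv.Perm G.edgeSet => ¬ IsRigid (multipede (baseIncidence G σ))) ≤
    permProb (fun σ : Equiv.Perm G.edgeSet => ¬ IsOddBipartite (baseIncidence G σ)) +
    (permProb (fun σ : Equiv.Perm G.edgeSet => ¬ IsRigid (bipartiteGraph (baseIncidence G σ))) +
    permProb (fun σ : Equiv.Perm G.edgeSet => ¬ SecondNeighborhoodsDistinct (baseIncidence G σ))))
    (by omega) (fun n hn => ?_) n hn
  have : Fact (6 ≤ n) := ⟨by omega⟩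
  exact permProb_not_isRigid_multipede_le
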